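/- **Setting.** Let $L>1$ be odd, $R\ge 1$, and let $\Lambda=(\mathbb Z/L^R\mathbb Z)^2$, with $|x|=\max(|x_0|,|x_1|)$ (representatives of least absolute value), lattice directions $\hat e=\{\pm e_0,\pm e_1\}$ and $\partial^\mu f_x=f_{x+\mu}-f_x$. A sum $\sum_{\mu\in\hat e}$ carries by convention a factor $\frac12$. For $0\le j\le R$, a $j$-block is a translate by $L^j\mathbb Z^2$ of $\{x:|x|\le L^j/2\}$; a $j$-polymer $X$ is a union of $j$-blocks, and $|X|_j$ is the number of its $j$-blocks. Blocks are adjacent if they contain sites at distance $|x-y|=1$; connected polymers are nonempty and connected for this adjacency; $\mathcal S_j$ is the set of connected $j$-polymers with at most $4$ blocks (small polymers). For a $j$-polymer $X$: $X^*$ is the union of the $Y\in\mathcal S_j$ that meet $X$; $\overline X$ is the smallest $(j+1)$-polymer containing $X$; $\partial X$ is the set of sites of $X$ with a nearest neighbour outside $X$. For $n=0,1,2$ put $\|\nabla_j^n f\|_{L^\infty(Y)}=\max_{x\in Y}\max_{\mu_1,\dots,\mu_n\in\hat e} L^{nj}|\partial^{\mu_1}\cdots\partial^{\mu_n}f_x|$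 and $\|f\|_{\mathcal C^2_k(X)}=\max_{n\le 2}\|\nabla_k^n f\|_{L^\infty(X^*)}$, where, for a $j$-polymer $X$, $X^*$ is taken on scale $j$ also when $k=j+1$. Given constants $c_1,c_3,c_0>0$, let $\kappa_L=c_0/\log L$ and define the field regulator of a real field $\varphi$ by $$\ln G_j(\varphi,X)=c_1\kappa_L\sum_{x\in X}\sum_{\mu\in\hat e}|\partial^\mu\varphi_x|^2+c_3\kappa_L L^{j}\sum_{x\in\partial X}\sum_{\mu\in\hat e}|\partial^\mu\varphi_x|^2+c_1\kappa_L\sum_{B\subset X\ j\text{-block}}\|\nabla_j^2\varphi\|^2_{L^\infty(B^*)}.$$ For smooth complex $F$ of the real field $(\varphi_x)_{x\in X^*}$ and $h>1$ let $$\|F(\varphi)\|_{h,T_k(\varphi,X)}=\sum_{n\ge0}\frac{h^n}{n!}\sup_{\|f_i\|_{\mathcal C^2_k(X)}\le1}\Big|\sum_{x_1,\dots,x_n\in X^*}(f_1)_{x_1}\cdots(f_n)_{x_n}\frac{\partial^nF}{\partial\varphi_{x_1}\cdots\partial\varphi_{x_n}}(\varphi)\Big|$$ (complex test functions $f_i$).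 Given $\alpha>0$, a polymer activity $K$ on scale $j$ assigns to each connected $j$-polymer $X$ a smooth complex function $K(\varphi,X)$ of $(\varphi_x)_{x\in X^*}$ with $K(\varphi+\frac{2\pi m}{\alpha},X)=K(\varphi,X)$ for $m\in\mathbb Z$. For $A>1$ put $$\|K\|_{h,T_j}=\sup_{X}A^{|X|_j}\sup_\varphi\frac{\|K(\varphi,X)\|_{h,T_j(\varphi,X)}}{G_j(\varphi,X)},$$ the first supremum being over connected $j$-polymers. The neutral component of $K$ is $\widehat K(0,\varphi,X)=\frac{\alpha}{2\pi}\int_0^{2\pi/\alpha}K(\varphi+s,X)\,ds$. Fix constants $(C_n)_{n\ge1}$ and $c$. For $0\le j<R$, let $\Gamma_j:\Lambda\to\mathbb R$ be positive-definite (possibly degenerate), with $\Gamma_j(x)=0$ for $|x|\ge L^{j+1}/2$; $|\partial^a\Gamma_j(x)|\le C_{|a|}L^{-j|a|}$ for $|x|\le L^{j+1}/2$ and every iterated derivative $\partial^a$ of order $|a|\ge1$; and $|\Gamma_j(0)-\frac1{2\pi}\ln L|\le cL^{-j/4}$. Let $\mathbb E_j$ be the expectation over the centred Gaussian field $\zeta$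 with covariance $\mathbb E_j[\zeta_x\zeta_y]=\Gamma_j(x-y)$, and put $\varphi=\varphi'+\zeta$. For smooth $F$, ${\rm Rem}_2F(\xi)=F(\xi)-\sum_{m\le2}\frac1{m!}D^mF(0)\cdot(\xi,\dots,\xi)$. Let $F_X(\varphi')=\mathbb E_j[\widehat K(0,\varphi'+\zeta,X)]$; for $x_0\in X$ set $(\delta\varphi')_x=\varphi'_x-\varphi'_{x_0}$ and let ${\rm Rem}_2\,\mathbb E_j[\widehat K(0,\varphi,X)]$ denote the function $\varphi'\mapsto({\rm Rem}_2F_X)(\delta\varphi')$. **Theorem.** There is $\vartheta>0$ such that, for all constants $(C_n)$, $c$ and all $c_1,c_3,c_0>0$, there is $L_0$ such that the following holds for every odd $L\ge L_0$, $L>1$, all $0\le j<R$, every $\Gamma_j$ as above, all $h>1$, $A>1$, $\alpha>0$, every polymer activity $K_j$ on scale $j$ with $\|K_j\|_{h,T_j}<\infty$, and every $X\in\mathcal S_j$. For every $\varphi'$ the variable $\widehat K_j(0,\varphi'+\zeta,X)$ is integrable; its expectation is a smooth function of $\varphi'$; and, for every $x_0\in X$ and every real field $\varphi'$ on $\Lambda$,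 $$\big\|{\rm Rem}_2\,\mathbb E_j[\widehat K_j(0,\varphi,X)]\big\|_{h,T_{j+1}(\varphi',X)}\le L^{-(2+\vartheta)}\,\|K_j\|_{h,T_j}\Big(\frac A2\Big)^{-|X|_j}G_{j+1}(\varphi',\overline X).$$ -/

import Mathlib

open MeasureTheory ProbabilityTheory
open scoped ContDiff ENNReal

noncomputable section

namespace CoulombGas

/-! ### The periodic lattice and discrete derivatives -/

/-- The periodic two-dimensional square lattice with `N` sites per side. -/
abbrev Torus (N : ℕ) : Type := Fin 2 → ZMod N

/-- `|x| = max (|x₀|, |x₁|)`, with representatives of the coordinates in `(-N/2, N/2]`. -/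
def supAbs {N : ℕ} (x : Torus N) : ℕ :=
  Finset.univ.sup fun i => (x i).valMinAbs.natAbs

/-- Labels of the four lattice directions: `(i, true)` is `+eᵢ` and `(i, false)` is `-eᵢ`. -/
abbrev Dir : Type := Fin 2 × Bool

/-- The unit vector belonging to a direction. -/
def unitVec {N : ℕ} (μ : Dir) : Torus N :=
  if μ.2 then Pi.single μ.1 1 else -Pi.single μ.1 1

/-- The discrete derivative `(∂^μ f)(x) = f (x + μ) - f x`. -/
def diff {N : ℕ} {E : Type*} [Sub E] (μ : Dir) (f : Torus N → E) : Torus N → E :=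
  fun x => f (x + unitVec μ) - f x

/-- The iterated discrete derivative `∂^{μ₁} ⋯ ∂^{μₙ} f`. -/
def iterDiff {N : ℕ} {E : Type*} [Sub E] (μs : List Dir) (f : Torus N → E) : Torus N → E :=
  μs.foldr diff f

/-! ### Blocks and polymers -/

section Polymers

variable {N : ℕ} [NeZero N]

open Classical in
/-- The translate by `L^j k`, `k ∈ ℤ²`, of the central square `{x : |x| ≤ L^j / 2}`. -/
def block (N L j : ℕ) [NeZero N] (k : Fin 2 → ℤ) : Finset (Torus N) :=
  Finset.univ.filter fun x =>
    2 * supAbs (x - fun i => (((L : ℤ) ^ j * k i : ℤ) : ZMod N)) ≤ L ^ j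

open Classical in
/-- The set of all `j`-blocks. -/
def blocks (N L j : ℕ) [NeZero N] : Finset (Finset (Torus N)) :=
  Finset.univ.filter fun B => ∃ k : Fin 2 → ℤ, B = block N L j k

open Classical in
/-- The `j`-blocks contained in `X`. -/
def blocksIn (L j : ℕ) (X : Finset (Torus N)) : Finset (Finset (Torus N)) :=
  (blocks N L j).filter fun B => B ⊆ X

open Classical in
/-- `X` is a `j`-polymer: a union of `j`-blocks. -/
def IsPolymer (L j : ℕ) (X : Finset (Torus N)) : Prop :=
  (blocksIn L j X).biUnion id = X

/-- `|X|_j`, the number of `j`-blocks in `X`. -/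
def blockCount (L j : ℕ) (X : Finset (Torus N)) : ℕ :=
  (blocksIn L j X).card

/-- Two blocks touch: they contain sites at distance one in the maximum norm. -/
def Touch (B D : Finset (Torus N)) : Prop :=
  ∃ x ∈ B, ∃ y ∈ D, supAbs (x - y) = 1

/-- `X` is a connected `j`-polymer (nonempty by convention). -/
def IsConnPolymer (L j : ℕ) (X : Finset (Torus N)) : Prop :=
  X.Nonempty ∧ IsPolymer L j X ∧
    ∀ B ∈ blocksIn L j X, ∀ D ∈ blocksIn L j X,
      Relation.ReflTransGen
        (fun B' D' => B' ∈ blocksIn L j X ∧ D' ∈ blocksIn L j X ∧ Touch B' D') B D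

/-- `X` is a small `j`-polymer: connected and made of at most four `j`-blocks. -/
def IsSmall (L j : ℕ) (X : Finset (Torus N)) : Prop :=
  IsConnPolymer L j X ∧ blockCount L j X ≤ 4

open Classical in
/-- The small set neighbourhood `X^*` on scale `j`: the union of the small `j`-polymers
that intersect `X`. -/
def star (L j : ℕ) (X : Finset (Torus N)) : Finset (Torus N) :=
  Finset.univ.filter fun x => ∃ Y, IsSmall L j Y ∧ x ∈ Y ∧ ∃ y ∈ Y, y ∈ X

open Classical in
/-- The union of the `k`-blocks that meet `X`, i.e. the smallest `k`-polymer containing `X`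
(the `k`-blocks partition the lattice). For a `j`-polymer `X` and `k = j + 1` it is the
closure of `X`. -/
def closure (L k : ℕ) (X : Finset (Torus N)) : Finset (Torus N) :=
  ((blocks N L k).filter fun D => ∃ x ∈ D, x ∈ X).biUnion id

open Classical in
/-- The sites of `X` with a nearest neighbour outside `X`. -/
def boundary (X : Finset (Torus N)) : Finset (Torus N) :=
  X.filter fun x => ∃ μ : Dir, x + unitVec μ ∉ X

end Polymers

/-! ### Norms of fields and the field regulator -/

section Norms

variable {N : ℕ} [NeZero N]

/-- `‖∇_j^n f‖_{L^∞(Y)}`, the maximum over `x ∈ Y` and over all `n`-tuples of directions of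
`L^{nj} |∂^{μ₁} ⋯ ∂^{μₙ} f(x)|`. -/
def gradSup {E : Type*} [NormedAddCommGroup E] (L j n : ℕ) (f : Torus N → E)
    (Y : Finset (Torus N)) : ℝ :=
  ⨆ x : {x // x ∈ Y}, ⨆ μ : Fin n → Dir,
    (L : ℝ) ^ (n * j) * ‖iterDiff (List.ofFn μ) f x.1‖

/-- The `C²`-norm on scale `k`, with the maximum taken over the set of sites `Y`. -/
def c2Norm {E : Type*} [NormedAddCommGroup E] (L k : ℕ) (f : Torus N → E)
    (Y : Finset (Torus N)) : ℝ :=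
  max (gradSup L k 0 f Y) (max (gradSup L k 1 f Y) (gradSup L k 2 f Y))

/-- `‖∇_j φ‖²_{L²_j(X)} = L^{-2j} ∑_{x ∈ X} ∑_μ L^{2j} |∂^μ φ(x)|²`. A sum over the four
directions carries a factor `1/2`. -/
def gradL2Sq (L j : ℕ) (φ : Torus N → ℝ) (X : Finset (Torus N)) : ℝ :=
  ((L : ℝ) ^ (2 * j))⁻¹ *
    ∑ x ∈ X, (1 / 2 : ℝ) * ∑ μ : Dir, (L : ℝ) ^ (2 * j) * (diff μ φ x) ^ 2

/-- `‖∇_j φ‖²_{L²_j(∂X)} = L^{-j} ∑_{x ∈ ∂X} ∑_μ L^{2j} |∂^μ φ(x)|²`, with the same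
convention. -/
def gradL2BdrySq (L j : ℕ) (φ : Torus N → ℝ) (X : Finset (Torus N)) : ℝ :=
  ((L : ℝ) ^ j)⁻¹ *
    ∑ x ∈ boundary X, (1 / 2 : ℝ) * ∑ μ : Dir, (L : ℝ) ^ (2 * j) * (diff μ φ x) ^ 2

/-- `W_j(∇_j² φ, X)²`, the sum over the `j`-blocks `B` of `X` of `‖∇_j² φ‖²_{L^∞(B^*)}`. -/
def hessWSq (L j : ℕ) (φ : Torus N → ℝ) (X : Finset (Torus N)) : ℝ :=
  ∑ B ∈ blocksIn L j X, (gradSup L j 2 φ (star L j B)) ^ 2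

/-- The field regulator `G_j(φ, X)`. -/
def regulator (c₁ c₃ κ : ℝ) (L j : ℕ) (φ : Torus N → ℝ) (X : Finset (Torus N)) : ℝ :=
  Real.exp (c₁ * κ * gradL2Sq L j φ X + c₃ * κ * gradL2BdrySq L j φ X
    + c₁ * κ * hessWSq L j φ X)

/-- `κ_L = c / log L`. -/
def kappa (c : ℝ) (L : ℕ) : ℝ := c / Real.log L

end Norms

/-! ### Norms of polymer activities -/

section Activities

variable {N : ℕ} [NeZero N]

/-- `D^n F(φ) · (f₁, …, fₙ) = ∑_{x₁, …, xₙ ∈ Y} f₁(x₁) ⋯ fₙ(xₙ) ∂ⁿF/∂φ_{x₁}⋯∂φ_{xₙ} (φ)`, for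
complex-valued directions `fᵢ`. -/
def dirDeriv (Y : Finset (Torus N)) (F : (Torus N → ℝ) → ℂ) (φ : Torus N → ℝ) (n : ℕ)
    (f : Fin n → Torus N → ℂ) : ℂ :=
  ∑ x ∈ Fintype.piFinset (fun _ : Fin n => Y),
    (∏ i, f i (x i)) * iteratedFDeriv ℝ n F φ (fun i => Pi.single (x i) (1 : ℝ))

/-- `‖F(φ)‖_{T^n_k(φ)}`: the supremum of `|D^n F(φ) · (f₁, …, fₙ)|` over directions whose
`C²`-norm on scale `k`, taken over the set of sites `Y`, is at most one. -/
def tNormN (L k : ℕ) (Y : Finset (Torus N)) (F : (Torus N → ℝ) → ℂ) (φ : Torus N → ℝ)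
    (n : ℕ) : ℝ≥0∞ :=
  ⨆ f : Fin n → Torus N → ℂ, ⨆ _ : ∀ i, c2Norm L k (f i) Y ≤ 1,
    ENNReal.ofReal ‖dirDeriv Y F φ n f‖

/-- `‖F(φ)‖_{h, T_k(φ)} = ∑ₙ hⁿ / n! ‖F(φ)‖_{T^n_k(φ)}`, infinite when the series diverges. -/
def tNorm (h : ℝ) (L k : ℕ) (Y : Finset (Torus N)) (F : (Torus N → ℝ) → ℂ)
    (φ : Torus N → ℝ) : ℝ≥0∞ :=
  ∑' n : ℕ, ENNReal.ofReal (h ^ n / (n.factorial : ℝ)) * tNormN L k Y F φ n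

/-- `‖F‖_{h, T_j(X)}`: the supremum over the field of `‖F(φ)‖_{h, T_j(φ, X)} / G_j(φ, X)`, for
a `j`-polymer `X`. -/
def activityNormOn (c₁ c₃ κ h : ℝ) (L j : ℕ) (X : Finset (Torus N))
    (F : (Torus N → ℝ) → ℂ) : ℝ≥0∞ :=
  ⨆ φ : Torus N → ℝ,
    tNorm h L j (star L j X) F φ / ENNReal.ofReal (regulator c₁ c₃ κ L j φ X)

/-- `‖K‖_{h, T_j}`: the supremum over connected `j`-polymers of `A^{|X|_j} ‖K(X)‖_{h, T_j(X)}`. -/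
def activityNorm (c₁ c₃ κ h A : ℝ) (L j : ℕ)
    (K : Finset (Torus N) → (Torus N → ℝ) → ℂ) : ℝ≥0∞ :=
  ⨆ X : Finset (Torus N), ⨆ _ : IsConnPolymer L j X,
    ENNReal.ofReal (A ^ blockCount L j X) * activityNormOn c₁ c₃ κ h L j X (K X)

/-- `K` is a polymer activity on scale `j`: for each connected `j`-polymer `X`, the function
`K X` is smooth, depends on the field in `X^*` only, and is invariant under translation of the
field by the constants `2πm/α`, `m ∈ ℤ`. -/
structure IsActivity (α : ℝ) (L j : ℕ) (K : Finset (Torus N) → (Torus N → ℝ) → ℂ) : Prop where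
  smooth : ∀ X, IsConnPolymer L j X → ContDiff ℝ ∞ (K X)
  isLocal : ∀ X, IsConnPolymer L j X → ∀ φ ψ : Torus N → ℝ,
    (∀ x ∈ star L j X, φ x = ψ x) → K X φ = K X ψ
  periodic : ∀ X, IsConnPolymer L j X → ∀ (φ : Torus N → ℝ) (m : ℤ),
    K X (fun x => φ x + 2 * Real.pi * m / α) = K X φ

/-- The component of charge `q` of a function of the field,
`α / 2π ∫₀^{2π/α} F(φ + s) e^{-iqαs} ds`. -/
def chargedComponent (α : ℝ) (q : ℤ) (F : (Torus N → ℝ) → ℂ) (φ : Torus N → ℝ) : ℂ :=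
  ((α / (2 * Real.pi) : ℝ) : ℂ) *
    ∫ s in (0 : ℝ)..(2 * Real.pi / α),
      F (fun x => φ x + s) * Complex.exp (-(Complex.I * q * α * s))

/-- The Taylor polynomial of order `n` of `F` at the zero field. -/
def tay (n : ℕ) (F : (Torus N → ℝ) → ℂ) (ξ : Torus N → ℝ) : ℂ :=
  ∑ m ∈ Finset.range (n + 1), ((m.factorial : ℂ))⁻¹ * iteratedFDeriv ℝ m F 0 (fun _ => ξ)

/-- The Taylor remainder of order `n` of `F` at the zero field. -/
def rem (n : ℕ) (F : (Torus N → ℝ) → ℂ) (ξ : Torus N → ℝ) : ℂ := F ξ - tay n F ξ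

/-- `(δφ)(x) = φ(x) - φ(x₀)`. -/
def delta (x₀ : Torus N) (φ : Torus N → ℝ) : Torus N → ℝ := fun x => φ x - φ x₀

end Activities

/-! ### The fluctuation field -/

section Fluctuation

variable {N : ℕ} [NeZero N]

/-- `Γ` is an admissible covariance of the fluctuation field on scale `j`, with constants `C`
(indexed by the order of the derivative) and `c`: it is positive-definite (possibly degenerate),
it has range `L^{j+1} / 2`, its derivatives of positive order `n` are at most `C n * L^{-jn}`,
and `Γ(0)` is `(1 / 2π) log L` up to an error `c L^{-j/4}`. -/
structure IsFluctuationCovariance (L j : ℕ) (C : ℕ → ℝ) (c : ℝ) (Γ : Torus N → ℝ) :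
    Prop where
  posSemidef : (Matrix.circulant Γ).PosSemidef
  finiteRange : ∀ x, L ^ (j + 1) ≤ 2 * supAbs x → Γ x = 0
  deriv_le : ∀ a : List Dir, a ≠ [] → ∀ x, 2 * supAbs x ≤ L ^ (j + 1) →
    |iterDiff a Γ x| ≤ C a.length * ((L : ℝ) ^ (j * a.length))⁻¹
  atZero : |Γ 0 - 1 / (2 * Real.pi) * Real.log L| ≤ c * (L : ℝ) ^ (-((j : ℝ) / 4))

/-- The centred Gaussian law `dP` of the fluctuation field `ζ` with covariance
`𝔼[ζ_x ζ_y] = Γ(x - y)`. -/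
def fluctuationMeasure (Γ : Torus N → ℝ) : Measure (EuclideanSpace ℝ (Torus N)) :=
  multivariateGaussian 0 (Matrix.circulant Γ)

/-- The fluctuation expectation `𝔼[F(φ' + ζ)]` as a function of the field `φ'`. -/
def fluctuationExp (Γ : Torus N → ℝ) (F : (Torus N → ℝ) → ℂ) (φ' : Torus N → ℝ) : ℂ :=
  ∫ ζ, F (fun x => φ' x + ζ x) ∂(fluctuationMeasure Γ)

end Fluctuation

end CoulombGas

end

/-! The remainder sees $\varphi'$ and every test direction only through $\delta$. For a small
polymer, $\delta f$ measured on scale $j$ is $20/L$ times smaller than $f$ measured on scale $j+1$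
(`IsSmall.c2Norm_delta_le`): its value on $X^*$ is an oscillation over a distance of order $L^j$,
and derivatives carry powers of the scale. A second order Taylor remainder yields at least three
such factors. For $n\ge 3$ derivatives all $n$ come from the test directions. For $n<3$ the
remainder is recovered from the third derivative by integrating along $t\,\delta\varphi'$, so $3-n$
of the factors come from $\delta\varphi'$ itself (`norm_iteratedFDeriv_taylorRem_le`). This gives
$L^{-3}$ times a power at most $3$ of $D$, the scale $j+1$ gradient norm of $\varphi'$ on $X^*$.

Two things have to be paid for. First, the fluctuation integral: $\ln G_j$ is a positive quadratic
form in derivatives, so $G_j(\varphi'+\zeta)\le G_j(\varphi')^2G_j(\zeta)^2$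
(`logRegulator_add_le`). The scaled derivatives of $\zeta$ are Gaussian with variance bounded
uniformly in $L$ and $j$. An exponential Orlicz norm, subadditive and combined with a discrete
Sobolev inequality for the suprema, bounds $\ln G_j(\zeta)$ by $O(\kappa_L)$ in that norm. Since
$\kappa_L\to0$, $G_j(\zeta)^2$ has a majorant of expectation at most $2$ for large $L$
(`IsSmall.exists_fluctuation_weight`).

Second, the factor $G_j(t\,\delta\varphi')^2$ and the powers of $D$. The former is at most
$\exp(O(\kappa_L)D^2/L^2)$ (`IsSmall.logRegulator_le`), while $D^2$ is at most $72$ times the bulk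
gradient and Hessian terms on $\overline X$ (`IsSmall.gradNorm_sq_le`). Hence $\exp(aD^2)\le
G_{j+1}(\varphi',\overline X)$ with $a=c_1\kappa_L/72$. Half of this exponential absorbs $G_j^2$;
the other half absorbs $1+D^4$ at a cost of order $a^{-2}\sim(\log L)^2$.

The total is a constant times $L^{-3}(\log L)^2$, which is below $L^{-5/2}$ for large $L$; so
$\vartheta=\frac12$. `IsSmall.tNorm_rem_le` carries out the contraction. -/

noncomputable section

set_option linter.unusedSectionVars false
set_option maxSynthPendingDepth 3

namespace CoulombGas

/-! ### Sites as integer vectors modulo `N`; blocks and their neighbours. -/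

section Geometry

variable {N : ℕ}

/-- The site of the torus represented by an integer vector. -/
def site (N : ℕ) (z : Fin 2 → ℤ) : Torus N := fun i => (z i : ZMod N)

lemma site_add (z w : Fin 2 → ℤ) : site N (z + w) = site N z + site N w := by
  ext i; simp [site]

lemma site_sub (z w : Fin 2 → ℤ) : site N (z - w) = site N z - site N w := by
  ext i; simp [site]

lemma site_surjective (x : Torus N) : ∃ z, site N z = x :=
  ⟨fun i => (x i).valMinAbs, by ext i; simp [site]⟩

lemma unitVec_pos (i : Fin 2) : unitVec (N := N) (i, true) = site N (Pi.single i 1) := by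
  ext k; by_cases h : k = i
  · subst h; simp [unitVec, site]
  · simp [unitVec, site, h]

lemma unitVec_neg (i : Fin 2) : unitVec (N := N) (i, false) = site N (-Pi.single i 1) := by
  ext k; by_cases h : k = i
  · subst h; simp [unitVec, site]
  · simp [unitVec, site, h]

lemma unitVec_eq_site (μ : Dir) :
    ∃ e : Fin 2 → ℤ, unitVec (N := N) μ = site N e ∧ ∀ i, |e i| ≤ 1 := by
  obtain ⟨i, b⟩ := μ
  cases b
  · refine ⟨_, unitVec_neg i, fun k => ?_⟩
    by_cases h : k = i
    · subst h; simp
    · simp [h]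
  · refine ⟨_, unitVec_pos i, fun k => ?_⟩
    by_cases h : k = i
    · subst h; simp
    · simp [h]

lemma site_eq_iff {z w : Fin 2 → ℤ} : site N z = site N w ↔ ∀ i, (N : ℤ) ∣ z i - w i := by
  simp only [site, funext_iff]
  refine forall_congr' fun i => ?_
  rw [eq_comm, ZMod.intCast_eq_intCast_iff_dvd_sub]

lemma supAbs_le_iff {x : Torus N} {n : ℕ} :
    supAbs x ≤ n ↔ ∀ i, (x i).valMinAbs.natAbs ≤ n := by
  simp [supAbs]

/-- A representative in $(-N/2,N/2]$ has least absolute value in its class: shifting it by a nonzero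
multiple of $N$ cannot bring it closer to zero. -/
lemma natAbs_valMinAbs_intCast_le [NeZero N] (z : ℤ) :
    ((z : ZMod N)).valMinAbs.natAbs ≤ z.natAbs := by
  set v := ((z : ZMod N)).valMinAbs with hv
  have h1 : ((v : ℤ) : ZMod N) = z := by simp [hv]
  have h2 := ZMod.valMinAbs_mem_Ioc (z : ZMod N)
  rw [← hv] at h2
  rw [ZMod.intCast_eq_intCast_iff_dvd_sub] at h1
  obtain ⟨t, ht⟩ := h1
  obtain ⟨h3, h4⟩ := h2
  have hN : (0 : ℤ) < N := by exact_mod_cast Nat.pos_of_ne_zero (NeZero.ne N)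
  by_contra hcon
  push Not at hcon
  have hc : |z| < |v| := by rw [Int.abs_eq_natAbs, Int.abs_eq_natAbs]; exact_mod_cast hcon
  rcases lt_trichotomy t 0 with h | h | h
  · have : (N : ℤ) * t ≤ -N := by nlinarith
    grind
  · subst h; simp at ht; have : z = v := by linarith
    rw [this] at hc; exact lt_irrefl _ hc
  · have : (N : ℤ) ≤ N * t := by nlinarith
    grind

lemma supAbs_site_le [NeZero N] {z : Fin 2 → ℤ} {n : ℕ} (h : ∀ i, |z i| ≤ n) :
    supAbs (site N z) ≤ n := by
  rw [supAbs_le_iff]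
  intro i
  refine (natAbs_valMinAbs_intCast_le (z i)).trans ?_
  have := h i
  rw [Int.abs_eq_natAbs] at this
  exact_mod_cast this

lemma exists_site_of_supAbs_le {x : Torus N} {n : ℕ} (h : supAbs x ≤ n) :
    ∃ z : Fin 2 → ℤ, x = site N z ∧ ∀ i, |z i| ≤ n := by
  refine ⟨fun i => (x i).valMinAbs, by ext i; simp [site], fun i => ?_⟩
  have := supAbs_le_iff.1 h i
  rw [Int.abs_eq_natAbs]
  exact_mod_cast this

lemma supAbs_neg (x : Torus N) : supAbs (-x) = supAbs x := by
  simp [supAbs, ZMod.natAbs_valMinAbs_neg]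

lemma supAbs_eq_zero_iff [NeZero N] {x : Torus N} : supAbs x = 0 ↔ x = 0 := by
  rw [← Nat.le_zero, supAbs_le_iff]
  simp [funext_iff]

lemma Touch.symm {B D : Finset (Torus N)} (h : Touch B D) : Touch D B := by
  obtain ⟨x, hx, y, hy, hxy⟩ := h
  refine ⟨y, hy, x, hx, ?_⟩
  rw [← supAbs_neg, neg_sub, hxy]

variable [NeZero N] {L j : ℕ}

lemma mem_block {k : Fin 2 → ℤ} {x : Torus N} :
    x ∈ block N L j k ↔ ∃ r : Fin 2 → ℤ, (∀ i, 2 * |r i| ≤ (L : ℤ) ^ j) ∧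
      x = site N ((L : ℤ) ^ j • k + r) := by
  have hc : (fun i => (((L : ℤ) ^ j * k i : ℤ) : ZMod N)) = site N ((L : ℤ) ^ j • k) := by
    ext i; simp [site]
  simp only [block, Finset.mem_filter, Finset.mem_univ, true_and]
  rw [hc]
  constructor
  · intro h
    obtain ⟨r, hr, hle⟩ := exists_site_of_supAbs_le (le_refl (supAbs (x - site N ((L : ℤ) ^ j • k))))
    refine ⟨r, fun i => ?_, ?_⟩
    · have h' : (2 : ℤ) * supAbs (x - site N ((L : ℤ) ^ j • k)) ≤ (L : ℤ) ^ j := by exact_mod_cast h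
      linarith [hle i]
    · rw [site_add, ← hr]; abel
  · rintro ⟨r, hr, rfl⟩
    rw [site_add, add_sub_cancel_left]
    have : supAbs (site N r) ≤ L ^ j / 2 := by
      apply supAbs_site_le
      intro i
      have := hr i
      push_cast
      omega
    omega

lemma center_mem_block (k : Fin 2 → ℤ) : site N ((L : ℤ) ^ j • k) ∈ block N L j k :=
  mem_block.2 ⟨0, by simp, by simp⟩

lemma block_mem_blocks (k : Fin 2 → ℤ) : block N L j k ∈ blocks N L j := by
  simp [blocks]

lemma exists_of_mem_blocksIn {X B : Finset (Torus N)} (h : B ∈ blocksIn L j X) :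
    B ⊆ X ∧ ∃ k, B = block N L j k := by
  simpa [blocksIn, blocks, and_comm] using h

lemma block_mem_blocksIn {X : Finset (Torus N)} {k : Fin 2 → ℤ} (h : block N L j k ⊆ X) :
    block N L j k ∈ blocksIn L j X := by
  simp [blocksIn, block_mem_blocks, h]

lemma block_congr {k k' : Fin 2 → ℤ}
    (h : site N ((L : ℤ) ^ j • k) = site N ((L : ℤ) ^ j • k')) :
    block N L j k = block N L j k' := by
  ext x
  simp only [mem_block, site_add, h]

/-- Oddness of $L^j$ excludes ties on block edges. This strict gain is what makes the blocks
disjoint. -/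
lemma odd_two_mul_le {m r : ℤ} (hm : Odd m) (h : 2 * |r| ≤ m) : 2 * |r| ≤ m - 1 := by
  obtain ⟨t, rfl⟩ := hm
  omega

lemma pow_odd (hL : Odd L) : Odd ((L : ℤ) ^ j) := by
  have : Odd (L : ℤ) := by exact_mod_cast hL
  exact this.pow

/-- Sites in two blocks that differ by a vector of size at most one lie in blocks with
neighbouring labels. -/
lemma exists_shift_of_near (hL : Odd L) (hd : L ^ j ∣ N) {k k' r r' e : Fin 2 → ℤ} {n : ℕ}
    (hr : ∀ i, 2 * |r i| ≤ (L : ℤ) ^ j) (hr' : ∀ i, 2 * |r' i| ≤ (L : ℤ) ^ j)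
    (he : ∀ i, |e i| ≤ n) (hn : n ≤ 1)
    (h : site N ((L : ℤ) ^ j • k + r) = site N ((L : ℤ) ^ j • k' + r') + site N e) :
    ∃ d : Fin 2 → ℤ, (∀ i, |d i| ≤ n) ∧ block N L j k = block N L j (k' + d) ∧
      e + r' - r = (L : ℤ) ^ j • d := by
  rw [← site_add, site_eq_iff] at h
  have hdZ : (L : ℤ) ^ j ∣ N := by exact_mod_cast hd
  -- Since $L^j$ divides $N$, equality on the torus forces congruence modulo $L^j$, and the block
  -- labels drop out.
  have h1 : ∀ i, (L : ℤ) ^ j ∣ e i + r' i - r i := by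
    intro i
    have := hdZ.trans (h i)
    simp only [Pi.add_apply, Pi.smul_apply, smul_eq_mul] at this
    have h2 : e i + r' i - r i = (L : ℤ) ^ j * (k i - k' i)
      - ((L : ℤ) ^ j * k i + r i - ((L : ℤ) ^ j * k' i + r' i + e i)) := by ring
    rw [h2]
    exact dvd_sub (dvd_mul_right _ _) this
  choose d hd' using h1
  refine ⟨d, fun i => ?_, ?_, ?_⟩
  · have h1 := odd_two_mul_le (pow_odd hL) (hr i)
    have h2 := odd_two_mul_le (pow_odd hL) (hr' i)
    have h3 := hd' i
    have h4 := he i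
    have hpos : 0 < (L : ℤ) ^ j := by
      have : 0 < L := hL.pos
      positivity
    -- Each offset is at most $(L^j-1)/2$. The total is therefore below $L^j(n+1)$, and $|d_i|\ge
    -- n+1$ is impossible.
    have h5 : |e i + r' i - r i| ≤ n + ((L : ℤ) ^ j - 1) := by grind
    rw [h3, abs_mul, abs_of_pos hpos] at h5
    by_contra hcon
    push Not at hcon
    have hn' : (n : ℤ) ≤ 1 := by exact_mod_cast hn
    have h6 : (n : ℤ) + 1 ≤ |d i| := hcon
    have h7 : (L : ℤ) ^ j * (n + 1) ≤ (L : ℤ) ^ j * |d i| := by gcongr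
    have h8 : (0 : ℤ) ≤ n := by positivity
    nlinarith
  · apply block_congr
    rw [site_eq_iff]
    intro i
    have h1 := h i
    have h2 := hd' i
    simp only [Pi.add_apply, Pi.smul_apply, smul_eq_mul] at h1 ⊢
    have h3 : (L : ℤ) ^ j * k i - (L : ℤ) ^ j * (k' i + d i)
      = (L : ℤ) ^ j * k i + r i - ((L : ℤ) ^ j * k' i + r' i + e i) := by linear_combination h2
    rw [h3]; exact h1
  · ext i; simpa using hd' i

/-- Displacement zero in `exists_shift_of_near`. The conclusion concerns the blocks and not the
labels, since labels are only determined modulo the torus. -/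
lemma block_eq_of_mem (hL : Odd L) (hd : L ^ j ∣ N) {k k' : Fin 2 → ℤ} {x : Torus N}
    (h : x ∈ block N L j k) (h' : x ∈ block N L j k') : block N L j k = block N L j k' := by
  obtain ⟨r, hr, hx⟩ := mem_block.1 h
  obtain ⟨r', hr', hx'⟩ := mem_block.1 h'
  obtain ⟨d, hd0, hb, -⟩ := exists_shift_of_near (N := N) (e := 0) (n := 0) (k := k)
    (k' := k') hL hd hr hr' (by simp) (by simp) (by rw [← hx, hx']; ext i; simp [site])
  have : d = 0 := by ext i; simpa using hd0 i
  rw [hb, this, add_zero]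

lemma Touch.exists_shift (hL : Odd L) (hd : L ^ j ∣ N) {k k' : Fin 2 → ℤ}
    (h : Touch (block N L j k) (block N L j k')) :
    ∃ d : Fin 2 → ℤ, (∀ i, |d i| ≤ 1) ∧ block N L j k' = block N L j (k + d) := by
  obtain ⟨y, hy, x, hx, hxy⟩ := h
  obtain ⟨r, hr, rfl⟩ := mem_block.1 hx
  obtain ⟨r', hr', rfl⟩ := mem_block.1 hy
  rw [← supAbs_neg, neg_sub] at hxy
  obtain ⟨e, he, hle⟩ := exists_site_of_supAbs_le hxy.le
  obtain ⟨d, hd0, hb, -⟩ := exists_shift_of_near (N := N) (e := e) (n := 1) hL hd hr hr' hle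
    le_rfl (by rw [← he]; abel)
  exact ⟨d, by simpa using hd0, hb⟩

lemma touch_shift (hL : Odd L) (hN : 3 ≤ N) (k : Fin 2 → ℤ) {d : Fin 2 → ℤ}
    (hd : ∀ i, |d i| ≤ 1) (hne : d ≠ 0) : Touch (block N L j k) (block N L j (k + d)) := by
  obtain ⟨ρ, hρ⟩ := pow_odd (j := j) hL
  have hρ0 : 0 ≤ ρ := by
    have : 0 < (L : ℤ) ^ j := by
      have : 0 < L := hL.pos
      positivity
    omega
  have hb : ∀ i, |ρ * d i| ≤ ρ := by
    intro i
    rw [abs_mul, abs_of_nonneg hρ0]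
    nlinarith [hd i]
  -- The facing sites have offsets $\rho d$ and $-\rho d$. As $L^j=2\rho+1$, they differ by exactly
  -- $-d$.
  refine ⟨_, mem_block.2 ⟨ρ • d, fun i => ?_, rfl⟩, _, mem_block.2 ⟨-ρ • d, fun i => ?_, rfl⟩, ?_⟩
  · have := hb i; simp only [Pi.smul_apply, smul_eq_mul]; omega
  · have := hb i; simp only [Pi.smul_apply, smul_eq_mul, neg_mul, abs_neg]; omega
  rw [← site_sub]
  have : (L : ℤ) ^ j • k + ρ • d - ((L : ℤ) ^ j • (k + d) + -ρ • d) = -d := by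
    ext i; simp [hρ]; ring
  rw [this]
  apply le_antisymm
  · exact supAbs_site_le (by simpa using hd)
  · rw [Nat.one_le_iff_ne_zero, Ne, supAbs_eq_zero_iff]
    intro h0
    apply hne
    have h0' : site N (-d) = site N 0 := by rw [h0]; ext i; simp [site]
    rw [site_eq_iff] at h0'
    ext i
    have h1 := Int.eq_zero_of_abs_lt_dvd (h0' i) (by
      have := hd i
      have : (3 : ℤ) ≤ N := by exact_mod_cast hN
      simp; omega)
    simpa using h1

lemma exists_block_of_mem {X : Finset (Torus N)} (hX : IsPolymer L j X) {x : Torus N}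
    (hx : x ∈ X) : ∃ k, x ∈ block N L j k ∧ block N L j k ⊆ X := by
  rw [← hX] at hx
  simp only [Finset.mem_biUnion, id] at hx
  obtain ⟨B, hB, hxB⟩ := hx
  obtain ⟨hs, k, rfl⟩ := exists_of_mem_blocksIn hB
  exact ⟨k, hxB, hs⟩

/-- Every site lies in some block. -/
lemma exists_mem_block (hL : Odd L) (x : Torus N) : ∃ k, x ∈ block N L j k := by
  obtain ⟨z, rfl⟩ := site_surjective x
  obtain ⟨ρ, hρ⟩ := pow_odd (j := j) hL
  have hpos : 0 < (L : ℤ) ^ j := by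
    have : 0 < L := hL.pos
    positivity
  refine ⟨fun i => (z i + ρ) / (L : ℤ) ^ j,
    mem_block.2 ⟨fun i => (z i + ρ) % (L : ℤ) ^ j - ρ, fun i => ?_, ?_⟩⟩
  · have h1 := Int.emod_nonneg (z i + ρ) hpos.ne'
    have h2 := Int.emod_lt_of_pos (z i + ρ) hpos
    grind
  · congr 1; ext i
    have := Int.mul_ediv_add_emod (z i + ρ) ((L : ℤ) ^ j)
    simp only [Pi.add_apply, Pi.smul_apply, smul_eq_mul]
    linarith

end Geometry

/-! ### Block counting, chains of blocks, and the extent of `X^*`. -/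

section Polymers

variable {N : ℕ} [NeZero N] {L j : ℕ}

lemma pow_pos_of_odd (hL : Odd L) : 0 < (L : ℤ) ^ j := by
  have : 0 < L := hL.pos
  positivity

/-- The integer vectors with entries at most `ρ` in absolute value. -/
def box (ρ : ℕ) : Finset (Fin 2 → ℤ) := Fintype.piFinset fun _ => Finset.Icc (-(ρ : ℤ)) ρ

lemma mem_box {ρ : ℕ} {r : Fin 2 → ℤ} : r ∈ box ρ ↔ ∀ i, |r i| ≤ ρ := by
  simp [box, abs_le]

lemma card_box (ρ : ℕ) : (box ρ).card = (2 * ρ + 1) ^ 2 := by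
  simp [box]
  omega

lemma exists_half (hL : Odd L) : ∃ ρ : ℕ, L ^ j = 2 * ρ + 1 ∧
    ∀ r : Fin 2 → ℤ, (∀ i, 2 * |r i| ≤ (L : ℤ) ^ j) ↔ r ∈ box ρ := by
  obtain ⟨ρ, hρ⟩ := hL.pow (n := j)
  refine ⟨ρ, hρ, fun r => ?_⟩
  have : (L : ℤ) ^ j = 2 * ρ + 1 := by exact_mod_cast hρ
  rw [mem_box, this]
  refine forall_congr' fun i => ?_
  omega

lemma card_block (hL : Odd L) (hd : L ^ j ∣ N) (k : Fin 2 → ℤ) :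
    (block N L j k).card = (L ^ j) ^ 2 := by
  obtain ⟨ρ, hρ, hbox⟩ := exists_half (j := j) hL
  have : block N L j k = (box ρ).image fun r => site N ((L : ℤ) ^ j • k + r) := by
    ext x
    simp only [mem_block, Finset.mem_image, hbox]
    exact exists_congr fun r => by rw [eq_comm (a := x)]
  rw [this, Finset.card_image_of_injOn, card_box, hρ]
  intro r hr r' hr' h
  simp only [site_add, add_right_inj] at h
  rw [site_eq_iff] at h
  ext i
  have hlt : |r i - r' i| < N := by
    have h1 := mem_box.1 hr i
    have h2 := mem_box.1 hr' i
    have h3 : ((L ^ j : ℕ) : ℤ) ≤ N := by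
      exact_mod_cast Nat.le_of_dvd (Nat.pos_of_ne_zero (NeZero.ne N)) hd
    rw [hρ] at h3
    push_cast at h3
    grind
  exact sub_eq_zero.1 (Int.eq_zero_of_abs_lt_dvd (h i) hlt)

lemma card_le_of_isPolymer (hL : Odd L) (hd : L ^ j ∣ N) {X : Finset (Torus N)}
    (hX : IsPolymer L j X) : X.card ≤ blockCount L j X * (L ^ j) ^ 2 := by
  conv_lhs => rw [← hX]
  apply Finset.card_biUnion_le_card_mul
  intro B hB
  obtain ⟨-, k, rfl⟩ := exists_of_mem_blocksIn hB
  exact (card_block hL hd k).le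

/-- A site strictly inside its block has all its neighbours in that block, so boundary sites of $X$
lie on the rims of its blocks, each rim having at most $4L^j$ sites. -/
lemma card_boundary_le (hL : Odd L) {X : Finset (Torus N)}
    (hX : IsPolymer L j X) : (boundary X).card ≤ blockCount L j X * (4 * L ^ j) := by
  classical
  obtain ⟨ρ, hρ, hbox⟩ := exists_half (j := j) hL
  -- A rim offset is given by a coordinate that is extreme, its sign, and the other coordinate.
  -- Corners are listed twice, which is harmless for an upper bound.
  set rim : Finset (Fin 2 → ℤ) :=
    (Finset.univ ×ˢ Finset.univ ×ˢ Finset.Icc (-(ρ : ℤ)) ρ : Finset (Fin 2 × Bool × ℤ)).image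
      fun p i => if i = p.1 then (if p.2.1 then (ρ : ℤ) else -ρ) else p.2.2 with hrim
  have hrimcard : rim.card ≤ 4 * L ^ j := by
    refine Finset.card_image_le.trans ?_
    simp
    omega
  have hsub : boundary X ⊆ (blocksIn L j X).biUnion fun B =>
      if h : ∃ k, B = block N L j k then
        rim.image fun r => site N ((L : ℤ) ^ j • h.choose + r) else ∅ := by
    intro x hx
    obtain ⟨hxX, μ, hμ⟩ := Finset.mem_filter.1 hx
    obtain ⟨k, hxk, hkX⟩ := exists_block_of_mem hX hxX
    refine Finset.mem_biUnion.2 ⟨_, block_mem_blocksIn hkX, ?_⟩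
    have hex : ∃ k', block N L j k = block N L j k' := ⟨k, rfl⟩
    rw [dif_pos hex]
    have hc := hex.choose_spec
    set k' := hex.choose
    rw [hc] at hxk hkX
    obtain ⟨r, hr, rfl⟩ := mem_block.1 hxk
    refine Finset.mem_image.2 ⟨r, ?_, rfl⟩
    have hr' := mem_box.1 ((hbox r).1 hr)
    have key : ∃ i, |r i| = ρ := by
      by_contra hcon
      push Not at hcon
      obtain ⟨e, he, hle⟩ := unitVec_eq_site (N := N) μ
      apply hμ
      apply hkX
      rw [he, ← site_add, add_assoc]
      refine mem_block.2 ⟨r + e, (hbox _).2 (mem_box.2 fun i => ?_), rfl⟩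
      have h1 := lt_of_le_of_ne (hr' i) (hcon i)
      have h2 := hle i
      simp only [Pi.add_apply]
      grind
    obtain ⟨i, hi⟩ := key
    obtain ⟨m, hm⟩ : ∃ m, m ≠ i := exists_ne i
    refine Finset.mem_image.2 ⟨(i, decide (r i = ρ), r m), ?_, ?_⟩
    · have := hr' m
      rw [abs_le] at this
      simp [this, em]
    · ext a
      by_cases ha : a = i
      · subst ha
        simp only [if_true, decide_eq_true_eq]
        split_ifs with h
        · exact h.symm
        · grind
      · have : a = m := by omega
        subst this
        simp [ha]
  refine (Finset.card_le_card hsub).trans ?_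
  apply Finset.card_biUnion_le_card_mul
  intro B hB
  split_ifs with h
  · exact Finset.card_image_le.trans hrimcard
  · simp

/-- Induction along chains of touching blocks in a small polymer. -/
lemma IsSmall.chain_induction (hL : Odd L) (hd : L ^ j ∣ N) {X : Finset (Torus N)}
    (hX : IsSmall L j X) (P : ℕ → (Fin 2 → ℤ) → Prop) {k : Fin 2 → ℤ}
    (hk : block N L j k ⊆ X) (h0 : P 0 k)
    (hs : ∀ n k' d, (∀ i, |d i| ≤ 1) → block N L j k' ⊆ X → block N L j (k' + d) ⊆ X →
      P n k' → P (n + 1) (k' + d))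
    {D : Finset (Torus N)} (hD : D ∈ blocksIn L j X) :
    ∃ n ≤ 3, ∃ k', D = block N L j k' ∧ P n k' := by
  classical
  let G : SimpleGraph {B // B ∈ blocksIn L j X} := SimpleGraph.fromRel fun a b => Touch a.1 b.1
  -- A block has many integer labels, so the walk is lifted: each step selects the label adjacent to
  -- the current one, and `P` follows the lift.
  have hwalk : ∀ (a b : {B // B ∈ blocksIn L j X}) (p : G.Walk a b) (n : ℕ) (k' : Fin 2 → ℤ),
      a.1 = block N L j k' → P n k' → ∃ k'', b.1 = block N L j k'' ∧ P (n + p.length) k'' := by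
    intro a b p
    induction p with
    | nil => intro n k' h hP; exact ⟨k', h, hP⟩
    | @cons u v w hadj p ih =>
      intro n k' h hP
      have ht : Touch u.1 v.1 := by
        rcases (SimpleGraph.fromRel_adj _ _ _).1 hadj with ⟨-, h | h⟩
        · exact h
        · exact h.symm
      obtain ⟨hv, k₁, hk₁⟩ := exists_of_mem_blocksIn v.2
      have hu := (exists_of_mem_blocksIn u.2).1
      rw [h, hk₁] at ht
      obtain ⟨d, hd1, hdb⟩ := ht.exists_shift hL hd
      rw [hk₁, hdb] at hv
      rw [h] at hu
      obtain ⟨k'', h1, h2⟩ := ih (n + 1) (k' + d) (by rw [hk₁, hdb]) (hs n k' d hd1 hu hv hP)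
      refine ⟨k'', h1, ?_⟩
      rw [SimpleGraph.Walk.length_cons, show n + (p.length + 1) = n + 1 + p.length by ring]
      exact h2
  have hB := block_mem_blocksIn hk
  have hreach : ∀ D' (h : D' ∈ blocksIn L j X), G.Reachable ⟨_, hB⟩ ⟨D', h⟩ := by
    intro D' h
    have hr := hX.1.2.2 _ hB _ h
    clear hD
    induction hr with
    | refl => exact SimpleGraph.Reachable.refl _
    | tail _ hst ih =>
      refine (ih hst.1).trans ?_
      by_cases heq : (⟨_, hst.1⟩ : {B // B ∈ blocksIn L j X}) = ⟨_, h⟩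
      · rw [heq]
      · exact SimpleGraph.Adj.reachable ((SimpleGraph.fromRel_adj _ _ _).2 ⟨heq, Or.inl hst.2.2⟩)
  -- A path visits distinct blocks, of which there are at most four; hence at most three steps.
  obtain ⟨p, hp⟩ := (hreach D hD).exists_isPath
  have hlen := hp.length_lt
  rw [Fintype.card_coe] at hlen
  have hc : (blocksIn L j X).card ≤ 4 := hX.2
  obtain ⟨k', h1, h2⟩ := hwalk _ _ p 0 k rfl h0
  exact ⟨p.length, by omega, k', h1, by simpa using h2⟩

lemma IsSmall.exists_shift (hL : Odd L) (hd : L ^ j ∣ N) {X : Finset (Torus N)}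
    (hX : IsSmall L j X) {k : Fin 2 → ℤ} (hk : block N L j k ⊆ X)
    {D : Finset (Torus N)} (hD : D ∈ blocksIn L j X) :
    ∃ d : Fin 2 → ℤ, (∀ i, |d i| ≤ 3) ∧ D = block N L j (k + d) := by
  obtain ⟨n, hn, k', hk', hP⟩ := hX.chain_induction hL hd
    (fun n k' => ∀ i, |k' i - k i| ≤ n) hk (by simp) (by
      intro n k' d hd' _ _ h i
      have h1 := h i
      have h2 := hd' i
      simp only [Pi.add_apply]
      push_cast
      grind) hD
  refine ⟨k' - k, fun i => (hP i).trans (by exact_mod_cast hn), by simpa using hk'⟩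

/-- Four consecutively neighbouring blocks form a small polymer. -/
lemma isSmall_biUnion (hL : Odd L) (hd : L ^ j ∣ N) (hN : 3 ≤ N) (κ : ℕ → Fin 2 → ℤ)
    (hκ : ∀ t i, |κ (t + 1) i - κ t i| ≤ 1) :
    IsSmall L j ((Finset.range 4).biUnion fun t => block N L j (κ t)) := by
  classical
  set Y := (Finset.range 4).biUnion fun t => block N L j (κ t) with hY
  have hsub : ∀ t < 4, block N L j (κ t) ⊆ Y := fun t ht x hx =>
    Finset.mem_biUnion.2 ⟨t, Finset.mem_range.2 ht, hx⟩
  -- A block inside the union has its centre in one of the four blocks, and thus coincides with it.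
  have hblocks : ∀ D ∈ blocksIn L j Y, ∃ t < 4, D = block N L j (κ t) := by
    intro D hD
    obtain ⟨hDY, k, rfl⟩ := exists_of_mem_blocksIn hD
    have hc := hDY (center_mem_block k)
    obtain ⟨t, ht, hx⟩ := Finset.mem_biUnion.1 hc
    exact ⟨t, Finset.mem_range.1 ht, block_eq_of_mem hL hd (center_mem_block k) hx⟩
  have hstep : ∀ t, block N L j (κ t) = block N L j (κ (t + 1)) ∨
      Touch (block N L j (κ t)) (block N L j (κ (t + 1))) := by
    intro t
    by_cases h : κ (t + 1) - κ t = 0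
    · left; rw [sub_eq_zero.1 h]
    · right
      have := touch_shift (j := j) hL hN (κ t) (d := κ (t + 1) - κ t) (hκ t) h
      rwa [add_sub_cancel] at this
  set rel : Finset (Torus N) → Finset (Torus N) → Prop := fun B' D' =>
    B' ∈ blocksIn L j Y ∧ D' ∈ blocksIn L j Y ∧ Touch B' D' with hrel
  have hfwd : ∀ t < 4, Relation.ReflTransGen rel (block N L j (κ 0)) (block N L j (κ t)) := by
    intro t
    induction t with
    | zero => intro _; exact .refl
    | succ t ih =>
      intro ht
      rcases hstep t with h | h
      · rw [← h]; exact ih (by omega)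
      · exact (ih (by omega)).tail ⟨block_mem_blocksIn (hsub t (by omega)),
          block_mem_blocksIn (hsub _ ht), h⟩
  have hsymm : ∀ B D, Relation.ReflTransGen rel B D → Relation.ReflTransGen rel D B := by
    intro B D h
    induction h with
    | refl => exact .refl
    | tail _ hst ih => exact ih.head ⟨hst.2.1, hst.1, hst.2.2.symm⟩
  refine ⟨⟨⟨_, hsub 0 (by norm_num) (center_mem_block _)⟩, ?_, ?_⟩, ?_⟩
  · apply subset_antisymm
    · intro x hx
      obtain ⟨B, hB, hxB⟩ := Finset.mem_biUnion.1 hx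
      exact (exists_of_mem_blocksIn hB).1 hxB
    · intro x hx
      obtain ⟨t, ht, hxt⟩ := Finset.mem_biUnion.1 hx
      exact Finset.mem_biUnion.2 ⟨_, block_mem_blocksIn (hsub t (Finset.mem_range.1 ht)), hxt⟩
  · intro B hB D hD
    obtain ⟨s, hs, rfl⟩ := hblocks B hB
    obtain ⟨t, ht, rfl⟩ := hblocks D hD
    exact (hsymm _ _ (hfwd s hs)).trans (hfwd t ht)
  · have : blocksIn L j Y ⊆ (Finset.range 4).image fun t => block N L j (κ t) := by
      intro D hD
      obtain ⟨t, ht, rfl⟩ := hblocks D hD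
      exact Finset.mem_image.2 ⟨t, Finset.mem_range.2 ht, rfl⟩
    exact (Finset.card_le_card this).trans (Finset.card_image_le.trans (by simp))

lemma mem_star {X : Finset (Torus N)} {x : Torus N} :
    x ∈ star L j X ↔ ∃ Y, IsSmall L j Y ∧ x ∈ Y ∧ ∃ y ∈ Y, y ∈ X := by
  simp [star]

/-- Blocks at distance at most three of a block of `X` belong to `X^*`. -/
lemma block_subset_star (hL : Odd L) (hd : L ^ j ∣ N) (hN : 3 ≤ N) {X : Finset (Torus N)}
    {k d : Fin 2 → ℤ} (hk : block N L j k ⊆ X) (h3 : ∀ i, |d i| ≤ 3) :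
    block N L j (k + d) ⊆ star L j X := by
  intro x hx
  -- Clamping $d$ to $[-t,t]$ coordinatewise gives a chain from $k$ to $k+d$ in three steps, each of
  -- size at most one.
  set κ : ℕ → Fin 2 → ℤ := fun t i => k i + max (-(t : ℤ)) (min t (d i)) with hκ
  have hκ3 : κ 3 = k + d := by
    ext i
    have := abs_le.1 (h3 i)
    simp [hκ]
    omega
  have hκ0 : κ 0 = k := by
    ext i
    simp [hκ]
  have hsmall := isSmall_biUnion hL hd hN κ (by
    intro t i
    simp only [hκ]
    push_cast
    grind)
  refine mem_star.2 ⟨_, hsmall, ?_, site N ((L : ℤ) ^ j • k), ?_, ?_⟩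
  · exact Finset.mem_biUnion.2 ⟨3, by simp, by rw [hκ3]; exact hx⟩
  · exact Finset.mem_biUnion.2 ⟨0, by simp, by rw [hκ0]; exact center_mem_block k⟩
  · exact hk (center_mem_block k)

/-- Converse to `block_subset_star`: two blocks of one small polymer are at most three steps apart.
-/
lemma exists_of_mem_star (hL : Odd L) (hd : L ^ j ∣ N) {X : Finset (Torus N)}
    (hX : IsPolymer L j X) {x : Torus N} (hx : x ∈ star L j X) :
    ∃ k d : Fin 2 → ℤ, block N L j k ⊆ X ∧ (∀ i, |d i| ≤ 3) ∧ x ∈ block N L j (k + d) := by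
  obtain ⟨Y, hY, hxY, y, hyY, hyX⟩ := mem_star.1 hx
  obtain ⟨k, hyk, hkX⟩ := exists_block_of_mem hX hyX
  obtain ⟨ky, hyky, hkyY⟩ := exists_block_of_mem hY.1.2.1 hyY
  obtain ⟨kx, hxkx, hkxY⟩ := exists_block_of_mem hY.1.2.1 hxY
  have hkY : block N L j k ⊆ Y := by rwa [block_eq_of_mem hL hd hyk hyky]
  obtain ⟨d, hd3, hdk⟩ := hY.exists_shift hL hd hkY (block_mem_blocksIn hkxY)
  exact ⟨k, d, hkX, hd3, hdk ▸ hxkx⟩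

lemma isPolymer_block (k : Fin 2 → ℤ) : IsPolymer L j (block N L j k) := by
  classical
  apply subset_antisymm
  · intro x hx
    obtain ⟨B, hB, hxB⟩ := Finset.mem_biUnion.1 hx
    exact (exists_of_mem_blocksIn hB).1 hxB
  · intro x hx
    exact Finset.mem_biUnion.2 ⟨_, block_mem_blocksIn (subset_refl _), hx⟩

/-- The square of radius `3 L^j + L^j / 2` about the centre of a block of `X` lies in `X^*`. -/
lemma site_mem_star (hL : Odd L) (hd : L ^ j ∣ N) (hN : 3 ≤ N) {X : Finset (Torus N)}
    {k w : Fin 2 → ℤ} (hk : block N L j k ⊆ X) (hw : ∀ i, 2 * |w i| ≤ 7 * (L : ℤ) ^ j) :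
    site N ((L : ℤ) ^ j • k + w) ∈ star L j X := by
  obtain ⟨ρ, hρ⟩ := pow_odd (j := j) hL
  have hpos := pow_pos_of_odd (j := j) hL
  have h1 : ∀ i, ∃ d r : ℤ, w i = (L : ℤ) ^ j * d + r ∧ 2 * |r| ≤ (L : ℤ) ^ j := by
    intro i
    refine ⟨(w i + ρ) / (L : ℤ) ^ j, (w i + ρ) % (L : ℤ) ^ j - ρ, ?_, ?_⟩
    · have := Int.mul_ediv_add_emod (w i + ρ) ((L : ℤ) ^ j)
      linarith
    · have h1 := Int.emod_nonneg (w i + ρ) hpos.ne'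
      have h2 := Int.emod_lt_of_pos (w i + ρ) hpos
      grind
  choose d r hdr hr using h1
  apply block_subset_star hL hd hN hk (d := d)
  · intro i
    have h1 := hw i
    have h2 := odd_two_mul_le (pow_odd hL) (hr i)
    by_contra hcon
    push Not at hcon
    -- Otherwise $8L^j\le 2|w_i|+2|r_i|\le 7L^j+(L^j-1)$.
    have h3 : (L : ℤ) ^ j * 4 ≤ (L : ℤ) ^ j * |d i| := by gcongr; omega
    have h4 : (L : ℤ) ^ j * |d i| = |w i - r i| := by
      rw [hdr i, add_sub_cancel_right, abs_mul, abs_of_pos hpos]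
    have h5 : |w i - r i| ≤ |w i| + |r i| := abs_sub _ _
    omega
  · refine mem_block.2 ⟨r, hr, ?_⟩
    congr 1
    ext i
    have := hdr i
    simp only [Pi.add_apply, Pi.smul_apply, smul_eq_mul]
    linarith

lemma exists_site_of_mem_star (hL : Odd L) (hd : L ^ j ∣ N) {X : Finset (Torus N)}
    (hX : IsPolymer L j X) {x : Torus N} (hx : x ∈ star L j X) :
    ∃ k w : Fin 2 → ℤ, block N L j k ⊆ X ∧ (∀ i, 2 * |w i| ≤ 7 * (L : ℤ) ^ j) ∧
      x = site N ((L : ℤ) ^ j • k + w) := by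
  obtain ⟨k, d, hk, hd3, hxd⟩ := exists_of_mem_star hL hd hX hx
  obtain ⟨r, hr, rfl⟩ := mem_block.1 hxd
  refine ⟨k, (L : ℤ) ^ j • d + r, hk, fun i => ?_, by rw [smul_add, add_assoc]⟩
  have hpos := pow_pos_of_odd (j := j) hL
  have h1 : |(L : ℤ) ^ j * d i| ≤ (L : ℤ) ^ j * 3 := by
    rw [abs_mul, abs_of_pos hpos]
    gcongr
    exact hd3 i
  have h2 := hr i
  simp only [Pi.add_apply, Pi.smul_apply, smul_eq_mul]
  have := abs_add_le ((L : ℤ) ^ j * d i) (r i)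
  omega

lemma subset_star (hL : Odd L) (hd : L ^ j ∣ N) (hN : 3 ≤ N) {X : Finset (Torus N)}
    (hX : IsPolymer L j X) : X ⊆ star L j X := by
  intro x hx
  obtain ⟨k, hxk, hk⟩ := exists_block_of_mem hX hx
  have := block_subset_star hL hd hN hk (d := 0) (by simp)
  rw [add_zero] at this
  exact this hxk

lemma star_mono {X Y : Finset (Torus N)} (h : X ⊆ Y) : star L j X ⊆ star L j Y := by
  intro x hx
  obtain ⟨Z, hZ, hxZ, y, hyZ, hyX⟩ := mem_star.1 hx
  exact mem_star.2 ⟨Z, hZ, hxZ, y, hyZ, h hyX⟩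

/-- A site of `X^*` differs from a given site of the small polymer `X` by at most `7 L^j`. -/
lemma IsSmall.exists_site_of_mem_star (hL : Odd L) (hd : L ^ j ∣ N) {X : Finset (Torus N)}
    (hX : IsSmall L j X) {x₀ x : Torus N} (hx₀ : x₀ ∈ X) (hx : x ∈ star L j X) :
    ∃ w : Fin 2 → ℤ, (∀ i, |w i| ≤ 7 * (L : ℤ) ^ j) ∧ x = x₀ + site N w := by
  obtain ⟨k, w, hk, hw, rfl⟩ := CoulombGas.exists_site_of_mem_star hL hd hX.1.2.1 hx
  obtain ⟨k₀, hxk₀, hk₀⟩ := exists_block_of_mem hX.1.2.1 hx₀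
  obtain ⟨d, hd3, hdk⟩ := hX.exists_shift hL hd hk (block_mem_blocksIn hk₀)
  rw [hdk] at hxk₀
  obtain ⟨r, hr, rfl⟩ := mem_block.1 hxk₀
  -- In units of $L^j$: $\frac72$ from a centre to the site of $X^*$, $3$ between centres, $\frac12$
  -- from a centre to $x_0$.
  refine ⟨w - (L : ℤ) ^ j • d - r, fun i => ?_, ?_⟩
  · have hpos := pow_pos_of_odd (j := j) hL
    have h1 : |(L : ℤ) ^ j * d i| ≤ (L : ℤ) ^ j * 3 := by
      rw [abs_mul, abs_of_pos hpos]
      gcongr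
      exact hd3 i
    have h2 := hr i
    have h3 := hw i
    simp only [Pi.sub_apply, Pi.smul_apply, smul_eq_mul]
    have := abs_sub (w i - (L : ℤ) ^ j * d i) (r i)
    have := abs_sub (w i) ((L : ℤ) ^ j * d i)
    omega
  · rw [← site_add]
    congr 1
    rw [smul_add]
    abel

end Polymers

/-! ### Discrete gradients, the `C²` norms, and oscillation over `X^*`. -/

section Norms

variable {N : ℕ} {E : Type*} [NormedAddCommGroup E]

lemma diff_add (μ : Dir) (f g : Torus N → E) : diff μ (f + g) = diff μ f + diff μ g := by
  ext x; simp [diff]; abel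

lemma diff_delta (μ : Dir) (x₀ : Torus N) (f : Torus N → ℝ) : diff μ (delta x₀ f) = diff μ f := by
  ext x; simp [diff, delta]

lemma diff_smul {𝕜 : Type*} [NormedField 𝕜] [NormedSpace 𝕜 E] (μ : Dir) (c : 𝕜)
    (f : Torus N → E) : diff μ (c • f) = c • diff μ f := by
  ext x; simp [diff, smul_sub]

lemma diff_comp {F : Type*} [NormedAddCommGroup F] (μ : Dir) (g : E →+ F) (f : Torus N → E) :
    diff μ (fun x => g (f x)) = fun x => g (diff μ f x) := by
  ext x; simp [diff]

lemma le_gradSup (L j n : ℕ) (f : Torus N → E) {Y : Finset (Torus N)} {x : Torus N} (hx : x ∈ Y)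
    (μ : Fin n → Dir) :
    (L : ℝ) ^ (n * j) * ‖iterDiff (List.ofFn μ) f x‖ ≤ gradSup L j n f Y := by
  have h1 := le_ciSup (f := fun μ : Fin n → Dir =>
    (L : ℝ) ^ (n * j) * ‖iterDiff (List.ofFn μ) f x‖) (Set.finite_range _).bddAbove μ
  exact h1.trans (le_ciSup (f := fun x : {x // x ∈ Y} => ⨆ μ : Fin n → Dir,
    (L : ℝ) ^ (n * j) * ‖iterDiff (List.ofFn μ) f x.1‖) (Set.finite_range _).bddAbove ⟨x, hx⟩)

lemma gradSup_le {L j n : ℕ} {f : Torus N → E} {Y : Finset (Torus N)} {B : ℝ} (hB : 0 ≤ B)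
    (h : ∀ x ∈ Y, ∀ μ : Fin n → Dir, (L : ℝ) ^ (n * j) * ‖iterDiff (List.ofFn μ) f x‖ ≤ B) :
    gradSup L j n f Y ≤ B :=
  Real.iSup_le (fun x => Real.iSup_le (fun μ => h x.1 x.2 μ) hB) hB

lemma gradSup_nonneg (L j n : ℕ) (f : Torus N → E) (Y : Finset (Torus N)) :
    0 ≤ gradSup L j n f Y :=
  Real.iSup_nonneg fun _ => Real.iSup_nonneg fun _ => by positivity

lemma norm_le_gradSup_zero {L j : ℕ} {f : Torus N → E} {Y : Finset (Torus N)} {x : Torus N}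
    (hx : x ∈ Y) : ‖f x‖ ≤ gradSup L j 0 f Y := by
  simpa [iterDiff] using le_gradSup L j 0 f hx Fin.elim0

lemma norm_diff_le_gradSup {L j : ℕ} {f : Torus N → E} {Y : Finset (Torus N)} {x : Torus N}
    (hx : x ∈ Y) (μ : Dir) : (L : ℝ) ^ j * ‖diff μ f x‖ ≤ gradSup L j 1 f Y := by
  simpa [iterDiff] using le_gradSup L j 1 f hx ![μ]

lemma norm_diff_diff_le_gradSup {L j : ℕ} {f : Torus N → E} {Y : Finset (Torus N)} {x : Torus N}
    (hx : x ∈ Y) (μ ν : Dir) :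
    (L : ℝ) ^ (2 * j) * ‖diff μ (diff ν f) x‖ ≤ gradSup L j 2 f Y := by
  simpa [iterDiff] using le_gradSup L j 2 f hx ![μ, ν]

lemma gradSup_one_le {L j : ℕ} {f : Torus N → E} {Y : Finset (Torus N)} {B : ℝ} (hB : 0 ≤ B)
    (h : ∀ x ∈ Y, ∀ μ, (L : ℝ) ^ j * ‖diff μ f x‖ ≤ B) : gradSup L j 1 f Y ≤ B :=
  gradSup_le hB fun x hx μ => by simpa [iterDiff] using h x hx (μ 0)

lemma gradSup_two_le {L j : ℕ} {f : Torus N → E} {Y : Finset (Torus N)} {B : ℝ} (hB : 0 ≤ B)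
    (h : ∀ x ∈ Y, ∀ μ ν, (L : ℝ) ^ (2 * j) * ‖diff μ (diff ν f) x‖ ≤ B) :
    gradSup L j 2 f Y ≤ B :=
  gradSup_le hB fun x hx μ => by simpa [iterDiff] using h x hx (μ 0) (μ 1)

lemma gradSup_mono {L j n : ℕ} (f : Torus N → E) {Y Z : Finset (Torus N)} (h : Y ⊆ Z) :
    gradSup L j n f Y ≤ gradSup L j n f Z :=
  gradSup_le (gradSup_nonneg _ _ _ _ _) fun _ hx μ => le_gradSup L j n f (h hx) μ

lemma c2Norm_nonneg (L k : ℕ) (f : Torus N → E) (Y : Finset (Torus N)) : 0 ≤ c2Norm L k f Y :=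
  (gradSup_nonneg L k 0 f Y).trans (le_max_left _ _)

lemma c2Norm_le {L k : ℕ} {f : Torus N → E} {Y : Finset (Torus N)} {B : ℝ} (hB : 0 ≤ B)
    (h0 : ∀ x ∈ Y, ‖f x‖ ≤ B) (h1 : ∀ x ∈ Y, ∀ μ, (L : ℝ) ^ k * ‖diff μ f x‖ ≤ B)
    (h2 : ∀ x ∈ Y, ∀ μ ν, (L : ℝ) ^ (2 * k) * ‖diff μ (diff ν f) x‖ ≤ B) :
    c2Norm L k f Y ≤ B :=
  max_le (gradSup_le hB fun x hx μ => by simpa [iterDiff] using h0 x hx)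
    (max_le (gradSup_one_le hB h1) (gradSup_two_le hB h2))

lemma norm_le_c2Norm {L k : ℕ} {f : Torus N → E} {Y : Finset (Torus N)} {x : Torus N}
    (hx : x ∈ Y) : ‖f x‖ ≤ c2Norm L k f Y :=
  (norm_le_gradSup_zero hx).trans (le_max_left _ _)

lemma gradSup_one_le_c2Norm (L k : ℕ) (f : Torus N → E) (Y : Finset (Torus N)) :
    gradSup L k 1 f Y ≤ c2Norm L k f Y :=
  (le_max_left _ _).trans (le_max_right _ _)

lemma gradSup_two_le_c2Norm (L k : ℕ) (f : Torus N → E) (Y : Finset (Torus N)) :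
    gradSup L k 2 f Y ≤ c2Norm L k f Y :=
  (le_max_right _ _).trans (le_max_right _ _)

/-- Lets real and complex test functions be compared: it serves for real part, imaginary part and
the inclusion of the reals. -/
lemma c2Norm_comp_le {F : Type*} [NormedAddCommGroup F] (L k : ℕ) (g : E →+ F)
    (hg : ∀ e, ‖g e‖ ≤ ‖e‖) (f : Torus N → E) (Y : Finset (Torus N)) :
    c2Norm L k (fun x => g (f x)) Y ≤ c2Norm L k f Y := by
  refine c2Norm_le (c2Norm_nonneg _ _ _ _) (fun x hx => (hg _).trans (norm_le_c2Norm hx))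
    (fun x hx μ => ?_) (fun x hx μ ν => ?_)
  · rw [diff_comp]
    refine le_trans ?_ ((norm_diff_le_gradSup hx μ).trans (gradSup_one_le_c2Norm L k f Y))
    gcongr
    exact hg _
  · rw [diff_comp, diff_comp]
    refine le_trans ?_ ((norm_diff_diff_le_gradSup hx μ ν).trans (gradSup_two_le_c2Norm L k f Y))
    gcongr
    exact hg _

lemma c2Norm_smul_le {𝕜 : Type*} [NormedField 𝕜] [NormedSpace 𝕜 E] (L k : ℕ) (c : 𝕜)
    (f : Torus N → E) (Y : Finset (Torus N)) :
    c2Norm L k (c • f) Y ≤ ‖c‖ * c2Norm L k f Y := by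
  refine c2Norm_le (mul_nonneg (norm_nonneg _) (c2Norm_nonneg _ _ _ _)) (fun x hx => ?_)
    (fun x hx μ => ?_) (fun x hx μ ν => ?_)
  · rw [Pi.smul_apply, norm_smul]
    gcongr
    exact norm_le_c2Norm hx
  · rw [diff_smul, Pi.smul_apply, norm_smul, mul_left_comm]
    gcongr
    exact (norm_diff_le_gradSup hx μ).trans (gradSup_one_le_c2Norm L k f Y)
  · rw [diff_smul, diff_smul, Pi.smul_apply, norm_smul, mul_left_comm]
    gcongr
    exact (norm_diff_diff_le_gradSup hx μ ν).trans (gradSup_two_le_c2Norm L k f Y)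

lemma norm_sub_le_of_int_step {g : ℤ → E} {M : ℝ} {R : ℤ}
    (h : ∀ z, 2 * |z| ≤ R → 2 * |z + 1| ≤ R → ‖g (z + 1) - g z‖ ≤ M) {a b : ℤ}
    (ha : 2 * |a| ≤ R) (hb : 2 * |b| ≤ R) : ‖g a - g b‖ ≤ |((a - b : ℤ) : ℝ)| * M := by
  wlog hab : b ≤ a generalizing a b
  · rw [norm_sub_rev, show a - b = -(b - a) by ring, Int.cast_neg, abs_neg]
    exact this hb ha (by omega)
  have key : ∀ n : ℕ, 2 * |b + n| ≤ R → ‖g (b + n) - g b‖ ≤ n * M := by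
    intro n
    induction n with
    | zero => simp
    | succ n ih =>
      intro hn
      push_cast at hn ⊢
      have h1 : 2 * |b + n| ≤ R := by grind
      have h2 := ih h1
      have h3 := h (b + n) h1 (by rwa [add_assoc])
      have h4 : g (b + (n + 1)) - g b = (g (b + n + 1) - g (b + n)) + (g (b + n) - g b) := by
        rw [add_assoc]; abel
      rw [h4]
      refine (norm_add_le _ _).trans ?_
      linarith
  obtain ⟨n, hn⟩ := Int.le.dest hab
  have := key n (by rw [hn]; exact ha)
  rw [hn] at this
  refine this.trans (le_of_eq ?_)
  rw [← hn]; simp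

/-- The oscillation of a function over a square is controlled by its discrete gradient there. -/
lemma norm_sub_le_of_norm_diff_le {f : Torus N → E} {c : Fin 2 → ℤ} {M : ℝ} {R : ℤ}
    (h : ∀ w : Fin 2 → ℤ, (∀ i, 2 * |w i| ≤ R) → ∀ μ, ‖diff μ f (site N (c + w))‖ ≤ M)
    {u v : Fin 2 → ℤ} (hu : ∀ i, 2 * |u i| ≤ R) (hv : ∀ i, 2 * |v i| ≤ R) :
    ‖f (site N (c + u)) - f (site N (c + v))‖
      ≤ (|((u 0 - v 0 : ℤ) : ℝ)| + |((u 1 - v 1 : ℤ) : ℝ)|) * M := by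
  -- The path from $v$ to $u$ turns once, at $(v_0,u_1)$, and stays in the square.
  have h0 := norm_sub_le_of_int_step (g := fun z => f (site N (c + ![z, u 1]))) (M := M) (R := R)
    (fun z hz _ => by
      have := h ![z, u 1] (by intro i; fin_cases i; exacts [hz, hu 1]) (0, true)
      rw [diff, unitVec_pos, ← site_add] at this
      convert this using 5
      rw [add_assoc]; congr 1; ext i; fin_cases i <;> simp) (hu 0) (hv 0)
  have h1 := norm_sub_le_of_int_step (g := fun z => f (site N (c + ![v 0, z]))) (M := M) (R := R)
    (fun z hz _ => by
      have := h ![v 0, z] (by intro i; fin_cases i; exacts [hv 0, hz]) (1, true)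
      rw [diff, unitVec_pos, ← site_add] at this
      convert this using 5
      rw [add_assoc]; congr 1; ext i; fin_cases i <;> simp) (hu 1) (hv 1)
  have hu' : ![u 0, u 1] = u := by ext i; fin_cases i <;> rfl
  have hv' : ![v 0, v 1] = v := by ext i; fin_cases i <;> rfl
  simp only [hu', hv'] at h0 h1
  have := norm_add_le _ _ |>.trans (add_le_add h0 h1)
  rw [sub_add_sub_cancel] at this
  linarith

variable [NeZero N] {L j : ℕ}

lemma abs_cast_le_of_two_mul_le {m R : ℤ} (h : 2 * |m| ≤ R) : |(m : ℝ)| ≤ R / 2 := by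
  have : (2 : ℝ) * |(m : ℝ)| ≤ R := by exact_mod_cast h
  linarith

/-- The oscillation of a function over `X^*`, for a small polymer `X`. -/
lemma IsSmall.norm_sub_le (hL : Odd L) (hd : L ^ j ∣ N) (hN : 3 ≤ N) {X : Finset (Torus N)}
    (hX : IsSmall L j X) {f : Torus N → E} {M : ℝ}
    (hM : ∀ x ∈ star L j X, ∀ μ, ‖diff μ f x‖ ≤ M) {x₀ x : Torus N} (hx₀ : x₀ ∈ X)
    (hx : x ∈ star L j X) : ‖f x - f x₀‖ ≤ 20 * (L : ℝ) ^ j * M := by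
  have hM0 : 0 ≤ M := (norm_nonneg _).trans (hM x hx (0, true))
  have hpos := pow_pos_of_odd (j := j) hL
  have hposR : (0 : ℝ) < (L : ℝ) ^ j := by exact_mod_cast hpos
  obtain ⟨k, w, hk, hw, rfl⟩ := CoulombGas.exists_site_of_mem_star hL hd hX.1.2.1 hx
  obtain ⟨k₀, hxk₀, hk₀⟩ := exists_block_of_mem hX.1.2.1 hx₀
  -- oscillation over one square
  have sq : ∀ k, block N L j k ⊆ X → ∀ u : Fin 2 → ℤ, (∀ i, 2 * |u i| ≤ 7 * (L : ℤ) ^ j) →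
      ‖f (site N ((L : ℤ) ^ j • k + u)) - f (site N ((L : ℤ) ^ j • k))‖
        ≤ (|(u 0 : ℝ)| + |(u 1 : ℝ)|) * M := by
    intro k hk u hu
    have := norm_sub_le_of_norm_diff_le (f := f) (c := (L : ℤ) ^ j • k) (M := M)
      (R := 7 * (L : ℤ) ^ j) (fun w hw μ => hM _ (site_mem_star hL hd hN hk hw) μ) (u := u) (v := 0)
      hu (by simp)
    simpa using this
  -- Moving along centres of touching blocks keeps the path in $X^*$, where the gradient bound
  -- holds; each step costs at most $2L^jM$.
  obtain ⟨n, hn, k', hk', hP⟩ := hX.chain_induction hL hd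
    (fun n k' => ‖f (site N ((L : ℤ) ^ j • k')) - f (site N ((L : ℤ) ^ j • k))‖
      ≤ n * (2 * (L : ℝ) ^ j * M)) hk (by simp) (by
      intro n k' d hd' hk' _ h
      have hd'' : ∀ i, |(d i : ℝ)| ≤ 1 := fun i => by exact_mod_cast hd' i
      have h1 := sq k' hk' ((L : ℤ) ^ j • d) (by
        intro i
        have : |(L : ℤ) ^ j * d i| ≤ (L : ℤ) ^ j * 1 := by
          rw [abs_mul, abs_of_pos hpos]
          gcongr
          exact hd' i
        simp only [Pi.smul_apply, smul_eq_mul]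
        omega)
      rw [← smul_add] at h1
      have h2 : (|(((L : ℤ) ^ j • d) 0 : ℝ)| + |(((L : ℤ) ^ j • d) 1 : ℝ)|) * M
          ≤ 2 * (L : ℝ) ^ j * M := by
        gcongr
        simp only [Pi.smul_apply, smul_eq_mul, Int.cast_mul, Int.cast_pow, Int.cast_natCast,
          abs_mul, abs_of_pos hposR]
        nlinarith [hd'' 0, hd'' 1]
      have h3 := norm_add_le _ _ |>.trans (add_le_add (h1.trans h2) h)
      rw [sub_add_sub_cancel] at h3
      push_cast
      linarith) (block_mem_blocksIn hk₀)
  rw [hk'] at hxk₀ hk₀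
  obtain ⟨r, hr, rfl⟩ := mem_block.1 hxk₀
  have e1 := sq k hk w hw
  have e2 := sq k' hk₀ r (fun i => (hr i).trans (by omega))
  have b1 : (|(w 0 : ℝ)| + |(w 1 : ℝ)|) * M ≤ 7 * (L : ℝ) ^ j * M := by
    gcongr
    have h0 := abs_cast_le_of_two_mul_le (hw 0)
    have h1 := abs_cast_le_of_two_mul_le (hw 1)
    push_cast at h0 h1
    linarith
  have b2 : (|(r 0 : ℝ)| + |(r 1 : ℝ)|) * M ≤ (L : ℝ) ^ j * M := by
    gcongr
    have h0 := abs_cast_le_of_two_mul_le (hr 0)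
    have h1 := abs_cast_le_of_two_mul_le (hr 1)
    push_cast at h0 h1
    linarith
  -- The three pieces cost $7+6+1=14$ times $L^jM$, so the constant $20$ leaves room.
  have b3 : (n : ℝ) * (2 * (L : ℝ) ^ j * M) ≤ 3 * (2 * (L : ℝ) ^ j * M) := by
    gcongr
    exact_mod_cast hn
  rw [norm_sub_rev] at e2 hP
  have := norm_add₃_le (a := f (site N ((L : ℤ) ^ j • k + w)) - f (site N ((L : ℤ) ^ j • k)))
    (b := f (site N ((L : ℤ) ^ j • k)) - f (site N ((L : ℤ) ^ j • k')))
    (c := f (site N ((L : ℤ) ^ j • k')) - f (site N ((L : ℤ) ^ j • k' + r)))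
  rw [sub_add_sub_cancel, sub_add_sub_cancel] at this
  have : 0 ≤ (L : ℝ) ^ j * M := by positivity
  linarith

end Norms

/-! ### The regulator against gradient norms on the next scale. -/

section Regulator

variable {N : ℕ} [NeZero N] {L j : ℕ}

/-- The logarithm of the field regulator. -/
def logRegulator (c₁ c₃ κ : ℝ) (L j : ℕ) (φ : Torus N → ℝ) (X : Finset (Torus N)) : ℝ :=
  c₁ * κ * gradL2Sq L j φ X + c₃ * κ * gradL2BdrySq L j φ X + c₁ * κ * hessWSq L j φ X

lemma regulator_eq_exp (c₁ c₃ κ : ℝ) (L j : ℕ) (φ : Torus N → ℝ) (X : Finset (Torus N)) :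
    regulator c₁ c₃ κ L j φ X = Real.exp (logRegulator c₁ c₃ κ L j φ X) := rfl

/-- The scaled gradient norm of a field, together with that of its second derivatives. -/
def gradNorm (L j : ℕ) (φ : Torus N → ℝ) (Y : Finset (Torus N)) : ℝ :=
  max (gradSup L j 1 φ Y) (gradSup L j 2 φ Y)

lemma gradNorm_nonneg (L j : ℕ) (φ : Torus N → ℝ) (Y : Finset (Torus N)) :
    0 ≤ gradNorm L j φ Y := (gradSup_nonneg _ _ _ _ _).trans (le_max_left _ _)

lemma gradNorm_le_c2Norm (L j : ℕ) (φ : Torus N → ℝ) (Y : Finset (Torus N)) :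
    gradNorm L j φ Y ≤ c2Norm L j φ Y :=
  max_le (gradSup_one_le_c2Norm _ _ _ _) (gradSup_two_le_c2Norm _ _ _ _)

lemma norm_diff_le_gradNorm {φ : Torus N → ℝ} {Y : Finset (Torus N)} {x : Torus N}
    (hx : x ∈ Y) (μ : Dir) : (L : ℝ) ^ j * ‖diff μ φ x‖ ≤ gradNorm L j φ Y :=
  (norm_diff_le_gradSup hx μ).trans (le_max_left _ _)

lemma norm_diff_diff_le_gradNorm {φ : Torus N → ℝ} {Y : Finset (Torus N)} {x : Torus N}
    (hx : x ∈ Y) (μ ν : Dir) :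
    (L : ℝ) ^ (2 * j) * ‖diff μ (diff ν φ) x‖ ≤ gradNorm L j φ Y :=
  (norm_diff_diff_le_gradSup hx μ ν).trans (le_max_right _ _)

/-- Subtracting the value at a point gains one power of `L` in the change of scale. -/
lemma IsSmall.c2Norm_delta_le (hL : Odd L) (hd : L ^ j ∣ N) (hN : 3 ≤ N) {X : Finset (Torus N)}
    (hX : IsSmall L j X) {x₀ : Torus N} (hx₀ : x₀ ∈ X) (φ : Torus N → ℝ) :
    c2Norm L j (delta x₀ φ) (star L j X) ≤ 20 / L * gradNorm L (j + 1) φ (star L j X) := by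
  have hL0 : (0 : ℝ) < L := by exact_mod_cast hL.pos
  have hL1 : (1 : ℝ) ≤ L := by exact_mod_cast hL.pos
  set D := gradNorm L (j + 1) φ (star L j X) with hD
  have hD0 : 0 ≤ D := gradNorm_nonneg _ _ _ _
  have h1 : ∀ x ∈ star L j X, ∀ μ, ‖diff μ φ x‖ ≤ D / L ^ (j + 1) := by
    intro x hx μ
    rw [le_div_iff₀ (by positivity), mul_comm]
    exact norm_diff_le_gradNorm hx μ
  -- The value gains $20/L$ by the oscillation bound. Derivatives are unaffected by `delta` and gain
  -- $L^{-1}$ and $L^{-2}$ from the scale alone.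
  refine c2Norm_le (by positivity) (fun x hx => ?_) (fun x hx μ => ?_) (fun x hx μ ν => ?_)
  · refine (hX.norm_sub_le hL hd hN h1 hx₀ hx).trans (le_of_eq ?_)
    rw [pow_succ]
    field_simp
  · rw [diff_delta]
    calc (L : ℝ) ^ j * ‖diff μ φ x‖ ≤ (L : ℝ) ^ j * (D / L ^ (j + 1)) := by
          gcongr
          exact h1 x hx μ
      _ = 1 / L * D := by rw [pow_succ]; field_simp
      _ ≤ 20 / L * D := by gcongr; norm_num
  · rw [diff_delta]
    have h2 : ‖diff μ (diff ν φ) x‖ ≤ D / L ^ (2 * (j + 1)) := by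
      rw [le_div_iff₀ (by positivity), mul_comm]
      exact norm_diff_diff_le_gradNorm hx μ ν
    calc (L : ℝ) ^ (2 * j) * ‖diff μ (diff ν φ) x‖
        ≤ (L : ℝ) ^ (2 * j) * (D / L ^ (2 * (j + 1))) := by gcongr
      _ = 1 / L ^ 2 * D := by rw [show 2 * (j + 1) = 2 * j + 2 by ring, pow_add]; field_simp
      _ ≤ 20 / L * D := by
        gcongr
        · norm_num
        · nlinarith

/-- Smooth fields: on a small polymer, the regulator is controlled by the gradient norm on the
next scale, with a gain `L⁻²`. -/
lemma IsSmall.logRegulator_le (hL : Odd L) (hd : L ^ j ∣ N) (hN : 3 ≤ N) {X : Finset (Torus N)}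
    (hX : IsSmall L j X) {c₁ c₃ κ : ℝ} (h₁ : 0 ≤ c₁) (h₃ : 0 ≤ c₃) (hκ : 0 ≤ κ)
    {φ : Torus N → ℝ} {D : ℝ} (hD : gradNorm L (j + 1) φ (star L j X) ≤ D) :
    logRegulator c₁ c₃ κ L j φ X ≤ κ * (12 * c₁ + 32 * c₃) * (D ^ 2 / L ^ 2) := by
  have hL0 : (0 : ℝ) < L := by exact_mod_cast hL.pos
  have hL1 : (1 : ℝ) ≤ L := by exact_mod_cast hL.pos
  have hD0 : 0 ≤ D := (gradNorm_nonneg _ _ _ _).trans hD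
  set d := D ^ 2 / (L : ℝ) ^ 2 with hd'
  have hd0 : 0 ≤ d := by positivity
  have hcount : (blockCount L j X : ℝ) ≤ 4 := by exact_mod_cast hX.2
  have hsub := subset_star hL hd hN hX.1.2.1
  have hs : ∀ x ∈ X, (1 / 2 : ℝ) * ∑ μ : Dir, (L : ℝ) ^ (2 * j) * (diff μ φ x) ^ 2 ≤ 2 * d := by
    intro x hx
    have : ∀ μ ∈ (Finset.univ : Finset Dir), (L : ℝ) ^ (2 * j) * (diff μ φ x) ^ 2 ≤ d := by
      intro μ _
      have h := (norm_diff_le_gradNorm (L := L) (j := j + 1) (φ := φ) (hsub hx) μ).trans hD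
      have h2 : ((L : ℝ) ^ (j + 1) * ‖diff μ φ x‖) ^ 2 ≤ D ^ 2 := by gcongr
      rw [mul_pow, Real.norm_eq_abs, sq_abs] at h2
      rw [hd', le_div_iff₀ (by positivity)]
      refine le_trans (le_of_eq ?_) h2
      ring
    have := Finset.sum_le_card_nsmul _ _ _ this
    simp at this
    linarith
  have b1 : gradL2Sq L j φ X ≤ 8 * d := by
    rw [gradL2Sq, inv_mul_le_iff₀ (by positivity)]
    refine (Finset.sum_le_card_nsmul _ _ _ hs).trans ?_
    have hc : (X.card : ℝ) ≤ blockCount L j X * (L ^ j) ^ 2 := by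
      exact_mod_cast card_le_of_isPolymer hL hd hX.1.2.1
    rw [nsmul_eq_mul]
    have : (X.card : ℝ) ≤ 4 * (L ^ j) ^ 2 := hc.trans (by gcongr)
    calc (X.card : ℝ) * (2 * d) ≤ 4 * (L ^ j) ^ 2 * (2 * d) := by gcongr
      _ = (L : ℝ) ^ (2 * j) * (8 * d) := by ring
  have b2 : gradL2BdrySq L j φ X ≤ 32 * d := by
    rw [gradL2BdrySq, inv_mul_le_iff₀ (by positivity)]
    refine (Finset.sum_le_card_nsmul _ _ (2 * d) fun x hx => hs x (Finset.mem_filter.1 hx).1).trans ?_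
    have hc : ((boundary X).card : ℝ) ≤ blockCount L j X * (4 * L ^ j) := by
      exact_mod_cast card_boundary_le hL hX.1.2.1
    rw [nsmul_eq_mul]
    have : ((boundary X).card : ℝ) ≤ 4 * (4 * L ^ j) := hc.trans (by gcongr)
    calc ((boundary X).card : ℝ) * (2 * d) ≤ 4 * (4 * L ^ j) * (2 * d) := by gcongr
      _ = (L : ℝ) ^ j * (32 * d) := by ring
  have b3 : hessWSq L j φ X ≤ 4 * d := by
    have : ∀ B ∈ blocksIn L j X, (gradSup L j 2 φ (star L j B)) ^ 2 ≤ d := by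
      intro B hB
      -- The Hessian really gains $L^{-2}$ before squaring; one power is enough and matches the
      -- gradient terms.
      have hg : gradSup L j 2 φ (star L j B) ≤ D / L := by
        refine gradSup_two_le (by positivity) fun x hx μ ν => ?_
        have h := (norm_diff_diff_le_gradNorm (L := L) (j := j + 1) (φ := φ)
          (star_mono (exists_of_mem_blocksIn hB).1 hx) μ ν).trans hD
        rw [le_div_iff₀ hL0]
        refine le_trans ?_ h
        calc (L : ℝ) ^ (2 * j) * ‖diff μ (diff ν φ) x‖ * L
            = (L : ℝ) ^ (2 * j + 1) * ‖diff μ (diff ν φ) x‖ := by ring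
          _ ≤ _ := by
            gcongr
            omega
      calc (gradSup L j 2 φ (star L j B)) ^ 2 ≤ (D / L) ^ 2 := by
            gcongr
            exact gradSup_nonneg _ _ _ _ _
        _ = d := by rw [div_pow]
    refine (Finset.sum_le_card_nsmul _ _ _ this).trans ?_
    rw [nsmul_eq_mul]
    change (blockCount L j X : ℝ) * d ≤ _
    gcongr
  -- Four blocks give $8+4=12$ for the two bulk terms, and their rims give $16\cdot2=32$.
  rw [logRegulator]
  have e1 : c₁ * κ * gradL2Sq L j φ X ≤ c₁ * κ * (8 * d) := by gcongr
  have e2 : c₃ * κ * gradL2BdrySq L j φ X ≤ c₃ * κ * (32 * d) := by gcongr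
  have e3 : c₁ * κ * hessWSq L j φ X ≤ c₁ * κ * (4 * d) := by gcongr
  linarith

lemma gradL2Sq_nonneg (L j : ℕ) (φ : Torus N → ℝ) (X : Finset (Torus N)) :
    0 ≤ gradL2Sq L j φ X := by
  unfold gradL2Sq; positivity

lemma gradL2BdrySq_nonneg (L j : ℕ) (φ : Torus N → ℝ) (X : Finset (Torus N)) :
    0 ≤ gradL2BdrySq L j φ X := by
  unfold gradL2BdrySq; positivity

lemma hessWSq_nonneg (L j : ℕ) (φ : Torus N → ℝ) (X : Finset (Torus N)) :
    0 ≤ hessWSq L j φ X := by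
  unfold hessWSq; positivity

lemma logRegulator_nonneg {c₁ c₃ κ : ℝ} (h₁ : 0 ≤ c₁) (h₃ : 0 ≤ c₃) (hκ : 0 ≤ κ) (L j : ℕ)
    (φ : Torus N → ℝ) (X : Finset (Torus N)) : 0 ≤ logRegulator c₁ c₃ κ L j φ X := by
  have h1 := gradL2Sq_nonneg L j φ X
  have h2 := gradL2BdrySq_nonneg L j φ X
  have h3 := hessWSq_nonneg L j φ X
  unfold logRegulator; positivity

lemma gradL2Sq_add_le (L j : ℕ) (φ ψ : Torus N → ℝ) (X : Finset (Torus N)) :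
    gradL2Sq L j (φ + ψ) X ≤ 2 * gradL2Sq L j φ X + 2 * gradL2Sq L j ψ X := by
  have : ∀ x μ, (L : ℝ) ^ (2 * j) * diff μ (φ + ψ) x ^ 2 ≤
      2 * ((L : ℝ) ^ (2 * j) * diff μ φ x ^ 2) + 2 * ((L : ℝ) ^ (2 * j) * diff μ ψ x ^ 2) := by
    intro x μ
    rw [diff_add, Pi.add_apply]
    nlinarith [mul_nonneg (pow_nonneg (Nat.cast_nonneg (α := ℝ) L) (2 * j))
      (sq_nonneg (diff μ φ x - diff μ ψ x))]
  calc gradL2Sq L j (φ + ψ) X ≤ ((L : ℝ) ^ (2 * j))⁻¹ * ∑ x ∈ X, (1 / 2 : ℝ) * ∑ μ : Dir,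
        (2 * ((L : ℝ) ^ (2 * j) * diff μ φ x ^ 2) + 2 * ((L : ℝ) ^ (2 * j) * diff μ ψ x ^ 2)) := by
        unfold gradL2Sq
        gcongr
        exact this _ _
    _ = _ := by
      unfold gradL2Sq
      simp only [Finset.sum_add_distrib, ← Finset.mul_sum, mul_add]
      ring

lemma gradL2BdrySq_add_le (L j : ℕ) (φ ψ : Torus N → ℝ) (X : Finset (Torus N)) :
    gradL2BdrySq L j (φ + ψ) X ≤ 2 * gradL2BdrySq L j φ X + 2 * gradL2BdrySq L j ψ X := by
  have h := gradL2Sq_add_le L j φ ψ (boundary X)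
  -- The boundary term is $L^j$ times the bulk term over $\partial X$, provided the inverse powers
  -- are not degenerate.
  by_cases hL : (L : ℝ) ^ j = 0
  · simp [gradL2BdrySq, hL]
  have hpos : 0 < (L : ℝ) ^ j := lt_of_le_of_ne (by positivity) (Ne.symm hL)
  have e : ∀ φ : Torus N → ℝ, gradL2BdrySq L j φ X = (L : ℝ) ^ j * gradL2Sq L j φ (boundary X) := by
    intro φ
    unfold gradL2BdrySq gradL2Sq
    rw [two_mul, pow_add, ← mul_assoc]
    congr 1
    field_simp
  rw [e, e, e]
  nlinarith

lemma gradSup_two_add_le (L j : ℕ) (φ ψ : Torus N → ℝ) (Y : Finset (Torus N)) :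
    gradSup L j 2 (φ + ψ) Y ≤ gradSup L j 2 φ Y + gradSup L j 2 ψ Y := by
  refine gradSup_two_le (add_nonneg (gradSup_nonneg _ _ _ _ _) (gradSup_nonneg _ _ _ _ _))
    fun x hx μ ν => ?_
  rw [diff_add, diff_add, Pi.add_apply]
  have h1 := norm_diff_diff_le_gradSup (L := L) (j := j) (f := φ) hx μ ν
  have h2 := norm_diff_diff_le_gradSup (L := L) (j := j) (f := ψ) hx μ ν
  have h3 : (L : ℝ) ^ (2 * j) * ‖diff μ (diff ν φ) x + diff μ (diff ν ψ) x‖ ≤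
      (L : ℝ) ^ (2 * j) * (‖diff μ (diff ν φ) x‖ + ‖diff μ (diff ν ψ) x‖) := by
    gcongr
    exact norm_add_le _ _
  linarith

lemma hessWSq_add_le (L j : ℕ) (φ ψ : Torus N → ℝ) (X : Finset (Torus N)) :
    hessWSq L j (φ + ψ) X ≤ 2 * hessWSq L j φ X + 2 * hessWSq L j ψ X := by
  unfold hessWSq
  rw [Finset.mul_sum, Finset.mul_sum, ← Finset.sum_add_distrib]
  refine Finset.sum_le_sum fun B _ => ?_
  have h := gradSup_two_add_le L j φ ψ (star L j B)
  have h0 := gradSup_nonneg L j 2 (φ + ψ) (star L j B)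
  nlinarith [sq_nonneg (gradSup L j 2 φ (star L j B) - gradSup L j 2 ψ (star L j B))]

/-- From $(a+b)^2\le2a^2+2b^2$ in each term. It separates the background from the fluctuation at the
price of squaring both regulators. -/
lemma logRegulator_add_le {c₁ c₃ κ : ℝ} (h₁ : 0 ≤ c₁) (h₃ : 0 ≤ c₃) (hκ : 0 ≤ κ) (L j : ℕ)
    (φ ψ : Torus N → ℝ) (X : Finset (Torus N)) :
    logRegulator c₁ c₃ κ L j (φ + ψ) X ≤
      2 * logRegulator c₁ c₃ κ L j φ X + 2 * logRegulator c₁ c₃ κ L j ψ X := by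
  have e1 := mul_le_mul_of_nonneg_left (gradL2Sq_add_le L j φ ψ X) (mul_nonneg h₁ hκ)
  have e2 := mul_le_mul_of_nonneg_left (gradL2BdrySq_add_le L j φ ψ X) (mul_nonneg h₃ hκ)
  have e3 := mul_le_mul_of_nonneg_left (hessWSq_add_le L j φ ψ X) (mul_nonneg h₁ hκ)
  unfold logRegulator
  linarith

/-- The gradient norm near a small polymer is controlled by the regulator on the next scale. -/
lemma IsSmall.gradNorm_sq_le (hL : Odd L) (hL7 : 7 ≤ L) (hd : L ^ (j + 1) ∣ N) (hN : 3 ≤ N)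
    {X : Finset (Torus N)} (hX : IsSmall L j X) (φ : Torus N → ℝ) :
    gradNorm L (j + 1) φ (star L j X) ^ 2 ≤
      72 * (gradL2Sq L (j + 1) φ (closure L (j + 1) X) +
        hessWSq L (j + 1) φ (closure L (j + 1) X)) := by
  have hdj : L ^ j ∣ N := (pow_dvd_pow L (Nat.le_succ j)).trans hd
  have hL0 : (0 : ℝ) < L := by exact_mod_cast hL.pos
  obtain ⟨x₀, hx₀⟩ := hX.1.1
  obtain ⟨k, hxk⟩ := exists_mem_block (j := j + 1) hL x₀
  set B := block N L (j + 1) k with hB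
  set S := gradSup L (j + 1) 2 φ (star L (j + 1) B) with hS
  have hS0 : 0 ≤ S := gradSup_nonneg _ _ _ _ _
  have hBcl : B ⊆ closure L (j + 1) X := by
    intro x hx
    simp only [closure, Finset.mem_biUnion, Finset.mem_filter, id]
    exact ⟨B, ⟨block_mem_blocks k, x₀, hxk, hx₀⟩, hx⟩
  have hSle : S ^ 2 ≤ hessWSq L (j + 1) φ (closure L (j + 1) X) :=
    Finset.single_le_sum (f := fun B => (gradSup L (j + 1) 2 φ (star L (j + 1) B)) ^ 2)
      (fun _ _ => sq_nonneg _) (block_mem_blocksIn hBcl)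
  obtain ⟨r, hr, hx₀r⟩ := mem_block.1 hxk
  -- The offset is at most $\frac12L^{j+1}+7L^j\le\frac32L^{j+1}$ once $L\ge7$. A single block $B$
  -- on scale $j+1$ then satisfies $X^*\subset B^*$.
  have hstar : ∀ x ∈ star L j X, ∃ w : Fin 2 → ℤ, (∀ i, 2 * |w i| ≤ 3 * (L : ℤ) ^ (j + 1)) ∧
      x = site N ((L : ℤ) ^ (j + 1) • k + w) := by
    intro x hx
    obtain ⟨w, hw, rfl⟩ := hX.exists_site_of_mem_star hL hdj hx₀ hx
    refine ⟨r + w, fun i => ?_, by rw [hx₀r, ← site_add, add_assoc]⟩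
    have h1 := hr i
    have h2 := hw i
    have h3 : 7 * (L : ℤ) ^ j ≤ (L : ℤ) ^ (j + 1) := by
      rw [pow_succ, mul_comm]
      gcongr
      exact_mod_cast hL7
    have := abs_add_le (r i) (w i)
    simp only [Pi.add_apply]
    omega
  have hmem : ∀ w : Fin 2 → ℤ, (∀ i, 2 * |w i| ≤ 3 * (L : ℤ) ^ (j + 1)) →
      site N ((L : ℤ) ^ (j + 1) • k + w) ∈ star L (j + 1) B := fun w hw =>
    site_mem_star hL hd hN (subset_refl _) fun i => (hw i).trans (by
      have := pow_pos_of_odd (j := j + 1) hL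
      omega)
  have hsub : star L j X ⊆ star L (j + 1) B := by
    intro x hx
    obtain ⟨w, hw, rfl⟩ := hstar x hx
    exact hmem w hw
  set ℓ : ℝ := (L : ℝ) ^ (j + 1) with hℓ
  have hℓ0 : 0 < ℓ := by positivity
  have hg2 : gradSup L (j + 1) 2 φ (star L j X) ≤ S := gradSup_mono φ hsub
  -- averaging over the block
  have hg1 : ∀ x ∈ star L j X, ∀ μ, (ℓ * ‖diff μ φ x‖) ^ 2 ≤
      4 * gradL2Sq L (j + 1) φ (closure L (j + 1) X) + 72 * S ^ 2 := by
    intro x hx μ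
    obtain ⟨w, hw, rfl⟩ := hstar x hx
    set x := site N ((L : ℤ) ^ (j + 1) • k + w)
    have hosc : ∀ y ∈ B, ‖diff μ φ x - diff μ φ y‖ ≤ 6 * ℓ * (S / ℓ ^ 2) := by
      intro y hy
      obtain ⟨v, hv, rfl⟩ := mem_block.1 hy
      have hpos := pow_pos_of_odd (j := j + 1) hL
      have hv' : ∀ i, 2 * |v i| ≤ 3 * (L : ℤ) ^ (j + 1) := fun i => (hv i).trans (by omega)
      refine (norm_sub_le_of_norm_diff_le (f := diff μ φ) (c := (L : ℤ) ^ (j + 1) • k)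
        (M := S / ℓ ^ 2) (R := 3 * (L : ℤ) ^ (j + 1)) (fun w hw ν => ?_) hw hv').trans ?_
      · rw [le_div_iff₀ (by positivity), mul_comm]
        have := norm_diff_diff_le_gradSup (L := L) (j := j + 1) (f := φ) (hmem w hw) ν μ
        rw [mul_comm 2, pow_mul] at this
        exact this
      · gcongr
        have h : ∀ i, |((w i - v i : ℤ) : ℝ)| ≤ 3 * ℓ := by
          intro i
          have h1 : 2 * |w i - v i| ≤ 6 * (L : ℤ) ^ (j + 1) := by
            have := abs_sub (w i) (v i)
            have := hw i
            have := hv' i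
            omega
          have := abs_cast_le_of_two_mul_le h1
          push_cast at this ⊢
          linarith
        linarith [h 0, h 1]
    -- The oscillation of the scaled gradient is at most $6S$, and $2\cdot6^2=72$.
    have hpt : ∀ y ∈ B, (ℓ * ‖diff μ φ x‖) ^ 2 ≤ 2 * (ℓ ^ 2 * diff μ φ y ^ 2) + 72 * S ^ 2 := by
      intro y hy
      have h1 := hosc y hy
      have h2 : ‖diff μ φ x‖ ≤ ‖diff μ φ y‖ + 6 * ℓ * (S / ℓ ^ 2) := by
        have := norm_sub_norm_le (diff μ φ x) (diff μ φ y)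
        linarith
      have h3 : ℓ * ‖diff μ φ x‖ ≤ ℓ * ‖diff μ φ y‖ + 6 * S := by
        refine (mul_le_mul_of_nonneg_left h2 hℓ0.le).trans (le_of_eq ?_)
        field_simp
      have h4 : (ℓ * ‖diff μ φ x‖) ^ 2 ≤ (ℓ * ‖diff μ φ y‖ + 6 * S) ^ 2 := by gcongr
      have h5 : diff μ φ y ^ 2 = ‖diff μ φ y‖ ^ 2 := by rw [Real.norm_eq_abs, sq_abs]
      rw [h5]
      nlinarith [sq_nonneg (ℓ * ‖diff μ φ y‖ - 6 * S)]
    have hsum := Finset.sum_le_sum hpt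
    rw [Finset.sum_const, Finset.sum_add_distrib, Finset.sum_const, ← Finset.mul_sum,
      hB, card_block hL hd, ← hB, nsmul_eq_mul, nsmul_eq_mul] at hsum
    push_cast at hsum
    rw [← hℓ] at hsum
    -- The factor $2$ undoes the $\frac12$ in the sum over directions; $B$ has $\ell^2$ sites, so
    -- the averaged inequality has coefficient $4$.
    have hle : ∑ y ∈ B, ℓ ^ 2 * diff μ φ y ^ 2 ≤
        2 * (ℓ ^ 2 * gradL2Sq L (j + 1) φ (closure L (j + 1) X)) := by
      have e : (L : ℝ) ^ (2 * (j + 1)) = ℓ ^ 2 := by rw [mul_comm, pow_mul]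
      rw [gradL2Sq, e, mul_inv_cancel_left₀ (by positivity), Finset.mul_sum]
      calc ∑ y ∈ B, ℓ ^ 2 * diff μ φ y ^ 2 ≤ ∑ y ∈ B, ∑ μ : Dir, ℓ ^ 2 * diff μ φ y ^ 2 :=
            Finset.sum_le_sum fun y _ => Finset.single_le_sum
              (f := fun μ => ℓ ^ 2 * diff μ φ y ^ 2) (fun _ _ => by positivity)
              (Finset.mem_univ μ)
        _ ≤ ∑ y ∈ closure L (j + 1) X, ∑ μ : Dir, ℓ ^ 2 * diff μ φ y ^ 2 :=
            Finset.sum_le_sum_of_subset_of_nonneg hBcl fun _ _ _ =>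
              Finset.sum_nonneg fun _ _ => by positivity
        _ = _ := Finset.sum_congr rfl fun _ _ => by ring
    have hℓ2 : 0 < ℓ ^ 2 := by positivity
    refine le_of_mul_le_mul_left ?_ hℓ2
    linarith
  have hg0 := gradL2Sq_nonneg L (j + 1) φ (closure L (j + 1) X)
  rw [gradNorm]
  set T := 4 * gradL2Sq L (j + 1) φ (closure L (j + 1) X) + 72 * S ^ 2 with hT
  have hT0 : 0 ≤ T := by positivity
  have hmax : max (gradSup L (j + 1) 1 φ (star L j X)) (gradSup L (j + 1) 2 φ (star L j X)) ≤
      Real.sqrt T := by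
    refine max_le (gradSup_one_le (Real.sqrt_nonneg _) fun x hx μ => ?_) (hg2.trans ?_)
    · exact Real.le_sqrt_of_sq_le (hg1 x hx μ)
    · exact Real.le_sqrt_of_sq_le (by rw [hT]; linarith [sq_nonneg S])
  have hmax0 : 0 ≤ max (gradSup L (j + 1) 1 φ (star L j X)) (gradSup L (j + 1) 2 φ (star L j X)) :=
    (gradSup_nonneg _ _ _ _ _).trans (le_max_left _ _)
  calc _ ≤ Real.sqrt T ^ 2 := pow_le_pow_left₀ hmax0 hmax 2
    _ = T := Real.sq_sqrt hT0
    _ ≤ _ := by rw [hT]; linarith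

end Regulator

/-! ### Differentiation under the integral sign. -/

section Smoothness

open Topology

variable {V E Ω : Type*} [NormedAddCommGroup V] [NormedSpace ℝ V] [MeasurableSpace V]
  [BorelSpace V] [SecondCountableTopology V]
  [NormedAddCommGroup E] [NormedSpace ℝ E] [CompleteSpace E] [MeasurableSpace Ω]

/-- Differentiation under the integral to all orders, for an average over translations. -/
lemma hasFTaylorSeriesUpTo_integral_shift {ν : Measure Ω} {T : Ω → V}
    (hT : Measurable T) {F : V → E} (hF : ContDiff ℝ ∞ F)
    (hdom : ∀ (n : ℕ) (φ₀ : V), ∃ bound : Ω → ℝ, Integrable bound ν ∧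
      ∀ φ ∈ Metric.ball φ₀ 1, ∀ o, ‖iteratedFDeriv ℝ n F (φ + T o)‖ ≤ bound o) :
    HasFTaylorSeriesUpTo (⊤ : ℕ∞) (fun φ => ∫ o, F (φ + T o) ∂ν)
      (fun φ n => ∫ o, iteratedFDeriv ℝ n F (φ + T o) ∂ν) := by
  have hcont : ∀ n, Continuous (iteratedFDeriv ℝ n F) := fun n =>
    hF.continuous_iteratedFDeriv (m := n) (mod_cast le_top)
  have hmeas : ∀ n φ, AEStronglyMeasurable (fun o => iteratedFDeriv ℝ n F (φ + T o)) ν :=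
    fun n φ => ((hcont n).stronglyMeasurable.comp_measurable
      (measurable_const.add hT)).aestronglyMeasurable
  have hint : ∀ n φ, Integrable (fun o => iteratedFDeriv ℝ n F (φ + T o)) ν := by
    intro n φ
    obtain ⟨b, hb, hle⟩ := hdom n φ
    exact hb.mono' (hmeas n φ) (Filter.Eventually.of_forall fun o =>
      hle φ (Metric.mem_ball_self one_pos) o)
  have hderiv : ∀ (m : ℕ) (φ : V), HasFDerivAt
      (fun φ => ∫ o, iteratedFDeriv ℝ m F (φ + T o) ∂ν)
      ((∫ o, iteratedFDeriv ℝ (m + 1) F (φ + T o) ∂ν).curryLeft) φ := by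
    intro m φ
    obtain ⟨b, hb, hle⟩ := hdom (m + 1) φ
    set e := (continuousMultilinearCurryLeftEquiv ℝ (fun _ : Fin (m + 1) => V) E)
    -- Currying commutes with the integral. This identifies the derivative of the $m$-th term of the
    -- series with its $(m+1)$-st.
    have hcomm : (∫ o, iteratedFDeriv ℝ (m + 1) F (φ + T o) ∂ν).curryLeft =
        ∫ o, e (iteratedFDeriv ℝ (m + 1) F (φ + T o)) ∂ν := by
      have hintE : Integrable (fun o => e (iteratedFDeriv ℝ (m + 1) F (φ + T o))) ν :=
        hb.mono' (e.continuous.comp_aestronglyMeasurable (hmeas (m + 1) φ))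
          (Filter.Eventually.of_forall fun o => by
            rw [e.norm_map]
            exact hle φ (Metric.mem_ball_self one_pos) o)
      ext v w
      rw [ContinuousMultilinearMap.curryLeft_apply,
        ContinuousMultilinearMap.integral_apply (hint (m + 1) φ),
        ContinuousLinearMap.integral_apply hintE,
        ContinuousMultilinearMap.integral_apply (hintE.apply_continuousLinearMap v)]
      rfl
    rw [hcomm]
    refine hasFDerivAt_integral_of_dominated_of_fderiv_le
      (F' := fun φ o => e (iteratedFDeriv ℝ (m + 1) F (φ + T o)))
      (Metric.ball_mem_nhds φ one_pos) (Filter.Eventually.of_forall fun φ => hmeas m φ)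
      (hint m φ) (e.continuous.comp_aestronglyMeasurable (hmeas (m + 1) φ))
      (bound := b) (Filter.Eventually.of_forall fun o φ' hφ' => ?_) hb
      (Filter.Eventually.of_forall fun o φ' hφ' => ?_)
    · rw [e.norm_map]
      exact hle φ' hφ' o
    · have hd : HasFDerivAt (iteratedFDeriv ℝ m F) (e (iteratedFDeriv ℝ (m + 1) F (φ' + T o)))
          (φ' + T o) := by
        have := (hF.differentiable_iteratedFDeriv (m := m)
          (by exact_mod_cast ENat.natCast_lt_top m) (φ' + T o)).hasFDerivAt
        rwa [fderiv_iteratedFDeriv] at this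
      exact hd.comp φ' ((hasFDerivAt_id φ').add_const (T o))
  refine ⟨fun φ => ?_, fun m _ φ => hderiv m φ, fun m _ => ?_⟩
  · rw [ContinuousMultilinearMap.curry0, ContinuousMultilinearMap.integral_apply (hint 0 φ)]
    simp
  · exact continuous_iff_continuousAt.2 fun φ => (hderiv m φ).continuousAt

end Smoothness

/-! ### The second order Taylor remainder. -/

section Taylor

variable {V : Type*} [NormedAddCommGroup V] [NormedSpace ℝ V] {H : V → ℂ}

/-- The second order Taylor remainder at zero. -/
def taylorRem (H : V → ℂ) (ξ : V) : ℂ :=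
  H ξ - (H 0 + fderiv ℝ H 0 ξ + (2 : ℝ)⁻¹ • fderiv ℝ (fderiv ℝ H) 0 ξ ξ)

/-- Symmetry of the second derivative turns the derivative of the diagonal quadratic form into twice
one of its partial evaluations, cancelling the $\frac12$. -/
lemma fderiv_taylorRem (hH : ContDiff ℝ ∞ H) :
    fderiv ℝ (taylorRem H) =
      fun ξ => fderiv ℝ H ξ - (fderiv ℝ H 0 + fderiv ℝ (fderiv ℝ H) 0 ξ) := by
  ext1 ξ
  have h1 : HasFDerivAt H (fderiv ℝ H ξ) ξ := (hH.differentiable (by simp) ξ).hasFDerivAt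
  have hsymm : ∀ v w, fderiv ℝ (fderiv ℝ H) 0 v w = fderiv ℝ (fderiv ℝ H) 0 w v :=
    fun v w => (hH.contDiffAt.isSymmSndFDerivAt (by
      simp only [minSmoothness_of_isRCLikeNormedField]
      exact ENat.LEInfty.out)).eq v w
  have h2 : HasFDerivAt (fun ξ => fderiv ℝ (fderiv ℝ H) 0 ξ ξ)
      ((2 : ℝ) • fderiv ℝ (fderiv ℝ H) 0 ξ) ξ := by
    have := ((fderiv ℝ (fderiv ℝ H) 0).hasFDerivAt (x := ξ)).clm_apply (hasFDerivAt_id ξ)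
    refine this.congr_fderiv ?_
    ext v
    simp [two_mul, hsymm v ξ]
  have := h1.sub (((hasFDerivAt_const (H 0) ξ).add (fderiv ℝ H 0).hasFDerivAt).add
    (h2.const_smul (2 : ℝ)⁻¹))
  rw [smul_smul, inv_mul_cancel₀ two_ne_zero, one_smul, zero_add] at this
  exact this.fderiv

lemma fderiv_fderiv_taylorRem (hH : ContDiff ℝ ∞ H) :
    fderiv ℝ (fderiv ℝ (taylorRem H)) =
      fun ξ => fderiv ℝ (fderiv ℝ H) ξ - fderiv ℝ (fderiv ℝ H) 0 := by
  rw [fderiv_taylorRem hH]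
  ext1 ξ
  have h1 : HasFDerivAt (fderiv ℝ H) (fderiv ℝ (fderiv ℝ H) ξ) ξ :=
    ((hH.fderiv_right (m := ∞) (by simp)).differentiable (by simp) ξ).hasFDerivAt
  have := h1.sub ((hasFDerivAt_const (fderiv ℝ H 0) ξ).add
    (fderiv ℝ (fderiv ℝ H) 0).hasFDerivAt)
  rw [zero_add] at this
  exact this.fderiv

/-- The subtracted polynomial has degree two, so three derivatives remove it. -/
lemma iteratedFDeriv_taylorRem_of_three_le (hH : ContDiff ℝ ∞ H) (n : ℕ) (ξ : V) :
    iteratedFDeriv ℝ (n + 3) (taylorRem H) ξ = iteratedFDeriv ℝ (n + 3) H ξ := by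
  have h3 : fderiv ℝ (fderiv ℝ (fderiv ℝ (taylorRem H))) =
      fderiv ℝ (fderiv ℝ (fderiv ℝ H)) := by
    rw [fderiv_fderiv_taylorRem hH]
    ext1 ξ
    have h : HasFDerivAt (fderiv ℝ (fderiv ℝ H)) (fderiv ℝ (fderiv ℝ (fderiv ℝ H)) ξ) ξ :=
      (((hH.fderiv_right (m := ∞) (by simp)).fderiv_right (m := ∞) (by simp)).differentiable
        (by simp) ξ).hasFDerivAt
    exact (h.sub_const _).fderiv
  ext m
  simp only [iteratedFDeriv_succ_apply_right, h3]

lemma iteratedFDeriv_taylorRem_zero (hH : ContDiff ℝ ∞ H) {n : ℕ} (hn : n ≤ 2) :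
    iteratedFDeriv ℝ n (taylorRem H) 0 = 0 := by
  ext m
  interval_cases n
  · simp [taylorRem]
  · simp [iteratedFDeriv_one_apply, fderiv_taylorRem hH]
  · simp [iteratedFDeriv_two_apply, fderiv_fderiv_taylorRem hH]

lemma contDiff_taylorRem (hH : ContDiff ℝ ∞ H) : ContDiff ℝ ∞ (taylorRem H) := by
  unfold taylorRem
  fun_prop

/-- Integrating a bound on the `n + 1`-st derivative along the segment from the origin. -/
lemma norm_iteratedFDeriv_le_of_segment {S : V → ℂ} (hS : ContDiff ℝ ∞ S) {n : ℕ} {ξ : V}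
    {p : V → ℝ} {B : ℝ} (h0 : iteratedFDeriv ℝ n S 0 = 0)
    (hb : ∀ t ∈ Set.Icc (0 : ℝ) 1, ∀ w : Fin (n + 1) → V,
      ‖iteratedFDeriv ℝ (n + 1) S (t • ξ) w‖ ≤ B * ∏ i, p (w i)) :
    ∀ t ∈ Set.Icc (0 : ℝ) 1, ∀ w : Fin n → V,
      ‖iteratedFDeriv ℝ n S (t • ξ) w‖ ≤ B * p ξ * ∏ i, p (w i) := by
  intro t ht w
  have hd : ∀ s : ℝ, HasDerivAt (fun s : ℝ => iteratedFDeriv ℝ n S (s • t • ξ) w)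
      (iteratedFDeriv ℝ (n + 1) S (s • t • ξ) (Fin.cons (t • ξ) w)) s := by
    intro s
    have h1 := (hS.differentiable_iteratedFDeriv (m := n)
      (by exact_mod_cast ENat.natCast_lt_top n) (s • t • ξ)).hasFDerivAt
    have h2 : HasDerivAt (fun s : ℝ => s • t • ξ) (t • ξ) s := by
      simpa using (hasDerivAt_id s).smul_const (t • ξ)
    have h3 := h1.comp_hasDerivAt s h2
    have h4 := ((ContinuousMultilinearMap.apply ℝ (fun _ : Fin n => V) ℂ w).hasFDerivAt).comp_hasDerivAt
      s h3
    exact h4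
  have := norm_image_sub_le_of_norm_deriv_le_segment_01'
    (f := fun s : ℝ => iteratedFDeriv ℝ n S (s • t • ξ) w) (C := B * p ξ * ∏ i, p (w i))
    (fun s _ => (hd s).hasDerivWithinAt) (fun s hs => by
      have hst : s * t ∈ Set.Icc (0 : ℝ) 1 :=
        ⟨mul_nonneg hs.1 ht.1, mul_le_one₀ hs.2.le ht.1 ht.2⟩
      have h := hb (s * t) hst (Fin.cons ξ w)
      -- The scalar leaves by multilinearity and is at most one, so `p` need not be homogeneous.
      have e : (Fin.cons (t • ξ) w : Fin (n + 1) → V) =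
          Function.update (Fin.cons ξ w : Fin (n + 1) → V) 0 (t • ξ) := by simp
      rw [e, ContinuousMultilinearMap.map_update_smul, Fin.update_cons_zero, norm_smul, smul_smul]
      rw [Fin.prod_univ_succ] at h
      simp only [Fin.cons_zero, Fin.cons_succ] at h
      have ht1 : ‖t‖ ≤ 1 := by rw [Real.norm_eq_abs, abs_of_nonneg ht.1]; exact ht.2
      calc ‖t‖ * _ ≤ 1 * (B * (p ξ * ∏ i, p (w i))) := by gcongr
        _ = _ := by ring)
  simpa [h0] using this

/-- Bounds on the derivatives of order at most two of the Taylor remainder. -/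
lemma norm_iteratedFDeriv_taylorRem_le (hH : ContDiff ℝ ∞ H) {ξ : V} {p : V → ℝ} {B : ℝ}
    (hb : ∀ t ∈ Set.Icc (0 : ℝ) 1, ∀ w : Fin 3 → V,
      ‖iteratedFDeriv ℝ 3 H (t • ξ) w‖ ≤ B * ∏ i, p (w i)) {n : ℕ} (hn : n ≤ 2)
    (w : Fin n → V) :
    ‖iteratedFDeriv ℝ n (taylorRem H) ξ w‖ ≤ B * p ξ ^ (3 - n) * ∏ i, p (w i) := by
  have hS := contDiff_taylorRem hH
  -- Descent from order three to zero: each lower derivative vanishes at the origin and costs one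
  -- factor `p ξ`.
  have h2 := norm_iteratedFDeriv_le_of_segment hS (iteratedFDeriv_taylorRem_zero hH le_rfl)
    (fun t ht w => by rw [iteratedFDeriv_taylorRem_of_three_le hH 0]; exact hb t ht w)
  have h1 := norm_iteratedFDeriv_le_of_segment hS (iteratedFDeriv_taylorRem_zero hH one_le_two) h2
  have h0 := norm_iteratedFDeriv_le_of_segment hS (iteratedFDeriv_taylorRem_zero hH zero_le_two) h1
  have h1m : (1 : ℝ) ∈ Set.Icc (0 : ℝ) 1 := by simp
  interval_cases n
  · have := h0 1 h1m w
    rw [one_smul] at this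
    convert this using 2
    ring
  · have := h1 1 h1m w
    rw [one_smul] at this
    convert this using 2
    ring
  · have := h2 1 h1m w
    rw [one_smul] at this
    convert this using 2
    ring

lemma rem_two_eq_taylorRem {N : ℕ} [NeZero N] (H : (Torus N → ℝ) → ℂ) :
    rem 2 H = taylorRem H := by
  ext ξ
  simp only [rem, tay, taylorRem, Finset.sum_range_succ, Finset.sum_range_zero,
    iteratedFDeriv_zero_apply, iteratedFDeriv_one_apply, iteratedFDeriv_two_apply]
  simp [Nat.factorial]

end Taylor

/-! ### From activity norms to derivative bounds, and their stability under averaging. -/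

section Activities

variable {N : ℕ} [NeZero N] {L j : ℕ} {Y : Finset (Torus N)}

/-- A crude comparison, serving only for domination and local boundedness; its dependence on $L$
never reaches the final estimate. -/
lemma c2Norm_le_norm (hL : 1 ≤ L) (f : Torus N → ℝ) :
    c2Norm L j f Y ≤ 4 * (L : ℝ) ^ (2 * j) * ‖f‖ := by
  have hL1 : (1 : ℝ) ≤ L := by exact_mod_cast hL
  have hp : (1 : ℝ) ≤ (L : ℝ) ^ (2 * j) := one_le_pow₀ hL1
  have hp' : (L : ℝ) ^ j ≤ (L : ℝ) ^ (2 * j) := pow_le_pow_right₀ hL1 (by omega)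
  have h1 : ∀ (f : Torus N → ℝ) (B : ℝ), (∀ x, ‖f x‖ ≤ B) → ∀ μ x, ‖diff μ f x‖ ≤ 2 * B := by
    intro f B hB μ x
    have := norm_sub_le (f (x + unitVec μ)) (f x)
    have := hB (x + unitVec μ)
    have := hB x
    simp only [diff]
    linarith
  have hf := norm_le_pi_norm f
  have hf0 := norm_nonneg f
  refine c2Norm_le (by positivity) (fun x _ => (hf x).trans ?_) (fun x _ μ => ?_)
    (fun x _ μ ν => ?_)
  · nlinarith
  · calc (L : ℝ) ^ j * ‖diff μ f x‖ ≤ (L : ℝ) ^ (2 * j) * (2 * ‖f‖) := by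
          gcongr
          exact h1 f _ hf μ x
      _ ≤ 4 * (L : ℝ) ^ (2 * j) * ‖f‖ := by nlinarith [mul_nonneg (zero_le_one.trans hp) hf0]
  · calc (L : ℝ) ^ (2 * j) * ‖diff μ (diff ν f) x‖ ≤ (L : ℝ) ^ (2 * j) * (2 * (2 * ‖f‖)) := by
          gcongr
          exact h1 _ _ (h1 f _ hf ν) μ x
      _ = 4 * (L : ℝ) ^ (2 * j) * ‖f‖ := by ring

/-- A function of the field that depends on the field in `Y` only. -/
def LocalOn (Y : Finset (Torus N)) (F : (Torus N → ℝ) → ℂ) : Prop :=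
  ∀ φ ψ : Torus N → ℝ, (∀ x ∈ Y, φ x = ψ x) → F φ = F ψ

/-- Bounds on all derivatives of a function of the field at `φ`, in terms of a weight `g φ`. -/
def DerivBound (h : ℝ) (L j : ℕ) (Y : Finset (Torus N)) (g : (Torus N → ℝ) → ℝ)
    (F : (Torus N → ℝ) → ℂ) : Prop :=
  ∀ (n : ℕ) (φ : Torus N → ℝ) (f : Fin n → Torus N → ℝ),
    h ^ n / (n.factorial : ℝ) * ‖iteratedFDeriv ℝ n F φ f‖ ≤ g φ * ∏ i, c2Norm L j (f i) Y

/-- The restriction of a field to `Y`, extended by zero. -/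
def restrictField (Y : Finset (Torus N)) : (Torus N → ℝ) →L[ℝ] (Torus N → ℝ) :=
  open Classical in
  ContinuousLinearMap.pi fun x => if x ∈ Y then ContinuousLinearMap.proj x else 0

lemma restrictField_apply_of_mem {x : Torus N} (hx : x ∈ Y) (u : Torus N → ℝ) :
    restrictField Y u x = u x := by
  simp [restrictField, hx]

lemma restrictField_apply_of_notMem {x : Torus N} (hx : x ∉ Y) (u : Torus N → ℝ) :
    restrictField Y u x = 0 := by
  simp [restrictField, hx]

lemma restrictField_congr {u v : Torus N → ℝ} (h : ∀ x ∈ Y, u x = v x) :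
    restrictField Y u = restrictField Y v := by
  ext x
  by_cases hx : x ∈ Y
  · rw [restrictField_apply_of_mem hx, restrictField_apply_of_mem hx, h x hx]
  · rw [restrictField_apply_of_notMem hx, restrictField_apply_of_notMem hx]

lemma restrictField_eq_sum (u : Torus N → ℝ) :
    restrictField Y u = ∑ x ∈ Y, u x • (Pi.single x (1 : ℝ) : Torus N → ℝ) := by
  ext y
  by_cases hy : y ∈ Y
  · rw [restrictField_apply_of_mem hy, Finset.sum_apply, Finset.sum_eq_single y]
    · simp
    · intro b _ hb
      simp [hb.symm]
    · exact fun h => absurd hy h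
  · rw [restrictField_apply_of_notMem hy, Finset.sum_apply]
    refine (Finset.sum_eq_zero fun b hb => ?_).symm
    have : y ≠ b := fun h => hy (h ▸ hb)
    simp [this]

/-- `F` equals its composition with the linear projection `restrictField Y`; the chain rule and
idempotence of the projection give the claim. -/
lemma LocalOn.iteratedFDeriv_restrict {F : (Torus N → ℝ) → ℂ} (hF : LocalOn Y F)
    (hs : ContDiff ℝ ∞ F) (n : ℕ) (φ : Torus N → ℝ) (u : Fin n → Torus N → ℝ) :
    iteratedFDeriv ℝ n F φ (fun i => restrictField Y (u i)) = iteratedFDeriv ℝ n F φ u := by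
  have hcomp : F ∘ restrictField Y = F := by
    ext ψ
    exact hF _ _ fun x hx => restrictField_apply_of_mem hx ψ
  have key : ∀ u : Fin n → Torus N → ℝ, iteratedFDeriv ℝ n F φ u =
      iteratedFDeriv ℝ n F (restrictField Y φ) (fun i => restrictField Y (u i)) := by
    intro u
    conv_lhs => rw [← hcomp]
    rw [(restrictField Y).iteratedFDeriv_comp_right hs φ (i := n) (mod_cast le_top)]
    rfl
  rw [key, key u]
  congr 1
  ext1 i
  exact restrictField_congr fun x hx => restrictField_apply_of_mem hx _

lemma LocalOn.iteratedFDeriv_congr {F : (Torus N → ℝ) → ℂ} (hF : LocalOn Y F)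
    (hs : ContDiff ℝ ∞ F) (n : ℕ) (φ : Torus N → ℝ) {u v : Fin n → Torus N → ℝ}
    (h : ∀ i, ∀ x ∈ Y, u i x = v i x) :
    iteratedFDeriv ℝ n F φ u = iteratedFDeriv ℝ n F φ v := by
  rw [← hF.iteratedFDeriv_restrict hs n φ u, ← hF.iteratedFDeriv_restrict hs n φ v]
  congr 1
  ext1 i
  exact restrictField_congr (h i)

/-- The sum over sites is the multilinear expansion of the restricted directions in point masses. -/
lemma dirDeriv_ofReal {F : (Torus N → ℝ) → ℂ} (hF : LocalOn Y F)
    (hs : ContDiff ℝ ∞ F) (n : ℕ) (φ : Torus N → ℝ) (u : Fin n → Torus N → ℝ) :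
    dirDeriv Y F φ n (fun i x => (u i x : ℂ)) = iteratedFDeriv ℝ n F φ u := by
  rw [← hF.iteratedFDeriv_restrict hs n φ u]
  simp only [restrictField_eq_sum]
  have := (iteratedFDeriv ℝ n F φ).toMultilinearMap.map_sum_finset
    (fun i x => u i x • (Pi.single x (1 : ℝ) : Torus N → ℝ)) (fun _ : Fin n => Y)
  simp only [ContinuousMultilinearMap.coe_coe] at this
  rw [this, dirDeriv]
  refine Finset.sum_congr rfl fun x _ => ?_
  rw [ContinuousMultilinearMap.map_smul_univ]
  simp

/-- Complex test functions cost at most a factor two each. -/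
lemma norm_dirDeriv_le {F : (Torus N → ℝ) → ℂ} (hF : LocalOn Y F)
    (hs : ContDiff ℝ ∞ F) {n k : ℕ} {φ : Torus N → ℝ} {B : ℝ} (hB : 0 ≤ B)
    (h : ∀ u : Fin n → Torus N → ℝ,
      ‖iteratedFDeriv ℝ n F φ u‖ ≤ B * ∏ i, c2Norm L k (u i) Y)
    (f : Fin n → Torus N → ℂ) (hf : ∀ i, c2Norm L k (f i) Y ≤ 1) :
    ‖dirDeriv Y F φ n f‖ ≤ 2 ^ n * B := by
  set part : Bool → (Torus N → ℂ) → Torus N → ℝ := fun b g x =>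
    if b then (g x).im else (g x).re with hpart
  set c : Bool → ℂ := fun b => if b then Complex.I else 1 with hc
  have hpartle : ∀ b g, c2Norm L k (part b g) Y ≤ c2Norm L k g Y := by
    intro b g
    cases b
    · exact c2Norm_comp_le L k Complex.reAddGroupHom Complex.abs_re_le_norm g Y
    · exact c2Norm_comp_le L k Complex.imAddGroupHom Complex.abs_im_le_norm g Y
  have hsplit : ∀ x : Fin n → Torus N, ∏ i, f i (x i) =
      ∑ b : Fin n → Bool, (∏ i, c (b i)) * ∏ i, ((part (b i) (f i) (x i) : ℝ) : ℂ) := by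
    intro x
    have h1 : ∀ i, f i (x i) = ∑ b : Bool, c b * ((part b (f i) (x i) : ℝ) : ℂ) := by
      intro i
      simp only [hc, hpart, Fintype.sum_bool, if_true, Bool.false_eq_true, if_false, one_mul]
      rw [add_comm, mul_comm]
      exact (Complex.re_add_im _).symm
    simp_rw [h1]
    rw [Finset.prod_univ_sum]
    simp only [Fintype.piFinset_univ, Finset.prod_mul_distrib]
  have hexp : dirDeriv Y F φ n f = ∑ b : Fin n → Bool, (∏ i, c (b i)) *
      iteratedFDeriv ℝ n F φ (fun i => part (b i) (f i)) := by
    simp_rw [← dirDeriv_ofReal hF hs]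
    simp only [dirDeriv, hsplit, Finset.mul_sum, Finset.sum_mul]
    rw [Finset.sum_comm]
    refine Finset.sum_congr rfl fun b _ => Finset.sum_congr rfl fun x _ => ?_
    ring
  rw [hexp]
  refine (norm_sum_le _ _).trans ?_
  have hterm : ∀ b ∈ (Finset.univ : Finset (Fin n → Bool)), ‖(∏ i, c (b i)) *
      iteratedFDeriv ℝ n F φ (fun i => part (b i) (f i))‖ ≤ B := by
    intro b _
    have hc1 : ∀ b, ‖c b‖ = 1 := by intro b; cases b <;> simp [hc]
    rw [norm_mul, norm_prod]
    simp only [hc1, Finset.prod_const_one, one_mul]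
    refine (h _).trans (mul_le_of_le_one_right hB ?_)
    exact Finset.prod_le_one (fun i _ => c2Norm_nonneg _ _ _ _)
      fun i _ => (hpartle _ _).trans (hf i)
  refine (Finset.sum_le_card_nsmul _ _ _ hterm).trans (le_of_eq ?_)
  simp

/-- The norm of polymer activities bounds all derivatives in real directions. -/
lemma derivBound_of_tNorm_le {h : ℝ} (hh : 0 < h) {F : (Torus N → ℝ) → ℂ} (hF : LocalOn Y F)
    (hs : ContDiff ℝ ∞ F) {g : (Torus N → ℝ) → ℝ} (hg : ∀ φ, 0 ≤ g φ)
    (hle : ∀ φ, tNorm h L j Y F φ ≤ ENNReal.ofReal (g φ)) : DerivBound h L j Y g F := by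
  intro n φ f
  -- A direction of norm zero vanishes on `Y`, and locality kills the derivative. Otherwise the
  -- directions are normalised and one term of the series is read off.
  by_cases hz : ∃ i, c2Norm L j (f i) Y = 0
  · obtain ⟨i, hi⟩ := hz
    have h0 : restrictField Y (f i) = 0 := by
      rw [restrictField_congr (v := 0), map_zero]
      intro x hx
      have := norm_le_c2Norm (L := L) (k := j) (f := f i) hx
      rw [hi] at this
      simpa using this
    rw [← hF.iteratedFDeriv_restrict hs, ContinuousMultilinearMap.map_coord_zero _ i h0]
    simpa using mul_nonneg (hg φ) (Finset.prod_nonneg fun i _ => c2Norm_nonneg _ _ _ _)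
  · push Not at hz
    have hpos : ∀ i, 0 < c2Norm L j (f i) Y := fun i =>
      lt_of_le_of_ne (c2Norm_nonneg _ _ _ _) (hz i).symm
    set u : Fin n → Torus N → ℝ := fun i => (c2Norm L j (f i) Y)⁻¹ • f i with hu
    have hu1 : ∀ i, c2Norm L j (fun x => ((u i x : ℝ) : ℂ)) Y ≤ 1 := by
      intro i
      have h1 := c2Norm_comp_le L j (E := ℝ) (F := ℂ) (Complex.ofRealHom : ℝ →+ ℂ)
        (by simp) (u i) Y
      refine h1.trans ((c2Norm_smul_le L j _ (f i) Y).trans (le_of_eq ?_))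
      rw [norm_inv, Real.norm_eq_abs, abs_of_pos (hpos i), inv_mul_cancel₀ (hpos i).ne']
    have hu2 : iteratedFDeriv ℝ n F φ f = ((∏ i, c2Norm L j (f i) Y : ℝ) : ℂ) *
        iteratedFDeriv ℝ n F φ u := by
      have : f = fun i => c2Norm L j (f i) Y • u i := by
        ext1 i
        rw [hu, smul_inv_smul₀ (hpos i).ne']
      conv_lhs => rw [this]
      rw [ContinuousMultilinearMap.map_smul_univ, Complex.real_smul]
    have hle1 : ENNReal.ofReal (h ^ n / (n.factorial : ℝ) * ‖iteratedFDeriv ℝ n F φ u‖) ≤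
        ENNReal.ofReal (g φ) := by
      refine le_trans ?_ (hle φ)
      rw [ENNReal.ofReal_mul (by positivity)]
      refine le_trans ?_ (ENNReal.le_tsum n)
      gcongr
      rw [tNormN, ← dirDeriv_ofReal hF hs]
      exact le_iSup₂_of_le (fun i x => ((u i x : ℝ) : ℂ)) hu1 le_rfl
    have hle2 := (ENNReal.ofReal_le_ofReal_iff (hg φ)).1 hle1
    have hprod : 0 ≤ ∏ i, c2Norm L j (f i) Y :=
      Finset.prod_nonneg fun i _ => c2Norm_nonneg _ _ _ _
    rw [hu2, norm_mul, Complex.norm_real, Real.norm_eq_abs, abs_of_nonneg hprod,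
      mul_left_comm, mul_comm]
    exact mul_le_mul_of_nonneg_right hle2 hprod

lemma DerivBound.norm_le {h : ℝ} (hh : 0 < h) (hL : 1 ≤ L) {F : (Torus N → ℝ) → ℂ}
    {g : (Torus N → ℝ) → ℝ} (hg : ∀ φ, 0 ≤ g φ) (hF : DerivBound h L j Y g F) (n : ℕ)
    (φ : Torus N → ℝ) : ‖iteratedFDeriv ℝ n F φ‖ ≤
      ((n.factorial : ℝ) / h ^ n * (4 * (L : ℝ) ^ (2 * j)) ^ n) * g φ := by
  refine ContinuousMultilinearMap.opNorm_le_bound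
    (mul_nonneg (by positivity) (hg φ)) fun f => ?_
  have h1 := hF n φ f
  have hpos : 0 < h ^ n / (n.factorial : ℝ) := by positivity
  have h2 : ∏ i, c2Norm L j (f i) Y ≤ (4 * (L : ℝ) ^ (2 * j)) ^ n * ∏ i, ‖f i‖ := by
    calc ∏ i, c2Norm L j (f i) Y ≤ ∏ i, (4 * (L : ℝ) ^ (2 * j) * ‖f i‖) :=
          Finset.prod_le_prod (fun i _ => c2Norm_nonneg _ _ _ _) fun i _ => c2Norm_le_norm hL _
      _ = _ := by simp [Finset.prod_mul_distrib]
  have h3 := h1.trans (mul_le_mul_of_nonneg_left h2 (hg φ))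
  rw [← le_div_iff₀' hpos] at h3
  refine h3.trans (le_of_eq ?_)
  field_simp

variable {Ω : Type*} [MeasurableSpace Ω]

/-- Averaging over translations preserves smoothness and derivative bounds. -/
lemma DerivBound.integral_shift {h : ℝ} (hh : 0 < h) (hL : 1 ≤ L) {F : (Torus N → ℝ) → ℂ}
    (hs : ContDiff ℝ ∞ F) {g a : (Torus N → ℝ) → ℝ} (hg : ∀ φ, 0 ≤ g φ)
    (hF : DerivBound h L j Y g F) {ν : Measure Ω} {T : Ω → Torus N → ℝ} (hT : Measurable T)
    {k : Ω → ℝ} (hk : Integrable k ν) (hk0 : ∀ o, 0 ≤ k o) (hga : ∀ φ o, g (φ + T o) ≤ a φ * k o)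
    (ha : ∀ φ₀, ∃ C, ∀ φ ∈ Metric.ball φ₀ 1, a φ ≤ C) :
    (∀ φ, Integrable (fun o => F (φ + T o)) ν) ∧
    ContDiff ℝ ∞ (fun φ => ∫ o, F (φ + T o) ∂ν) ∧
    DerivBound h L j Y (fun φ => a φ * ∫ o, k o ∂ν) (fun φ => ∫ o, F (φ + T o) ∂ν) := by
  have hnorm := fun n φ => hF.norm_le hh hL hg n φ
  have hcont : ∀ n, Continuous (iteratedFDeriv ℝ n F) := fun n =>
    hs.continuous_iteratedFDeriv (m := n) (mod_cast le_top)
  have hdom : ∀ (n : ℕ) (φ₀ : Torus N → ℝ), ∃ bound : Ω → ℝ, Integrable bound ν ∧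
      ∀ φ ∈ Metric.ball φ₀ 1, ∀ o, ‖iteratedFDeriv ℝ n F (φ + T o)‖ ≤ bound o := by
    intro n φ₀
    obtain ⟨C, hC⟩ := ha φ₀
    -- Separating the weight as `a φ * k o`, with `a` locally bounded, gives a dominating function
    -- that is uniform for nearby fields.
    refine ⟨fun o => ((n.factorial : ℝ) / h ^ n * (4 * (L : ℝ) ^ (2 * j)) ^ n) * (C * k o),
      (hk.const_mul C).const_mul _, fun φ hφ o => (hnorm n _).trans ?_⟩
    refine mul_le_mul_of_nonneg_left ?_ (by positivity)
    exact (hga φ o).trans (mul_le_mul_of_nonneg_right (hC φ hφ) (hk0 o))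
  have hser := hasFTaylorSeriesUpTo_integral_shift hT hs hdom
  have hint : ∀ n φ, Integrable (fun o => iteratedFDeriv ℝ n F (φ + T o)) ν := by
    intro n φ
    obtain ⟨b, hb, hle⟩ := hdom n φ
    refine hb.mono' ((hcont n).stronglyMeasurable.comp_measurable
      (measurable_const.add hT)).aestronglyMeasurable (Filter.Eventually.of_forall fun o =>
      hle φ (Metric.mem_ball_self one_pos) o)
  refine ⟨fun φ => ?_, hser.contDiff, ?_⟩
  · have h0 := hint 0 φ
    have h1 := (ContinuousMultilinearMap.apply ℝ (fun _ : Fin 0 => Torus N → ℝ) ℂ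
      (0 : Fin 0 → Torus N → ℝ)).integrable_comp h0
    simpa using h1
  · intro n φ f
    rw [← hser.eq_iteratedFDeriv (m := n) (mod_cast le_top) φ,
      ContinuousMultilinearMap.integral_apply (hint n φ)]
    have hpos : 0 < h ^ n / (n.factorial : ℝ) := by positivity
    set P := ∏ i, c2Norm L j (f i) Y
    have hP : 0 ≤ P := Finset.prod_nonneg fun i _ => c2Norm_nonneg _ _ _ _
    have hpt : ∀ o, ‖iteratedFDeriv ℝ n F (φ + T o) f‖ ≤
        (h ^ n / (n.factorial : ℝ))⁻¹ * (a φ * P) * k o := by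
      intro o
      have h1 := hF n (φ + T o) f
      rw [← le_div_iff₀' hpos] at h1
      refine h1.trans ?_
      rw [div_eq_inv_mul]
      have := mul_le_mul_of_nonneg_right (hga φ o) hP
      calc _ ≤ (h ^ n / (n.factorial : ℝ))⁻¹ * (a φ * k o * P) := by gcongr
        _ = _ := by ring
    have h2 := norm_integral_le_of_norm_le (hk.const_mul _)
      (Filter.Eventually.of_forall (p := fun o => _) hpt)
    rw [integral_const_mul] at h2
    calc _ ≤ h ^ n / (n.factorial : ℝ) *
          ((h ^ n / (n.factorial : ℝ))⁻¹ * (a φ * P) * ∫ o, k o ∂ν) := by gcongr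
      _ = _ := by rw [← mul_assoc, mul_inv_cancel_left₀ hpos.ne']; ring

lemma LocalOn.integral_shift {F : (Torus N → ℝ) → ℂ} (hF : LocalOn Y F) {ν : Measure Ω}
    {T : Ω → Torus N → ℝ} : LocalOn Y (fun φ => ∫ o, F (φ + T o) ∂ν) := by
  intro φ ψ h
  refine integral_congr_ae (Filter.Eventually.of_forall fun o => hF _ _ fun x hx => ?_)
  simp [h x hx]

/-- The base point must lie in `Y`, because `delta x₀` reads the field there. -/
lemma LocalOn.taylorRem_delta {H : (Torus N → ℝ) → ℂ} (hH : LocalOn Y H)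
    (hs : ContDiff ℝ ∞ H) {x₀ : Torus N} (hx₀ : x₀ ∈ Y) :
    LocalOn Y (fun φ => rem 2 H (delta x₀ φ)) := by
  intro φ ψ h
  have hd : ∀ x ∈ Y, delta x₀ φ x = delta x₀ ψ x := fun x hx => by
    simp [delta, h x hx, h x₀ hx₀]
  simp only [rem, tay]
  rw [hH _ _ hd]
  congr 1
  refine Finset.sum_congr rfl fun m _ => ?_
  rw [hH.iteratedFDeriv_congr hs m 0 (v := fun _ => delta x₀ ψ) fun _ => hd]

/-- The neutral component is the average over a period of constant translations. -/
lemma chargedComponent_zero_eq {α : ℝ} (hα : 0 < α) (F : (Torus N → ℝ) → ℂ) :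
    chargedComponent α 0 F = fun φ => ∫ s, F (φ + fun _ => s)
      ∂(ENNReal.ofReal (α / (2 * Real.pi)) • volume.restrict (Set.Ioc 0 (2 * Real.pi / α))) := by
  have h2 : 0 ≤ 2 * Real.pi / α := by positivity
  ext φ
  rw [integral_smul_measure, ENNReal.toReal_ofReal (by positivity), Complex.real_smul,
    chargedComponent, intervalIntegral.integral_of_le h2]
  simp
  left
  rfl

end Activities

/-! ### Exponential Orlicz bounds. -/

section Orlicz

variable {Ω : Type*} [MeasurableSpace Ω] {P : Measure Ω}

/-- The exponential Orlicz norm of `T` is at most `s`. -/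
def OrliczBound (P : Measure Ω) (T : Ω → ℝ) (s : ℝ) : Prop :=
  0 < s ∧ Measurable T ∧ ∫⁻ o, ENNReal.ofReal (Real.exp (T o / s)) ∂P ≤ 2

/-- Convexity of the exponential with weights proportional to $s_1,s_2$. No independence is needed,
so strongly correlated squares can be added. -/
lemma OrliczBound.add {T₁ T₂ : Ω → ℝ} {s₁ s₂ : ℝ} (h₁ : OrliczBound P T₁ s₁)
    (h₂ : OrliczBound P T₂ s₂) : OrliczBound P (fun o => T₁ o + T₂ o) (s₁ + s₂) := by
  obtain ⟨hs₁, hm₁, hi₁⟩ := h₁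
  obtain ⟨hs₂, hm₂, hi₂⟩ := h₂
  have hs : 0 < s₁ + s₂ := by positivity
  refine ⟨hs, hm₁.add hm₂, ?_⟩
  set a := s₁ / (s₁ + s₂) with ha
  set b := s₂ / (s₁ + s₂) with hb
  have ha0 : 0 ≤ a := by positivity
  have hb0 : 0 ≤ b := by positivity
  have hab : a + b = 1 := by rw [ha, hb]; field_simp
  have hpt : ∀ o, ENNReal.ofReal (Real.exp ((T₁ o + T₂ o) / (s₁ + s₂))) ≤
      ENNReal.ofReal a * ENNReal.ofReal (Real.exp (T₁ o / s₁)) +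
      ENNReal.ofReal b * ENNReal.ofReal (Real.exp (T₂ o / s₂)) := by
    intro o
    rw [← ENNReal.ofReal_mul ha0, ← ENNReal.ofReal_mul hb0,
      ← ENNReal.ofReal_add (by positivity) (by positivity)]
    apply ENNReal.ofReal_le_ofReal
    have := convexOn_exp.2 (Set.mem_univ (T₁ o / s₁)) (Set.mem_univ (T₂ o / s₂)) ha0 hb0 hab
    simp only [smul_eq_mul] at this
    have e : (T₁ o + T₂ o) / (s₁ + s₂) = a * (T₁ o / s₁) + b * (T₂ o / s₂) := by
      rw [ha, hb]
      field_simp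
    rw [e]
    exact this
  calc _ ≤ ∫⁻ o, (ENNReal.ofReal a * ENNReal.ofReal (Real.exp (T₁ o / s₁)) +
      ENNReal.ofReal b * ENNReal.ofReal (Real.exp (T₂ o / s₂))) ∂P := lintegral_mono hpt
    _ = ENNReal.ofReal a * (∫⁻ o, ENNReal.ofReal (Real.exp (T₁ o / s₁)) ∂P) +
        ENNReal.ofReal b * ∫⁻ o, ENNReal.ofReal (Real.exp (T₂ o / s₂)) ∂P := by
      rw [lintegral_add_left (by fun_prop), lintegral_const_mul _ (by fun_prop),
        lintegral_const_mul _ (by fun_prop)]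
    _ ≤ ENNReal.ofReal a * 2 + ENNReal.ofReal b * 2 := by gcongr
    _ = 2 := by
      rw [← add_mul, ← ENNReal.ofReal_add ha0 hb0, hab, ENNReal.ofReal_one, one_mul]

lemma OrliczBound.const_mul {T : Ω → ℝ} {s c : ℝ} (h : OrliczBound P T s) (hc : 0 < c) :
    OrliczBound P (fun o => c * T o) (c * s) := by
  obtain ⟨hs, hm, hi⟩ := h
  refine ⟨by positivity, hm.const_mul c, ?_⟩
  simpa only [mul_div_mul_left _ _ hc.ne'] using hi

lemma OrliczBound.mono {T : Ω → ℝ} {s s' : ℝ} (h : OrliczBound P T s) (hT : ∀ o, 0 ≤ T o)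
    (hs' : s ≤ s') : OrliczBound P T s' := by
  obtain ⟨hs, hm, hi⟩ := h
  refine ⟨hs.trans_le hs', hm, (lintegral_mono fun o => ?_).trans hi⟩
  apply ENNReal.ofReal_le_ofReal
  gcongr
  exact hT o

/-- A positive real upper bound for the number of terms replaces the cardinality, which also covers
empty sums such as an empty boundary. -/
lemma OrliczBound.sum {ι : Type*} [IsProbabilityMeasure P] {I : Finset ι} {T : ι → Ω → ℝ}
    {s m : ℝ} (hs : 0 < s) (hm : 0 < m) (hI : (I.card : ℝ) ≤ m) (hT : ∀ i ∈ I, ∀ o, 0 ≤ T i o)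
    (h : ∀ i ∈ I, OrliczBound P (T i) s) : OrliczBound P (fun o => ∑ i ∈ I, T i o) (m * s) := by
  classical
  rcases I.eq_empty_or_nonempty with rfl | hne
  · refine ⟨by positivity, by simp, ?_⟩
    simp
  · have key : OrliczBound P (fun o => ∑ i ∈ I, T i o) (I.card * s) := by
      clear hI
      induction hne using Finset.Nonempty.cons_induction with
      | singleton a => simpa using h a (by simp)
      | cons a I ha _ ih =>
        have h1 := (h a (by simp)).add (ih (fun i hi => hT i (by simp [hi]))
          fun i hi => h i (by simp [hi]))
        simp only [Finset.sum_cons, Finset.card_cons]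
        convert h1 using 1
        push_cast
        ring
    exact key.mono (fun o => Finset.sum_nonneg fun i hi => hT i hi o) (by gcongr)

end Orlicz

/-! ### Gaussian squares and derivatives of the fluctuation field. -/

section Gaussian

/-- The weight turns the density of variance $v'$ into at most $\sqrt2$ times that of variance
$2v'$. Zero variance is a point mass and is treated apart. -/
lemma lintegral_exp_sq_gaussianReal_le {v' : NNReal} {v : ℝ} (hle : (v' : ℝ) ≤ v) :
    ∫⁻ x, ENNReal.ofReal (Real.exp (x ^ 2 / (4 * v))) ∂(gaussianReal 0 v') ≤ 2 := by
  by_cases h0 : v' = 0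
  · subst h0
    rw [gaussianReal_zero_var, lintegral_dirac]
    simp
  have hv' : (0 : ℝ) < v' := by positivity
  have h2 : (2 * v' : NNReal) ≠ 0 := by simpa using h0
  rw [gaussianReal_of_var_ne_zero _ h0, lintegral_withDensity_eq_lintegral_mul _
    (measurable_gaussianPDF 0 v') (by fun_prop)]
  have hpt : ∀ x, (gaussianPDF 0 v' * fun x => ENNReal.ofReal (Real.exp (x ^ 2 / (4 * v)))) x ≤
      ENNReal.ofReal (Real.sqrt 2) * ENNReal.ofReal (gaussianPDFReal 0 (2 * v') x) := by
    intro x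
    rw [Pi.mul_apply, gaussianPDF, ← ENNReal.ofReal_mul (gaussianPDFReal_nonneg _ _ _),
      ← ENNReal.ofReal_mul (Real.sqrt_nonneg _)]
    apply ENNReal.ofReal_le_ofReal
    have hs : Real.sqrt (2 * Real.pi * (2 * v' : NNReal)) =
        Real.sqrt 2 * Real.sqrt (2 * Real.pi * v') := by
      rw [← Real.sqrt_mul (by norm_num)]
      congr 1
      push_cast
      ring
    have hs2 : Real.sqrt 2 ≠ 0 := by positivity
    have hs3 : Real.sqrt (2 * Real.pi * v') ≠ 0 := by positivity
    rw [gaussianPDFReal, gaussianPDFReal, hs, mul_inv, ← mul_assoc, ← mul_assoc,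
      mul_inv_cancel₀ hs2, one_mul, mul_assoc, ← Real.exp_add]
    gcongr
    have h4 : x ^ 2 / (4 * v) ≤ x ^ 2 / (4 * v') := by gcongr
    push_cast
    have e1 : -(x - 0) ^ 2 / (2 * (v' : ℝ)) + x ^ 2 / (4 * v') = -(x - 0) ^ 2 / (2 * (2 * v')) := by
      field_simp
      ring
    linarith
  refine (lintegral_mono hpt).trans ?_
  rw [lintegral_const_mul _ (by fun_prop), lintegral_gaussianPDFReal_eq_one _ h2, mul_one]
  rw [show (2 : ENNReal) = ENNReal.ofReal 2 by simp]
  apply ENNReal.ofReal_le_ofReal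
  rw [Real.sqrt_le_left (by norm_num)]
  norm_num

variable {N : ℕ}

lemma iterDiff_cons {E : Type*} [Sub E] (μ : Dir) (a : List Dir) (f : Torus N → E) (x : Torus N) :
    iterDiff (μ :: a) f x = iterDiff a f (x + unitVec μ) - iterDiff a f x := rfl

lemma iterDiff_add (a : List Dir) (f g : Torus N → ℝ) (x : Torus N) :
    iterDiff a (fun y => f y + g y) x = iterDiff a f x + iterDiff a g x := by
  induction a generalizing x with
  | nil => rfl
  | cons μ a ih => rw [iterDiff_cons, iterDiff_cons, iterDiff_cons, ih, ih]; ring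

lemma iterDiff_smul (a : List Dir) (c : ℝ) (f : Torus N → ℝ) (x : Torus N) :
    iterDiff a (fun y => c * f y) x = c * iterDiff a f x := by
  induction a generalizing x with
  | nil => rfl
  | cons μ a ih => rw [iterDiff_cons, iterDiff_cons, ih, ih]; ring

variable [NeZero N]

/-- The iterated derivative at a site, as a linear functional of the fluctuation field. -/
def iterDiffCLM (a : List Dir) (x : Torus N) : StrongDual ℝ (EuclideanSpace ℝ (Torus N)) :=
  LinearMap.toContinuousLinearMap
    { toFun := fun ζ => iterDiff a (fun y => ζ y) x
      map_add' := fun ζ ξ => iterDiff_add a (fun y => ζ y) (fun y => ξ y) x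
      map_smul' := fun c ζ => iterDiff_smul a c (fun y => ζ y) x }

lemma iterDiffCLM_cons (μ : Dir) (a : List Dir) (x : Torus N) :
    (iterDiffCLM (μ :: a) x : EuclideanSpace ℝ (Torus N) → ℝ) =
      (iterDiffCLM a (x + unitVec μ) : EuclideanSpace ℝ (Torus N) → ℝ) - iterDiffCLM a x := rfl

/-- The opposite direction. -/
def revDir (μ : Dir) : Dir := (μ.1, !μ.2)

lemma unitVec_revDir (μ : Dir) : unitVec (N := N) (revDir μ) = -unitVec μ := by
  obtain ⟨i, b⟩ := μ
  cases b <;> simp [revDir, unitVec]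

instance isGaussian_fluctuationMeasure (Γ : Torus N → ℝ) : IsGaussian (fluctuationMeasure Γ) := by
  unfold fluctuationMeasure; infer_instance

lemma memLp_iterDiffCLM (Γ : Torus N → ℝ) (a : List Dir) (x : Torus N) :
    MemLp (iterDiffCLM a x) 2 (fluctuationMeasure Γ) :=
  IsGaussian.memLp_dual _ _ 2 (by simp)

/-- Bilinearity of the covariance; a difference in the second site acts on $\Gamma(x-y)$ in the
opposite direction. -/
lemma covariance_iterDiff {Γ : Torus N → ℝ} (hΓ : (Matrix.circulant Γ).PosSemidef)
    (a b : List Dir) (x y : Torus N) :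
    cov[iterDiffCLM a x, iterDiffCLM b y; fluctuationMeasure Γ] =
      iterDiff (a ++ b.map revDir) Γ (x - y) := by
  induction a generalizing x with
  | nil =>
    induction b generalizing y with
    | nil => exact covariance_eval_multivariateGaussian hΓ x y
    | cons μ b ih =>
      rw [iterDiffCLM_cons, covariance_sub_right (memLp_iterDiffCLM _ _ _)
        (memLp_iterDiffCLM _ _ _) (memLp_iterDiffCLM _ _ _), ih, ih]
      simp only [List.nil_append, List.map_cons, iterDiff_cons, unitVec_revDir]
      rw [← sub_eq_add_neg, sub_sub]
  | cons μ a ih =>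
    rw [iterDiffCLM_cons, covariance_sub_left (memLp_iterDiffCLM _ _ _)
      (memLp_iterDiffCLM _ _ _) (memLp_iterDiffCLM _ _ _), ih, ih]
    simp only [List.cons_append, iterDiff_cons]
    rw [add_sub_right_comm]

/-- The variance of a derivative of order $m$ is a derivative of $\Gamma$ of order $2m$ at the
origin, hence at most $C_{2m}L^{-2mj}$; the factor $4$ is that of the Gaussian square estimate. -/
lemma orliczBound_iterDiff_sq {Γ : Torus N → ℝ} {L j : ℕ} {C : ℕ → ℝ} {c : ℝ}
    (hL : 1 ≤ L) (hΓ : IsFluctuationCovariance L j C c Γ) {a : List Dir} (ha : a ≠ []) {K : ℝ}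
    (hK : 0 < K) (hC : C (2 * a.length) ≤ K) (x : Torus N) :
    OrliczBound (fluctuationMeasure Γ) (fun ζ => iterDiff a (fun y => ζ y) x ^ 2)
      (4 * (K * ((L : ℝ) ^ (2 * a.length * j))⁻¹)) := by
  have hL0 : (0 : ℝ) < L := by exact_mod_cast hL
  set v := K * ((L : ℝ) ^ (2 * a.length * j))⁻¹ with hv
  have hv0 : 0 < v := by positivity
  have hmeas : Measurable (iterDiffCLM a x) := (iterDiffCLM a x).continuous.measurable
  refine ⟨by positivity, hmeas.pow_const 2, ?_⟩
  have hmap := IsGaussian.map_eq_gaussianReal (μ := fluctuationMeasure Γ) (iterDiffCLM a x)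
  have hmean : ∫ ζ, iterDiffCLM a x ζ ∂(fluctuationMeasure Γ) = 0 := by
    rw [(iterDiffCLM a x).integral_comp_id_comm IsGaussian.integrable_id]
    unfold fluctuationMeasure
    rw [integral_id_multivariateGaussian, map_zero]
  have hvar : Var[iterDiffCLM a x; fluctuationMeasure Γ] ≤ v := by
    rw [← covariance_self hmeas.aemeasurable, covariance_iterDiff hΓ.posSemidef, sub_self]
    have h0 : supAbs (0 : Torus N) = 0 := supAbs_eq_zero_iff.2 rfl
    refine (le_abs_self _).trans ((hΓ.deriv_le _ (by simp [ha]) 0 (by simp [h0])).trans ?_)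
    rw [List.length_append, List.length_map, ← two_mul, hv, mul_comm j]
    gcongr
  rw [hmean] at hmap
  calc ∫⁻ ζ, ENNReal.ofReal (Real.exp (iterDiff a (fun y => ζ y) x ^ 2 / (4 * v)))
        ∂(fluctuationMeasure Γ)
      = ∫⁻ t, ENNReal.ofReal (Real.exp (t ^ 2 / (4 * v)))
        ∂((fluctuationMeasure Γ).map (iterDiffCLM a x)) := by
        rw [lintegral_map (by fun_prop) hmeas]
        rfl
    _ ≤ 2 := by
        rw [hmap]
        apply lintegral_exp_sq_gaussianReal_le
        rw [Real.coe_toNNReal _ (variance_nonneg _ _)]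
        exact hvar

end Gaussian

/-! ### Discrete Sobolev inequalities. -/

section Sobolev

variable {N : ℕ}

/-- One-dimensional discrete Sobolev inequality on an interval. -/
lemma abs_le_sum_Icc (g : ℤ → ℝ) (ρ : ℕ) {u : ℤ} (hu : |u| ≤ ρ) :
    (2 * ρ + 1 : ℝ) * |g u| ≤ ∑ w ∈ Finset.Icc (-(ρ : ℤ)) ρ,
      (|g w| + (2 * ρ + 1) * |g (w + 1) - g w|) := by
  have htel : ∀ a : ℤ, ∀ n : ℕ, -(ρ : ℤ) ≤ a → a + n ≤ ρ → |g (a + n) - g a| ≤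
      ∑ w ∈ Finset.Icc (-(ρ : ℤ)) ρ, |g (w + 1) - g w| := by
    intro a n ha hn
    have h1 : ∀ n : ℕ, g (a + n) - g a = ∑ i ∈ Finset.range n, (g (a + i + 1) - g (a + i)) := by
      intro n
      induction n with
      | zero => simp
      | succ n ih => rw [Finset.sum_range_succ, ← ih]; push_cast; rw [← add_assoc]; ring
    rw [h1]
    refine (Finset.abs_sum_le_sum_abs _ _).trans ?_
    have himg : ∑ i ∈ Finset.range n, |g (a + i + 1) - g (a + i)| =
        ∑ w ∈ (Finset.range n).image (fun i : ℕ => a + i), |g (w + 1) - g w| := by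
      rw [Finset.sum_image]
      intro i _ i' _ h
      simpa using h
    rw [himg]
    refine Finset.sum_le_sum_of_subset_of_nonneg (fun w hw => ?_) fun _ _ _ => abs_nonneg _
    obtain ⟨i, hi, rfl⟩ := Finset.mem_image.1 hw
    have := Finset.mem_range.1 hi
    rw [Finset.mem_Icc]
    omega
  -- A value differs from any other by at most the total variation; summing over `v` gives the
  -- claim.
  have hpt : ∀ v ∈ Finset.Icc (-(ρ : ℤ)) ρ, |g u| ≤ |g v| +
      ∑ w ∈ Finset.Icc (-(ρ : ℤ)) ρ, |g (w + 1) - g w| := by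
    intro v hv
    rw [Finset.mem_Icc] at hv
    rw [abs_le] at hu
    have h2 : |g u - g v| ≤ ∑ w ∈ Finset.Icc (-(ρ : ℤ)) ρ, |g (w + 1) - g w| := by
      rcases le_total u v with h | h
      · obtain ⟨n, rfl⟩ := Int.le.dest h
        rw [abs_sub_comm]
        exact htel u n hu.1 hv.2
      · obtain ⟨n, rfl⟩ := Int.le.dest h
        exact htel v n hv.1 hu.2
    have := abs_sub_abs_le_abs_sub (g u) (g v)
    linarith
  have hcard : ((Finset.Icc (-(ρ : ℤ)) ρ).card : ℝ) = 2 * ρ + 1 := by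
    have : (Finset.Icc (-(ρ : ℤ)) ρ).card = 2 * ρ + 1 := by
      rw [Int.card_Icc]; omega
    rw [this]; push_cast; ring
  have := Finset.sum_le_sum hpt
  rw [Finset.sum_const, nsmul_eq_mul, hcard, Finset.sum_add_distrib, Finset.sum_const, nsmul_eq_mul,
    hcard] at this
  rw [Finset.sum_add_distrib, ← Finset.mul_sum]
  exact this

lemma sum_box (ρ : ℕ) (F : (Fin 2 → ℤ) → ℝ) :
    ∑ w ∈ box ρ, F w = ∑ a ∈ Finset.Icc (-(ρ : ℤ)) ρ, ∑ b ∈ Finset.Icc (-(ρ : ℤ)) ρ, F ![a, b] := by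
  rw [← Finset.sum_product']
  refine Finset.sum_bij' (fun w _ => (w 0, w 1)) (fun p _ => ![p.1, p.2]) ?_ ?_ ?_ ?_ ?_
  · intro w hw
    simp only [box, Fintype.mem_piFinset] at hw
    exact Finset.mem_product.2 ⟨hw 0, hw 1⟩
  · intro p hp
    obtain ⟨h1, h2⟩ := Finset.mem_product.1 hp
    simp only [box, Fintype.mem_piFinset]
    intro i
    fin_cases i
    exacts [h1, h2]
  · intro w _
    ext i; fin_cases i <;> rfl
  · intro p _
    rfl
  · intro w _
    congr 1
    ext i; fin_cases i <;> rfl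

/-- Two-dimensional discrete Sobolev inequality on a square of side `2ρ + 1`. -/
lemma sq_le_sum_box (f : Torus N → ℝ) (c : Fin 2 → ℤ) (ρ : ℕ) {u : Fin 2 → ℤ} (hu : u ∈ box ρ) :
    f (site N (c + u)) ^ 2 ≤ ∑ w ∈ box ρ, 4 / (2 * ρ + 1 : ℝ) ^ 2 *
      (f (site N (c + w)) ^ 2
        + (2 * ρ + 1 : ℝ) ^ 2 * diff (0, true) f (site N (c + w)) ^ 2
        + (2 * ρ + 1 : ℝ) ^ 2 * diff (1, true) f (site N (c + w)) ^ 2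
        + (2 * ρ + 1 : ℝ) ^ 4 * diff (1, true) (diff (0, true) f) (site N (c + w)) ^ 2) := by
  set n : ℝ := 2 * ρ + 1 with hn
  have hn0 : 0 < n := by positivity
  set F : (Fin 2 → ℤ) → ℝ := fun w => |f (site N (c + w))| + n * |diff (1, true) f (site N (c + w))|
    + n * (|diff (0, true) f (site N (c + w))|
      + n * |diff (1, true) (diff (0, true) f) (site N (c + w))|) with hF
  have hs0 : ∀ a b : ℤ, site N (c + ![a + 1, b]) = site N (c + ![a, b]) + unitVec (0, true) := by
    intro a b
    rw [unitVec_pos, ← site_add, add_assoc]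
    congr 2
    ext i; fin_cases i <;> simp
  have hs1 : ∀ a b : ℤ, site N (c + ![a, b + 1]) = site N (c + ![a, b]) + unitVec (1, true) := by
    intro a b
    rw [unitVec_pos, ← site_add, add_assoc]
    congr 2
    ext i; fin_cases i <;> simp
  have hu' := mem_box.1 hu
  have husite : f (site N (c + u)) = f (site N (c + ![u 0, u 1])) := by
    congr 3; ext i; fin_cases i <;> rfl
  have h1 : ∀ (g : Torus N → ℝ) (a : ℤ), n * |g (site N (c + ![a, u 1]))| ≤
      ∑ b ∈ Finset.Icc (-(ρ : ℤ)) ρ, (|g (site N (c + ![a, b]))| +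
        n * |diff (1, true) g (site N (c + ![a, b]))|) := by
    intro g a
    have := abs_le_sum_Icc (fun b => g (site N (c + ![a, b]))) ρ (hu' 1)
    simp only [hs1] at this
    exact this
  have h0 : n * |f (site N (c + ![u 0, u 1]))| ≤
      ∑ a ∈ Finset.Icc (-(ρ : ℤ)) ρ, (|f (site N (c + ![a, u 1]))| +
        n * |diff (0, true) f (site N (c + ![a, u 1]))|) := by
    have := abs_le_sum_Icc (fun a => f (site N (c + ![a, u 1]))) ρ (hu' 0)
    simp only [hs0] at this
    exact this
  have hmain : n ^ 2 * |f (site N (c + u))| ≤ ∑ w ∈ box ρ, F w := by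
    rw [sum_box, husite, pow_two, mul_assoc]
    refine (mul_le_mul_of_nonneg_left h0 hn0.le).trans ?_
    rw [Finset.mul_sum]
    refine Finset.sum_le_sum fun a _ => ?_
    have e1 := h1 f a
    have e2 := mul_le_mul_of_nonneg_left (h1 (diff (0, true) f) a) hn0.le
    rw [Finset.mul_sum] at e2
    have := add_le_add e1 e2
    rw [← Finset.sum_add_distrib] at this
    refine le_trans (le_of_eq (by ring)) this
  have hcard : ((box ρ).card : ℝ) = n ^ 2 := by rw [card_box]; push_cast; rfl
  -- Cauchy–Schwarz over the $n^2$ sites; the square of the four-term sum `F` then costs the factor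
  -- $4$.
  have hsq : (n ^ 2 * |f (site N (c + u))|) ^ 2 ≤ n ^ 2 * ∑ w ∈ box ρ, F w ^ 2 := by
    rw [← hcard]
    refine le_trans ?_ (sq_sum_le_card_mul_sum_sq (s := box ρ) (f := F))
    rw [hcard]
    gcongr
  have hFsq : ∀ w, F w ^ 2 ≤ 4 * (f (site N (c + w)) ^ 2
        + n ^ 2 * diff (0, true) f (site N (c + w)) ^ 2
        + n ^ 2 * diff (1, true) f (site N (c + w)) ^ 2
        + n ^ 4 * diff (1, true) (diff (0, true) f) (site N (c + w)) ^ 2) := by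
    intro w
    rw [hF]
    simp only
    set a := f (site N (c + w))
    set b := diff (0, true) f (site N (c + w))
    set c' := diff (1, true) f (site N (c + w))
    set d := diff (1, true) (diff (0, true) f) (site N (c + w))
    rw [← sq_abs a, ← sq_abs b, ← sq_abs c', ← sq_abs d]
    nlinarith [sq_nonneg (|a| - n * |c'|), sq_nonneg (|a| - n * |b|),
      sq_nonneg (|a| - n ^ 2 * |d|), sq_nonneg (n * |c'| - n * |b|),
      sq_nonneg (n * |c'| - n ^ 2 * |d|), sq_nonneg (n * |b| - n ^ 2 * |d|)]
  rw [← Finset.mul_sum, div_mul_eq_mul_div, le_div_iff₀ (by positivity)]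
  rw [mul_pow, sq_abs] at hsq
  have h5 := Finset.sum_le_sum (s := box ρ) fun w _ => hFsq w
  rw [← Finset.mul_sum] at h5
  have hn2 : 0 < n ^ 2 := by positivity
  refine le_trans ?_ h5
  refine le_of_mul_le_mul_left ?_ hn2
  linarith

end Sobolev

/-! ### Exponential integrability of the regulator of the fluctuation field. -/

section FluctuationWeight

variable {N : ℕ} [NeZero N] {L j : ℕ} {C : ℕ → ℝ} {c K : ℝ} {Γ : Torus N → ℝ}

lemma sq_mul_pow_le {n ℓ : ℝ} (hn : 0 ≤ n) (h : n ≤ 9 * ℓ) (m : ℕ) : n ^ m ≤ 9 ^ m * ℓ ^ m := by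
  rw [← mul_pow]
  gcongr

/-- The discrete Sobolev majorant of one second derivative of the fluctuation field. -/
lemma exists_orliczBound_diff_diff (hL : 1 ≤ L) (hΓ : IsFluctuationCovariance L j C c Γ)
    (hK : 0 < K) (h4 : C 4 ≤ K) (h6 : C 6 ≤ K) (h8 : C 8 ≤ K) (k : Fin 2 → ℤ) (μ ν : Dir) :
    ∃ T : EuclideanSpace ℝ (Torus N) → ℝ, (∀ ζ, 0 ≤ T ζ) ∧
      OrliczBound (fluctuationMeasure Γ) T (16 * 4 * 6561 * K) ∧
      ∀ ζ : EuclideanSpace ℝ (Torus N), ∀ w ∈ box (4 * L ^ j),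
        ((L : ℝ) ^ (2 * j) * ‖diff μ (diff ν fun x => ζ x) (site N (k + w))‖) ^ 2 ≤ T ζ := by
  have hL1 : (1 : ℝ) ≤ L := by exact_mod_cast hL
  set ℓ : ℝ := (L : ℝ) ^ j with hℓ
  have hℓ1 : 1 ≤ ℓ := one_le_pow₀ hL1
  have hℓ0 : 0 < ℓ := by linarith
  -- Radius $4L^j$ covers the neighbourhood of a block: $\frac72+\frac12$. The side is at most
  -- $9\ell$, and $9^4=6561$ bounds the weights of all the Sobolev terms.
  set n : ℝ := 2 * (4 * L ^ j : ℕ) + 1 with hn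
  have hnℓ : n = 8 * ℓ + 1 := by rw [hn]; push_cast; ring
  have hn0 : 0 < n := by rw [hnℓ]; positivity
  have hn9 : n ≤ 9 * ℓ := by rw [hnℓ]; linarith
  have hpow : ∀ m : ℕ, (L : ℝ) ^ (m * j) = ℓ ^ m := fun m => by rw [mul_comm, pow_mul]
  set t : Torus N → EuclideanSpace ℝ (Torus N) → ℝ := fun x ζ =>
    iterDiff [μ, ν] (fun y => ζ y) x ^ 2 + n ^ 2 * iterDiff [(0, true), μ, ν] (fun y => ζ y) x ^ 2
      + n ^ 2 * iterDiff [(1, true), μ, ν] (fun y => ζ y) x ^ 2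
      + n ^ 4 * iterDiff [(1, true), (0, true), μ, ν] (fun y => ζ y) x ^ 2 with ht
  have ht0 : ∀ x ζ, 0 ≤ t x ζ := fun x ζ => by rw [ht]; positivity
  have hOt : ∀ x, OrliczBound (fluctuationMeasure Γ) (t x) (16 * 6561 * K * (ℓ ^ 4)⁻¹) := by
    intro x
    have e4 := orliczBound_iterDiff_sq hL hΓ (a := [μ, ν]) (by simp) hK h4 x
    have e6 := (orliczBound_iterDiff_sq hL hΓ (a := [(0, true), μ, ν]) (by simp) hK h6 x).const_mul
      (c := n ^ 2) (by positivity)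
    have e6' := (orliczBound_iterDiff_sq hL hΓ (a := [(1, true), μ, ν]) (by simp) hK h6 x).const_mul
      (c := n ^ 2) (by positivity)
    have e8 := (orliczBound_iterDiff_sq hL hΓ (a := [(1, true), (0, true), μ, ν]) (by simp) hK h8
      x).const_mul (c := n ^ 4) (by positivity)
    refine (((e4.add e6).add e6').add e8).mono (ht0 x) ?_
    simp only [List.length_cons, List.length_nil]
    norm_num only
    rw [hpow, hpow, hpow]
    have b2 : n ^ 2 * (ℓ ^ 6)⁻¹ ≤ 6561 * (ℓ ^ 4)⁻¹ := by
      rw [← div_eq_mul_inv, ← div_eq_mul_inv, div_le_div_iff₀ (by positivity) (by positivity)]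
      have := sq_mul_pow_le hn0.le hn9 2
      have h1 : n ^ 2 * ℓ ^ 4 ≤ 9 ^ 2 * ℓ ^ 2 * ℓ ^ 4 := by gcongr
      have h2 : 0 ≤ ℓ ^ 6 := by positivity
      nlinarith
    have b4 : n ^ 4 * (ℓ ^ 8)⁻¹ ≤ 6561 * (ℓ ^ 4)⁻¹ := by
      rw [← div_eq_mul_inv, ← div_eq_mul_inv, div_le_div_iff₀ (by positivity) (by positivity)]
      have := sq_mul_pow_le hn0.le hn9 4
      have h1 : n ^ 4 * ℓ ^ 4 ≤ 9 ^ 4 * ℓ ^ 4 * ℓ ^ 4 := by gcongr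
      refine h1.trans (le_of_eq ?_)
      ring
    have b0 : (0 : ℝ) ≤ (ℓ ^ 4)⁻¹ := by positivity
    have c2 := mul_le_mul_of_nonneg_left b2 hK.le
    have c4 := mul_le_mul_of_nonneg_left b4 hK.le
    have c0 := mul_nonneg hK.le b0
    linarith
  refine ⟨fun ζ => ∑ w ∈ box (4 * L ^ j), (ℓ ^ 4 * (4 / n ^ 2)) * t (site N (k + w)) ζ,
    fun ζ => Finset.sum_nonneg fun w _ => mul_nonneg (by positivity) (ht0 _ _), ?_, ?_⟩
  · have hcard : ((box (4 * L ^ j)).card : ℝ) = n ^ 2 := by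
      rw [card_box, hn]; push_cast; rfl
    have hsum := OrliczBound.sum (P := fluctuationMeasure Γ) (I := box (4 * L ^ j))
      (T := fun w ζ => (ℓ ^ 4 * (4 / n ^ 2)) * t (site N (k + w)) ζ)
      (s := (ℓ ^ 4 * (4 / n ^ 2)) * (16 * 6561 * K * (ℓ ^ 4)⁻¹)) (m := n ^ 2)
      (by positivity) (by positivity) hcard.le
      (fun w _ ζ => mul_nonneg (by positivity) (ht0 _ _))
      (fun w _ => (hOt _).const_mul (by positivity))
    convert hsum using 1
    field_simp
  · intro ζ w hw
    have := sq_le_sum_box (diff μ (diff ν fun x => ζ x)) k (4 * L ^ j) hw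
    rw [← hn] at this
    rw [mul_pow, Real.norm_eq_abs, sq_abs, hpow 2, ← pow_mul]
    calc ℓ ^ (2 * 2) * diff μ (diff ν fun x => ζ x) (site N (k + w)) ^ 2
        ≤ ℓ ^ (2 * 2) * _ := mul_le_mul_of_nonneg_left this (by positivity)
      _ = _ := by
        rw [Finset.mul_sum]
        refine Finset.sum_congr rfl fun w _ => ?_
        rw [mul_assoc]
        rfl

/-- The maximum over the $16$ pairs of directions is replaced by the sum of their Sobolev majorants.
-/
lemma exists_orliczBound_gradSup (hL : Odd L) (hd : L ^ j ∣ N)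
    (hΓ : IsFluctuationCovariance L j C c Γ) (hK : 0 < K) (h4 : C 4 ≤ K) (h6 : C 6 ≤ K)
    (h8 : C 8 ≤ K) (k : Fin 2 → ℤ) :
    ∃ T : EuclideanSpace ℝ (Torus N) → ℝ, (∀ ζ, 0 ≤ T ζ) ∧
      OrliczBound (fluctuationMeasure Γ) T (16 * (16 * 4 * 6561 * K)) ∧
      ∀ ζ : EuclideanSpace ℝ (Torus N),
        gradSup L j 2 (fun x => ζ x) (star L j (block N L j k)) ^ 2 ≤ T ζ := by
  have h := fun p : Dir × Dir =>
    exists_orliczBound_diff_diff hL.pos hΓ hK h4 h6 h8 ((L : ℤ) ^ j • k) p.1 p.2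
  choose T hT0 hTO hTle using h
  refine ⟨fun ζ => ∑ p : Dir × Dir, T p ζ, fun ζ => Finset.sum_nonneg fun p _ => hT0 p ζ, ?_, ?_⟩
  · exact OrliczBound.sum (by positivity) (by norm_num) (by simp) (fun p _ => hT0 p)
      fun p _ => hTO p
  · intro ζ
    set S := ∑ p : Dir × Dir, T p ζ with hS
    have hS0 : 0 ≤ S := Finset.sum_nonneg fun p _ => hT0 p ζ
    have : gradSup L j 2 (fun x => ζ x) (star L j (block N L j k)) ≤ Real.sqrt S := by
      refine gradSup_two_le (Real.sqrt_nonneg _) fun x hx μ ν => Real.le_sqrt_of_sq_le ?_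
      obtain ⟨k', w, hk', hw, rfl⟩ := exists_site_of_mem_star hL hd (isPolymer_block k) hx
      obtain ⟨r, hr, hkr⟩ := mem_block.1 (hk' (center_mem_block k'))
      rw [site_add, hkr, ← site_add, add_assoc]
      have hrw : r + w ∈ box (4 * L ^ j) := mem_box.2 fun i => by
        have h1 := hr i
        have h2 := hw i
        have := abs_add_le (r i) (w i)
        simp only [Pi.add_apply]
        push_cast
        omega
      exact (hTle (μ, ν) ζ _ hrw).trans
        (Finset.single_le_sum (f := fun p => T p ζ) (fun p _ => hT0 p ζ) (Finset.mem_univ (μ, ν)))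
    calc _ ≤ Real.sqrt S ^ 2 := pow_le_pow_left₀ (gradSup_nonneg _ _ _ _ _) this 2
      _ = S := Real.sq_sqrt hS0

/-- Each direction contributes $4K$; four directions with the factor $\frac12$ give $8K$ per site.
-/
lemma orliczBound_gradSq_sum (hL : 1 ≤ L) (hΓ : IsFluctuationCovariance L j C c Γ)
    (hK : 0 < K) (h2 : C 2 ≤ K) {Z : Finset (Torus N)} {m : ℝ} (hm : 0 < m)
    (hZ : (Z.card : ℝ) ≤ m) :
    OrliczBound (fluctuationMeasure Γ) (fun ζ => ∑ x ∈ Z, (1 / 2 : ℝ) * ∑ μ : Dir,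
      (L : ℝ) ^ (2 * j) * (diff μ (fun y => ζ y) x) ^ 2) (m * (8 * K)) := by
  have hL0 : (0 : ℝ) < L := by exact_mod_cast hL
  refine OrliczBound.sum (by positivity) hm hZ (fun x _ ζ => by positivity) fun x _ => ?_
  have h1 : ∀ μ ∈ (Finset.univ : Finset Dir), OrliczBound (fluctuationMeasure Γ)
      (fun ζ => (L : ℝ) ^ (2 * j) * (diff μ (fun y => ζ y) x) ^ 2) (4 * K) := by
    intro μ _
    have h := (orliczBound_iterDiff_sq hL hΓ (a := [μ]) (by simp) hK h2 x).const_mul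
      (c := (L : ℝ) ^ (2 * j)) (by positivity)
    have e : (L : ℝ) ^ (2 * j) * (4 * (K * ((L : ℝ) ^ (2 * [μ].length * j))⁻¹)) = 4 * K := by
      rw [List.length_singleton, mul_one]
      field_simp
    rw [e] at h
    exact h
  have h2 := (OrliczBound.sum (by positivity) (m := 4) (by norm_num) (by simp)
    (fun μ _ ζ => by positivity) h1).const_mul (c := 1 / 2) (by norm_num)
  convert h2 using 1
  ring

/-- The exponential of twice the logarithm of the regulator of the fluctuation field is
dominated by a function of expectation at most two. -/
lemma IsSmall.exists_fluctuation_weight (hL : Odd L) (hd : L ^ j ∣ N) {X : Finset (Torus N)}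
    (hX : IsSmall L j X) (hΓ : IsFluctuationCovariance L j C c Γ) (hK : 0 < K) (h2 : C 2 ≤ K)
    (h4 : C 4 ≤ K) (h6 : C 6 ≤ K) (h8 : C 8 ≤ K) {c₁ c₃ κ : ℝ} (hc₁ : 0 < c₁) (hc₃ : 0 < c₃)
    (hκ : 0 < κ) (hsmall : 2 * (κ * (K * (26873888 * c₁ + 128 * c₃))) ≤ 1) :
    ∃ k : EuclideanSpace ℝ (Torus N) → ℝ, Integrable k (fluctuationMeasure Γ) ∧ (∀ ζ, 0 ≤ k ζ) ∧
      ∫ ζ, k ζ ∂(fluctuationMeasure Γ) ≤ 2 ∧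
      ∀ ζ, Real.exp (2 * logRegulator c₁ c₃ κ L j (fun x => ζ x) X) ≤ k ζ := by
  have hL0 : (0 : ℝ) < L := by exact_mod_cast hL.pos
  set ℓ : ℝ := (L : ℝ) ^ j with hℓ
  have hℓ0 : 0 < ℓ := by positivity
  have hcount : (blockCount L j X : ℝ) ≤ 4 := by exact_mod_cast hX.2
  have hcard : (X.card : ℝ) ≤ 4 * ℓ ^ 2 := by
    have : (X.card : ℝ) ≤ blockCount L j X * (L ^ j) ^ 2 := by
      exact_mod_cast card_le_of_isPolymer hL hd hX.1.2.1
    exact this.trans (by gcongr)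
  have hbdry : ((boundary X).card : ℝ) ≤ 16 * ℓ := by
    have : ((boundary X).card : ℝ) ≤ blockCount L j X * (4 * L ^ j) := by
      exact_mod_cast card_boundary_le hL hX.1.2.1
    refine this.trans ?_
    rw [← hℓ]
    nlinarith
  have hB : ∀ B ∈ blocksIn L j X, ∃ T : EuclideanSpace ℝ (Torus N) → ℝ, (∀ ζ, 0 ≤ T ζ) ∧
      OrliczBound (fluctuationMeasure Γ) T (16 * (16 * 4 * 6561 * K)) ∧
      ∀ ζ : EuclideanSpace ℝ (Torus N), gradSup L j 2 (fun x => ζ x) (star L j B) ^ 2 ≤ T ζ := by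
    intro B hB
    obtain ⟨-, k, rfl⟩ := exists_of_mem_blocksIn hB
    exact exists_orliczBound_gradSup hL hd hΓ hK h4 h6 h8 k
  choose! T hT0 hTO hTle using hB
  have hpow : (L : ℝ) ^ (2 * j) = ℓ ^ 2 := by rw [mul_comm, pow_mul]
  have o1 := ((orliczBound_gradSq_sum hL.pos hΓ hK h2 (by positivity) hcard).const_mul
    (c := ((L : ℝ) ^ (2 * j))⁻¹) (by positivity)).const_mul (c := c₁ * κ) (by positivity)
  have o2 := ((orliczBound_gradSq_sum hL.pos hΓ hK h2 (by positivity) hbdry).const_mul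
    (c := ((L : ℝ) ^ j)⁻¹) (by positivity)).const_mul (c := c₃ * κ) (by positivity)
  have o3 := (OrliczBound.sum (by positivity) (m := 4) (by norm_num) hcount
    (fun B hB => hT0 B hB) hTO).const_mul (c := c₁ * κ) (by positivity)
  have o := (o1.add o2).add o3
  -- Here $26873888=4\cdot8+4\cdot16\cdot(16\cdot4\cdot6561)$ collects gradient and Hessian terms,
  -- and $128=16\cdot8$ the boundary term.
  set s := κ * (K * (26873888 * c₁ + 128 * c₃)) with hs
  have hs0 : 0 < s := by positivity
  have hseq : c₁ * κ * (((L : ℝ) ^ (2 * j))⁻¹ * (4 * ℓ ^ 2 * (8 * K))) +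
      c₃ * κ * (((L : ℝ) ^ j)⁻¹ * (16 * ℓ * (8 * K))) +
      c₁ * κ * (4 * (16 * (16 * 4 * 6561 * K))) = s := by
    rw [hpow, ← hℓ, hs]
    field_simp
    ring
  rw [hseq] at o
  set U : EuclideanSpace ℝ (Torus N) → ℝ := fun ζ =>
    c₁ * κ * (((L : ℝ) ^ (2 * j))⁻¹ * ∑ x ∈ X, (1 / 2 : ℝ) * ∑ μ : Dir,
      (L : ℝ) ^ (2 * j) * (diff μ (fun y => ζ y) x) ^ 2) +
    c₃ * κ * (((L : ℝ) ^ j)⁻¹ * ∑ x ∈ boundary X, (1 / 2 : ℝ) * ∑ μ : Dir,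
      (L : ℝ) ^ (2 * j) * (diff μ (fun y => ζ y) x) ^ 2) +
    c₁ * κ * ∑ B ∈ blocksIn L j X, T B ζ with hU
  obtain ⟨-, hmeas, hint⟩ : OrliczBound (fluctuationMeasure Γ) U s := o
  have hkmeas : Measurable fun ζ => Real.exp (U ζ / s) := by fun_prop
  have hle : ∀ ζ, logRegulator c₁ c₃ κ L j (fun x => ζ x) X ≤ U ζ := by
    intro ζ
    have : hessWSq L j (fun x => ζ x) X ≤ ∑ B ∈ blocksIn L j X, T B ζ :=
      Finset.sum_le_sum fun B hB => hTle B hB ζ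
    have := mul_le_mul_of_nonneg_left this (mul_nonneg hc₁.le hκ.le)
    exact add_le_add le_rfl this
  have hintegrable : Integrable (fun ζ => Real.exp (U ζ / s)) (fluctuationMeasure Γ) := by
    refine ⟨hkmeas.aestronglyMeasurable, ?_⟩
    rw [hasFiniteIntegral_iff_ofReal (Filter.Eventually.of_forall fun _ => (Real.exp_pos _).le)]
    exact hint.trans_lt (by simp)
  refine ⟨fun ζ => Real.exp (U ζ / s), hintegrable, fun ζ => (Real.exp_pos _).le, ?_, fun ζ => ?_⟩
  · rw [integral_eq_lintegral_of_nonneg_ae (Filter.Eventually.of_forall fun _ => (Real.exp_pos _).le)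
      hkmeas.aestronglyMeasurable]
    exact ENNReal.toReal_mono (by simp) hint
  -- As $2s\le1$ and the logarithm of the regulator is nonnegative, twice it is at most $U/s$.
  · apply Real.exp_le_exp.2
    have h0 := (logRegulator_nonneg hc₁.le hc₃.le hκ.le L j (fun x => ζ x) X)
    rw [le_div_iff₀ hs0]
    nlinarith [hle ζ]

end FluctuationWeight

/-! ### The contraction of the Taylor remainder. -/

section Contraction

variable {N : ℕ} [NeZero N] {L j : ℕ}

/-- Subtraction of the value at a point, as a continuous linear map. -/
def deltaCLM (x₀ : Torus N) : (Torus N → ℝ) →L[ℝ] (Torus N → ℝ) :=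
  ContinuousLinearMap.pi fun x => ContinuousLinearMap.proj (R := ℝ) (φ := fun _ : Torus N => ℝ) x -
    ContinuousLinearMap.proj (R := ℝ) (φ := fun _ : Torus N => ℝ) x₀

lemma gradNorm_smul_delta_le (x₀ : Torus N) (φ : Torus N → ℝ) {t : ℝ} (ht : t ∈ Set.Icc (0 : ℝ) 1)
    (Y : Finset (Torus N)) : gradNorm L j (t • delta x₀ φ) Y ≤ gradNorm L j φ Y := by
  have h0 := gradNorm_nonneg L j φ Y
  have ht1 : ‖t‖ ≤ 1 := by rw [Real.norm_eq_abs, abs_of_nonneg ht.1]; exact ht.2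
  refine max_le (gradSup_one_le h0 fun x hx μ => ?_) (gradSup_two_le h0 fun x hx μ ν => ?_)
  · rw [diff_smul, diff_delta, Pi.smul_apply, norm_smul, mul_left_comm]
    exact (mul_le_of_le_one_left (by positivity) ht1).trans (norm_diff_le_gradNorm hx μ)
  · rw [diff_smul, diff_delta, diff_smul, Pi.smul_apply, norm_smul, mul_left_comm]
    exact (mul_le_of_le_one_left (by positivity) ht1).trans (norm_diff_diff_le_gradNorm hx μ ν)

/-- Only the quadratic term of the exponential series is kept. The price $a^{-2}$ becomes a square
of $\log L$. -/
lemma one_add_pow_four_le {a D : ℝ} (ha : 0 < a) :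
    1 + D ^ 4 ≤ (1 + 8 / a ^ 2) * Real.exp (a * D ^ 2 / 2) := by
  have hx : 0 ≤ a * D ^ 2 / 2 := by positivity
  have h1 := Real.one_le_exp hx
  have h2 := Real.quadratic_le_exp_of_nonneg hx
  have h3 : (a * D ^ 2 / 2) ^ 2 / 2 ≤ Real.exp (a * D ^ 2 / 2) := by nlinarith
  have h4 : D ^ 4 = 8 / a ^ 2 * ((a * D ^ 2 / 2) ^ 2 / 2) := by field_simp; ring
  have h5 := mul_le_mul_of_nonneg_left h3 (show 0 ≤ 8 / a ^ 2 by positivity)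
  rw [← h4] at h5
  linarith

lemma pow_le_one_add_pow_four {D : ℝ} (hD : 0 ≤ D) {m : ℕ} (hm : m ≤ 4) : D ^ m ≤ 1 + D ^ 4 := by
  rcases le_total D 1 with h | h
  · have := pow_le_one₀ (n := m) hD h
    have : 0 ≤ D ^ 4 := by positivity
    linarith
  · have := pow_le_pow_right₀ h hm
    linarith

/-- The Taylor remainder about a constant field contracts in the change of scale. -/
lemma IsSmall.tNorm_rem_le (hL : Odd L) (hL80 : 80 ≤ L) (hd : L ^ (j + 1) ∣ N) (hN : 3 ≤ N)
    {X : Finset (Torus N)} (hX : IsSmall L j X) {c₁ c₃ κ h B₀ : ℝ} (hc₁ : 0 < c₁) (hc₃ : 0 < c₃)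
    (hκ : 0 < κ) (hLc : 288 * (12 * c₁ + 32 * c₃) ≤ c₁ * (L : ℝ) ^ 2) (hh : 1 < h) (hB₀ : 0 ≤ B₀)
    {H : (Torus N → ℝ) → ℂ} (hs : ContDiff ℝ ∞ H) (hloc : LocalOn (star L j X) H)
    (hH : DerivBound h L j (star L j X)
      (fun φ => B₀ * Real.exp (2 * logRegulator c₁ c₃ κ L j φ X)) H)
    {x₀ : Torus N} (hx₀ : x₀ ∈ X) (φ : Torus N → ℝ) :
    tNorm h L (j + 1) (star L j X) (fun φ => rem 2 H (delta x₀ φ)) φ ≤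
      ENNReal.ofReal (48 * B₀ * (40 / L) ^ 3 * (1 + 8 / (c₁ * κ / 72) ^ 2) *
        regulator c₁ c₃ κ L (j + 1) φ (closure L (j + 1) X)) := by
  have hdj : L ^ j ∣ N := (pow_dvd_pow L (Nat.le_succ j)).trans hd
  have hL0 : (0 : ℝ) < L := by exact_mod_cast hL.pos
  have hh0 : 0 < h := by linarith
  set Y := star L j X with hY
  have hx₀Y : x₀ ∈ Y := subset_star hL hdj hN hX.1.2.1 hx₀
  set D := gradNorm L (j + 1) φ Y with hD
  have hD0 : 0 ≤ D := gradNorm_nonneg _ _ _ _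
  set a := c₁ * κ / 72 with ha
  have ha0 : 0 < a := by positivity
  set q : ℝ := 40 / L with hq
  have hq0 : 0 < q := by positivity
  have hq1 : q ≤ 1 / 2 := by
    rw [hq, div_le_div_iff₀ hL0 (by norm_num)]
    have : (80 : ℝ) ≤ L := by exact_mod_cast hL80
    linarith
  set b := B₀ * Real.exp (a * D ^ 2 / 2) with hb
  have hb0 : 0 ≤ b := by positivity
  have hweight : ∀ t ∈ Set.Icc (0 : ℝ) 1,
      B₀ * Real.exp (2 * logRegulator c₁ c₃ κ L j (t • delta x₀ φ) X) ≤ b := by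
    intro t ht
    have h1 := hX.logRegulator_le hL hdj hN hc₁.le hc₃.le hκ.le
      (gradNorm_smul_delta_le (L := L) (j := j + 1) x₀ φ ht Y)
    rw [hb]
    gcongr
    -- With $a=c_1\kappa/72$ this is exactly the hypothesis `hLc`: the gain $L^{-2}$ beats the fixed
    -- ratio of constants.
    have h2 : 2 * (κ * (12 * c₁ + 32 * c₃) * (D ^ 2 / (L : ℝ) ^ 2)) ≤ a * D ^ 2 / 2 := by
      rw [ha, ← mul_div_assoc, ← mul_div_assoc, div_le_iff₀ (by positivity)]
      have h3 : 0 ≤ κ * D ^ 2 := by positivity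
      nlinarith [mul_le_mul_of_nonneg_left hLc h3]
    linarith
  set p : (Torus N → ℝ) → ℝ := fun v => c2Norm L j v Y with hp
  have hp0 : ∀ v, 0 ≤ p v := fun v => c2Norm_nonneg _ _ _ _
  have hpδ : ∀ v, p (delta x₀ v) ≤ 20 / L * c2Norm L (j + 1) v Y := fun v =>
    (hX.c2Norm_delta_le hL hdj hN hx₀ v).trans (by
      gcongr
      exact gradNorm_le_c2Norm _ _ _ _)
  have hpφ : p (delta x₀ φ) ≤ 20 / L * D := hX.c2Norm_delta_le hL hdj hN hx₀ φ
  have hprod : ∀ (n : ℕ) (u : Fin n → Torus N → ℝ), ∏ i, p (delta x₀ (u i)) ≤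
      (20 / L) ^ n * ∏ i, c2Norm L (j + 1) (u i) Y := by
    intro n u
    calc ∏ i, p (delta x₀ (u i)) ≤ ∏ i, (20 / L * c2Norm L (j + 1) (u i) Y) :=
          Finset.prod_le_prod (fun i _ => hp0 _) fun i _ => hpδ _
      _ = _ := by
        rw [Finset.prod_mul_distrib, Finset.prod_const, Finset.card_univ, Fintype.card_fin]
  have hHb : ∀ t ∈ Set.Icc (0 : ℝ) 1, ∀ (n : ℕ) (w : Fin n → Torus N → ℝ),
      ‖iteratedFDeriv ℝ n H (t • delta x₀ φ) w‖ ≤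
        (n.factorial : ℝ) / h ^ n * b * ∏ i, p (w i) := by
    intro t ht n w
    have h1 := hH n (t • delta x₀ φ) w
    have hpos : 0 < h ^ n / (n.factorial : ℝ) := by positivity
    have hP : 0 ≤ ∏ i, p (w i) := Finset.prod_nonneg fun i _ => hp0 _
    have h2 := h1.trans (mul_le_mul_of_nonneg_right (hweight t ht) hP)
    rw [← le_div_iff₀' hpos] at h2
    refine h2.trans (le_of_eq ?_)
    field_simp
    rfl
  have hremeq : (fun φ => rem 2 H (delta x₀ φ)) = taylorRem H ∘ deltaCLM x₀ := by
    ext ψ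
    rw [rem_two_eq_taylorRem]
    rfl
  have hTs := contDiff_taylorRem hs
  have hRs : ContDiff ℝ ∞ (fun φ => rem 2 H (delta x₀ φ)) := by
    rw [hremeq]
    exact hTs.comp (deltaCLM x₀).contDiff
  have hRloc : LocalOn Y (fun φ => rem 2 H (delta x₀ φ)) := hloc.taylorRem_delta hs hx₀Y
  have hRd : ∀ (n : ℕ) (u : Fin n → Torus N → ℝ),
      iteratedFDeriv ℝ n (fun φ => rem 2 H (delta x₀ φ)) φ u =
        iteratedFDeriv ℝ n (taylorRem H) (delta x₀ φ) (fun i => delta x₀ (u i)) := by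
    intro n u
    rw [hremeq, (deltaCLM x₀).iteratedFDeriv_comp_right hTs φ (i := n) (mod_cast le_top)]
    rfl
  have h1mem : (1 : ℝ) ∈ Set.Icc (0 : ℝ) 1 := by simp
  -- one bound for each order of the derivative
  have hterm : ∀ n : ℕ, ENNReal.ofReal (h ^ n / (n.factorial : ℝ)) *
      tNormN L (j + 1) Y (fun φ => rem 2 H (delta x₀ φ)) φ n ≤
        ENNReal.ofReal (24 * b * q ^ 3 * (1 + D ^ 4) * (1 / 2) ^ n) := by
    intro n
    have hfac : 0 < h ^ n / (n.factorial : ℝ) := by positivity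
    suffices hreal : ∃ β, 0 ≤ β ∧ (∀ u : Fin n → Torus N → ℝ,
        ‖iteratedFDeriv ℝ n (fun φ => rem 2 H (delta x₀ φ)) φ u‖ ≤
          β * ∏ i, c2Norm L (j + 1) (u i) Y) ∧
        h ^ n / (n.factorial : ℝ) * (2 ^ n * β) ≤ 24 * b * q ^ 3 * (1 + D ^ 4) * (1 / 2) ^ n by
      obtain ⟨β, hβ, hbound, hle⟩ := hreal
      refine le_trans ?_ (ENNReal.ofReal_le_ofReal hle)
      rw [ENNReal.ofReal_mul hfac.le]
      gcongr
      refine iSup₂_le fun f hf => ENNReal.ofReal_le_ofReal ?_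
      exact norm_dirDeriv_le hRloc hRs hβ hbound f hf
    rcases lt_or_ge n 3 with hn | hn
    -- The third derivative is used: $n$ factors $20/L$ come from test directions, and $3-n$ factors
    -- $20D/L$ from $\delta\varphi$.
    · refine ⟨6 / h ^ 3 * b * (20 / L) ^ 3 * D ^ (3 - n), by positivity, fun u => ?_, ?_⟩
      · rw [hRd]
        have h6 : ∀ t ∈ Set.Icc (0 : ℝ) 1, ∀ w : Fin 3 → Torus N → ℝ,
            ‖iteratedFDeriv ℝ 3 H (t • delta x₀ φ) w‖ ≤ 6 / h ^ 3 * b * ∏ i, p (w i) := by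
          intro t ht w
          simpa [Nat.factorial] using hHb t ht 3 w
        refine (norm_iteratedFDeriv_taylorRem_le hs h6 (by omega) _).trans ?_
        have e1 : p (delta x₀ φ) ^ (3 - n) ≤ (20 / L * D) ^ (3 - n) :=
          pow_le_pow_left₀ (hp0 _) hpφ _
        have e2 := hprod n u
        have e3 : 0 ≤ ∏ i, c2Norm L (j + 1) (u i) Y :=
          Finset.prod_nonneg fun i _ => c2Norm_nonneg _ _ _ _
        have e4 : 0 ≤ ∏ i, p (delta x₀ (u i)) := Finset.prod_nonneg fun i _ => hp0 _
        calc _ ≤ 6 / h ^ 3 * b * (20 / L * D) ^ (3 - n) *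
              ((20 / L) ^ n * ∏ i, c2Norm L (j + 1) (u i) Y) := by gcongr
          _ = 6 / h ^ 3 * b * ((20 / L) ^ (3 - n) * (20 / L) ^ n) * D ^ (3 - n) *
              ∏ i, c2Norm L (j + 1) (u i) Y := by rw [mul_pow]; ring
          _ = _ := by rw [← pow_add, Nat.sub_add_cancel hn.le]
      · have e1 : h ^ n ≤ h ^ 3 := pow_le_pow_right₀ hh.le hn.le
        have e2 : D ^ (3 - n) ≤ 1 + D ^ 4 := pow_le_one_add_pow_four hD0 (by omega)
        have e3 : (1 : ℝ) ≤ n.factorial := by exact_mod_cast Nat.factorial_pos n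
        have e4 : h ^ n / (n.factorial : ℝ) ≤ h ^ 3 := by
          rw [div_le_iff₀ (by positivity)]
          nlinarith [pow_pos hh0 3]
        -- One $2^n$ is the cost of complex test functions, the other compensates the geometric
        -- factor; $32\cdot\frac68=24$.
        have e5 : (2 : ℝ) ^ n * 2 ^ n ≤ 32 := by
          interval_cases n <;> norm_num
        have e6 : (20 / L : ℝ) ^ 3 = q ^ 3 / 8 := by rw [hq]; field_simp; norm_num
        calc h ^ n / (n.factorial : ℝ) * (2 ^ n * (6 / h ^ 3 * b * (20 / L) ^ 3 * D ^ (3 - n)))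
            ≤ h ^ 3 * (2 ^ n * (6 / h ^ 3 * b * (20 / L) ^ 3 * (1 + D ^ 4))) := by gcongr
          _ = (2 : ℝ) ^ n * 2 ^ n * ((6 / 8) * b * q ^ 3 * (1 + D ^ 4) * (1 / 2) ^ n) := by
            rw [e6, one_div, inv_pow]
            field_simp
          _ ≤ 32 * ((6 / 8) * b * q ^ 3 * (1 + D ^ 4) * (1 / 2) ^ n) := by gcongr
          _ = _ := by ring
    · obtain ⟨m, rfl⟩ : ∃ m, n = m + 3 := ⟨n - 3, by omega⟩
      -- The factorial and the power of $h$ cancel against the norm's weights. With the complex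
      -- factor each direction yields $q=40/L\le\frac12$, so the series converges.
      refine ⟨((m + 3).factorial : ℝ) / h ^ (m + 3) * b * (20 / L) ^ (m + 3), by positivity,
        fun u => ?_, ?_⟩
      · rw [hRd, iteratedFDeriv_taylorRem_of_three_le hs]
        have := hHb 1 h1mem (m + 3) (fun i => delta x₀ (u i))
        rw [one_smul] at this
        refine this.trans ?_
        rw [mul_assoc (_ * b)]
        gcongr
        exact hprod _ u
      · have e1 : h ^ (m + 3) / ((m + 3).factorial : ℝ) * (2 ^ (m + 3) *
            (((m + 3).factorial : ℝ) / h ^ (m + 3) * b * (20 / L) ^ (m + 3))) = b * q ^ 3 * q ^ m := by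
          have : q = 2 * (20 / L) := by rw [hq]; ring
          rw [this, mul_assoc b, ← pow_add, add_comm 3 m, mul_pow]
          field_simp
        rw [e1]
        have e2 : q ^ m ≤ (1 / 2) ^ m := pow_le_pow_left₀ hq0.le hq1 m
        have e3 : 0 ≤ D ^ 4 := by positivity
        have e4 : 0 ≤ b * q ^ 3 * (1 / 2) ^ m := by positivity
        calc b * q ^ 3 * q ^ m ≤ b * q ^ 3 * (1 / 2) ^ m := by gcongr
          _ ≤ 24 * b * q ^ 3 * (1 + D ^ 4) * (1 / 2) ^ (m + 3) := by
            rw [pow_add]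
            nlinarith [mul_nonneg e4 e3]
  have hsum : tNorm h L (j + 1) Y (fun φ => rem 2 H (delta x₀ φ)) φ ≤
      ENNReal.ofReal (48 * b * q ^ 3 * (1 + D ^ 4)) := by
    refine (ENNReal.tsum_le_tsum hterm).trans ?_
    rw [← ENNReal.ofReal_tsum_of_nonneg (fun n => by positivity)
      (summable_geometric_two.mul_left _), tsum_mul_left, tsum_geometric_two]
    apply ENNReal.ofReal_le_ofReal
    linarith
  refine hsum.trans (ENNReal.ofReal_le_ofReal ?_)
  -- One half has absorbed the square of the scale $j$ regulator; the other absorbs $1+D^4$.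
  have hreg : Real.exp (a * D ^ 2 / 2) * Real.exp (a * D ^ 2 / 2) ≤
      regulator c₁ c₃ κ L (j + 1) φ (closure L (j + 1) X) := by
    rw [← Real.exp_add, add_halves, regulator_eq_exp]
    apply Real.exp_le_exp.2
    have h1 := hX.gradNorm_sq_le hL (by omega) hd hN φ
    have h2 := mul_le_mul_of_nonneg_left h1 ha0.le
    have h3 := gradL2BdrySq_nonneg L (j + 1) φ (closure L (j + 1) X)
    have h4 : 0 ≤ c₃ * κ * gradL2BdrySq L (j + 1) φ (closure L (j + 1) X) := by positivity
    rw [logRegulator]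
    refine h2.trans ?_
    rw [ha]
    linarith
  have h5 := one_add_pow_four_le (D := D) ha0
  calc 48 * b * q ^ 3 * (1 + D ^ 4)
      ≤ 48 * b * q ^ 3 * ((1 + 8 / a ^ 2) * Real.exp (a * D ^ 2 / 2)) := by gcongr
    _ = 48 * B₀ * q ^ 3 * (1 + 8 / a ^ 2) *
        (Real.exp (a * D ^ 2 / 2) * Real.exp (a * D ^ 2 / 2)) := by rw [hb]; ring
    _ ≤ _ := by gcongr

end Contraction

/-! ### The fluctuation expectation and the choice of `L`. -/

section Assembly

variable {N : ℕ} [NeZero N] {L j : ℕ}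

/-- The regulator sees only differences of the field, so averaging over constant shifts does not
change the weight. -/
lemma logRegulator_congr {φ ψ : Torus N → ℝ} (h : ∀ μ, diff μ φ = diff μ ψ) (c₁ c₃ κ : ℝ)
    (L j : ℕ) (X : Finset (Torus N)) :
    logRegulator c₁ c₃ κ L j φ X = logRegulator c₁ c₃ κ L j ψ X := by
  have h2 : ∀ Y : Finset (Torus N), gradSup L j 2 φ Y = gradSup L j 2 ψ Y := fun Y => by
    simp [gradSup, iterDiff, List.ofFn_succ, h]
  simp only [logRegulator, gradL2Sq, gradL2BdrySq, hessWSq, h, h2]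

lemma diff_add_const (μ : Dir) (φ : Torus N → ℝ) (s : ℝ) :
    diff μ (φ + fun _ => s) = diff μ φ := by
  ext x
  simp [diff]

lemma IsSmall.exists_logRegulator_le_on_ball (hL : Odd L) (hd : L ^ j ∣ N) (hN : 3 ≤ N)
    {X : Finset (Torus N)} (hX : IsSmall L j X) {c₁ c₃ κ : ℝ} (h₁ : 0 ≤ c₁) (h₃ : 0 ≤ c₃)
    (hκ : 0 ≤ κ) (φ₀ : Torus N → ℝ) :
    ∃ C, ∀ φ ∈ Metric.ball φ₀ 1, logRegulator c₁ c₃ κ L j φ X ≤ C := by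
  refine ⟨_, fun φ hφ => hX.logRegulator_le hL hd hN h₁ h₃ hκ
    (D := 4 * (L : ℝ) ^ (2 * (j + 1)) * (‖φ₀‖ + 1)) ?_⟩
  refine (gradNorm_le_c2Norm _ _ _ _).trans ((c2Norm_le_norm hL.pos φ).trans ?_)
  gcongr
  have h1 := norm_le_norm_add_norm_sub' φ φ₀
  rw [Metric.mem_ball, dist_eq_norm] at hφ
  linarith

/-- The fluctuation expectation of the neutral component exists, is smooth, and inherits the
derivative bounds with the square of the regulator. -/
lemma IsSmall.derivBound_fluctuationExp (hL : Odd L) (hd : L ^ j ∣ N) (hN : 3 ≤ N)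
    {X : Finset (Torus N)} (hX : IsSmall L j X) {c₁ c₃ κ h α M : ℝ} (hc₁ : 0 ≤ c₁) (hc₃ : 0 ≤ c₃)
    (hκ : 0 ≤ κ) (hh : 0 < h) (hα : 0 < α) (hM : 0 ≤ M) {F : (Torus N → ℝ) → ℂ}
    (hs : ContDiff ℝ ∞ F) (hloc : LocalOn (star L j X) F)
    (hF : ∀ φ, tNorm h L j (star L j X) F φ ≤ ENNReal.ofReal (M * regulator c₁ c₃ κ L j φ X))
    {Γ : Torus N → ℝ} {k : EuclideanSpace ℝ (Torus N) → ℝ}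
    (hk : Integrable k (fluctuationMeasure Γ)) (hk0 : ∀ ζ, 0 ≤ k ζ)
    (hk1 : ∀ ζ, Real.exp (2 * logRegulator c₁ c₃ κ L j (fun x => ζ x) X) ≤ k ζ) :
    (∀ φ : Torus N → ℝ, Integrable (fun ζ : EuclideanSpace ℝ (Torus N) =>
      chargedComponent α 0 F (fun x => φ x + ζ x)) (fluctuationMeasure Γ)) ∧
    ContDiff ℝ ∞ (fluctuationExp Γ (chargedComponent α 0 F)) ∧
    LocalOn (star L j X) (fluctuationExp Γ (chargedComponent α 0 F)) ∧
    DerivBound h L j (star L j X)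
      (fun φ => M * (∫ ζ, k ζ ∂(fluctuationMeasure Γ)) *
        Real.exp (2 * logRegulator c₁ c₃ κ L j φ X))
      (fluctuationExp Γ (chargedComponent α 0 F)) := by
  set Q := fun φ => logRegulator c₁ c₃ κ L j φ X with hQ
  have hball := hX.exists_logRegulator_le_on_ball hL hd hN hc₁ hc₃ hκ
  have hg : ∀ φ, 0 ≤ M * Real.exp (Q φ) := fun φ => by positivity
  have hD := derivBound_of_tNorm_le hh hloc hs hg hF
  -- the average over constant translations
  set ν : Measure ℝ :=
    ENNReal.ofReal (α / (2 * Real.pi)) • volume.restrict (Set.Ioc 0 (2 * Real.pi / α)) with hν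
  have hνone : ν Set.univ = 1 := by
    rw [hν, Measure.smul_apply, Measure.restrict_apply_univ, Real.volume_Ioc, smul_eq_mul,
      ← ENNReal.ofReal_mul (by positivity), sub_zero, ← ENNReal.ofReal_one]
    congr 1
    field_simp
  have : IsProbabilityMeasure ν := ⟨hνone⟩
  have hT : Measurable fun (s : ℝ) (_ : Torus N) => s := measurable_pi_lambda _ fun _ => measurable_id
  obtain ⟨-, hs', hD'⟩ := hD.integral_shift hh hL.pos hs hg hT (ν := ν)
    (integrable_const (1 : ℝ)) (fun _ => zero_le_one) (a := fun φ => M * Real.exp (Q φ))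
    (fun φ s => by
      rw [mul_one, hQ]
      simp only
      rw [logRegulator_congr fun μ => diff_add_const μ φ s])
    (fun φ₀ => by
      obtain ⟨C, hC⟩ := hball φ₀
      exact ⟨M * Real.exp C, fun φ hφ => by gcongr; exact hC φ hφ⟩)
  have hloc' : LocalOn (star L j X) (chargedComponent α 0 F) := by
    rw [chargedComponent_zero_eq hα]
    exact hloc.integral_shift
  rw [← chargedComponent_zero_eq hα] at hs' hD'
  simp only [integral_const, probReal_univ, smul_eq_mul, mul_one] at hD'
  -- the average over the fluctuation field
  have hT2 : Measurable fun (ζ : EuclideanSpace ℝ (Torus N)) (x : Torus N) => ζ x := by fun_prop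
  obtain ⟨hi, hs2, hD2⟩ := hD'.integral_shift hh hL.pos hs' hg hT2 hk hk0
    (a := fun φ => M * Real.exp (2 * Q φ))
    (fun φ ζ => by
      rw [mul_assoc]
      refine mul_le_mul_of_nonneg_left ?_ hM
      refine le_trans ?_ (mul_le_mul_of_nonneg_left (hk1 ζ) (Real.exp_pos _).le)
      rw [← Real.exp_add]
      exact Real.exp_le_exp.2 (logRegulator_add_le hc₁ hc₃ hκ L j φ (fun x => ζ x) X))
    (fun φ₀ => by
      obtain ⟨C, hC⟩ := hball φ₀
      exact ⟨M * Real.exp (2 * C), fun φ hφ => by gcongr; exact hC φ hφ⟩)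
  refine ⟨hi, hs2, hloc'.integral_shift, ?_⟩
  convert hD2 using 2 with φ
  · exact mul_right_comm _ _ _
  · rfl

/-- Each condition holds eventually, since $\kappa_L\to0$. The last uses $\kappa_L^{-2}\sim(\log
L)^2=o(L^{1/2})$, which turns $L^{-3}$ into $L^{-5/2}$; its $96$ is $48$ times the bound $2$ on the
expected weight. -/
lemma exists_scale_bound {c₁ c₃ c₀ K : ℝ} (hc₁ : 0 < c₁) (hc₀ : 0 < c₀) :
    ∃ L₀ : ℕ, ∀ L : ℕ, L₀ ≤ L → 80 ≤ L ∧
      2 * (kappa c₀ L * (K * (26873888 * c₁ + 128 * c₃))) ≤ 1 ∧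
      288 * (12 * c₁ + 32 * c₃) ≤ c₁ * (L : ℝ) ^ 2 ∧
      96 * (40 / (L : ℝ)) ^ 3 * (1 + 8 / (c₁ * kappa c₀ L / 72) ^ 2) ≤
        (L : ℝ) ^ (-(2 + 1 / 2) : ℝ) := by
  have hcast := tendsto_natCast_atTop_atTop (R := ℝ)
  have e1 := Filter.eventually_ge_atTop 80
  have hκ : Filter.Tendsto (fun L : ℕ => kappa c₀ L) Filter.atTop (nhds 0) :=
    (Real.tendsto_log_atTop.comp hcast).const_div_atTop c₀
  have e2 : ∀ᶠ L : ℕ in Filter.atTop,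
      2 * (kappa c₀ L * (K * (26873888 * c₁ + 128 * c₃))) < 1 := by
    have := (hκ.mul_const (K * (26873888 * c₁ + 128 * c₃))).const_mul 2
    rw [zero_mul, mul_zero] at this
    exact this.eventually_lt_const one_pos
  have e3 : ∀ᶠ L : ℕ in Filter.atTop, 288 * (12 * c₁ + 32 * c₃) ≤ c₁ * (L : ℝ) ^ 2 :=
    ((Filter.tendsto_pow_atTop two_ne_zero).comp hcast |>.const_mul_atTop hc₁).eventually_ge_atTop _
  have e4 : ∀ᶠ x : ℝ in Filter.atTop,
      ‖96 * 40 ^ 3 * (1 + 8 * (72 / (c₁ * c₀)) ^ 2 * Real.log x ^ (2 : ℝ))‖ ≤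
        1 * ‖x ^ (1 / 2 : ℝ)‖ := by
    have h1 : (fun _ : ℝ => (1 : ℝ)) =o[Filter.atTop] fun x : ℝ => x ^ (1 / 2 : ℝ) := by
      rw [Asymptotics.isLittleO_const_left]
      exact Or.inr (tendsto_norm_atTop_atTop.comp (tendsto_rpow_atTop (by norm_num)))
    have h2 := isLittleO_log_rpow_rpow_atTop 2 (show (0 : ℝ) < 1 / 2 by norm_num)
    exact ((h1.add (h2.const_mul_left _)).const_mul_left _).def one_pos
  obtain ⟨L₀, hL₀⟩ := Filter.eventually_atTop.1
    (e1.and (e2.and (e3.and (hcast.eventually e4))))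
  refine ⟨L₀, fun L hL => ?_⟩
  obtain ⟨h80, h2, h3, h4⟩ := hL₀ L hL
  refine ⟨h80, h2.le, h3, ?_⟩
  have hL0 : (0 : ℝ) < L := by exact_mod_cast (show 0 < L by omega)
  have hlog : 0 < Real.log L := Real.log_pos (by exact_mod_cast (show 1 < L by omega))
  rw [one_mul, Real.norm_of_nonneg (by positivity), Real.norm_of_nonneg (by positivity),
    Real.rpow_two] at h4
  have e5 : (L : ℝ) ^ (-(2 + 1 / 2) : ℝ) = (L : ℝ) ^ (1 / 2 : ℝ) / (L : ℝ) ^ 3 := by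
    rw [← Real.rpow_natCast (L : ℝ) 3, ← Real.rpow_sub hL0]
    norm_num
  rw [e5, le_div_iff₀ (by positivity)]
  refine le_trans (le_of_eq ?_) h4
  rw [kappa]
  field_simp

lemma tNorm_le_of_activityNorm {c₁ c₃ κ h A : ℝ} (hA : 0 < A)
    {K : Finset (Torus N) → (Torus N → ℝ) → ℂ} (hK : activityNorm c₁ c₃ κ h A L j K ≠ ⊤)
    {X : Finset (Torus N)} (hX : IsConnPolymer L j X) (φ : Torus N → ℝ) :
    tNorm h L j (star L j X) (K X) φ ≤
      ENNReal.ofReal ((activityNorm c₁ c₃ κ h A L j K).toReal * (A ^ blockCount L j X)⁻¹ *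
        regulator c₁ c₃ κ L j φ X) := by
  have hreg : 0 < regulator c₁ c₃ κ L j φ X := Real.exp_pos _
  have hAc : 0 < A ^ blockCount L j X := by positivity
  have h1 : ENNReal.ofReal (A ^ blockCount L j X) * (tNorm h L j (star L j X) (K X) φ /
      ENNReal.ofReal (regulator c₁ c₃ κ L j φ X)) ≤ activityNorm c₁ c₃ κ h A L j K :=
    (mul_le_mul_right (le_iSup (fun φ => tNorm h L j (star L j X) (K X) φ /
      ENNReal.ofReal (regulator c₁ c₃ κ L j φ X)) φ) _).trans
      (le_iSup₂ (f := fun (X : Finset (Torus N)) (_ : IsConnPolymer L j X) =>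
        ENNReal.ofReal (A ^ blockCount L j X) * activityNormOn c₁ c₃ κ h L j X (K X)) X hX)
  rw [ENNReal.ofReal_mul (by positivity), ENNReal.ofReal_mul ENNReal.toReal_nonneg,
    ENNReal.ofReal_toReal hK, ENNReal.ofReal_inv_of_pos hAc,
    ← ENNReal.div_le_iff (by simpa using hreg) ENNReal.ofReal_ne_top, ← div_eq_mul_inv,
    ENNReal.le_div_iff_mul_le (Or.inl (by simpa using hAc)) (Or.inl ENNReal.ofReal_ne_top),
    mul_comm]
  exact h1

end Assembly

end CoulombGas

end

/-! ### The theorem. -/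

open CoulombGas in
theorem mainTheorem7 :
    ∃ ϑ : ℝ, 0 < ϑ ∧
      ∀ (C : ℕ → ℝ) (c c₁ c₃ c₀ : ℝ), 0 < c₁ → 0 < c₃ → 0 < c₀ →
        ∃ L₀ : ℕ, ∀ (L : ℕ) [NeZero L], L₀ ≤ L → 1 < L → Odd L →
          ∀ R j : ℕ, j < R →
            ∀ Γ : Torus (L ^ R) → ℝ, IsFluctuationCovariance L j C c Γ →
              ∀ h A α : ℝ, 1 < h → 1 < A → 0 < α →
                ∀ K : Finset (Torus (L ^ R)) → (Torus (L ^ R) → ℝ) → ℂ,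
                  IsActivity α L j K →
                  activityNorm c₁ c₃ (kappa c₀ L) h A L j K ≠ ⊤ →
                  ∀ X : Finset (Torus (L ^ R)), IsSmall L j X →
                    (∀ φ' : Torus (L ^ R) → ℝ,
                      MeasureTheory.Integrable
                        (fun ζ : EuclideanSpace ℝ (Torus (L ^ R)) =>
                          chargedComponent α 0 (K X) (fun x => φ' x + ζ x))
                        (fluctuationMeasure Γ)) ∧
                    ContDiff ℝ ∞ (fluctuationExp Γ (chargedComponent α 0 (K X))) ∧
                    ∀ x₀ ∈ X, ∀ φ' : Torus (L ^ R) → ℝ,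
                      tNorm h L (j + 1) (CoulombGas.star L j X)
                          (fun φ => rem 2
                            (fluctuationExp Γ (chargedComponent α 0 (K X))) (delta x₀ φ)) φ'
                        ≤ ENNReal.ofReal ((L : ℝ) ^ (-(2 + ϑ)))
                          * activityNorm c₁ c₃ (kappa c₀ L) h A L j K
                          * ENNReal.ofReal ((A / 2) ^ (-(blockCount L j X : ℤ)))
                          * ENNReal.ofReal
                              (regulator c₁ c₃ (kappa c₀ L) L (j + 1) φ'
                                (CoulombGas.closure L (j + 1) X)) := by
  refine ⟨1 / 2, by norm_num, fun C c c₁ c₃ c₀ hc₁ hc₃ hc₀ => ?_⟩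
  -- Orders $2,4,6,8$ are the variances of the derivatives of order one to four that enter the
  -- regulator and its Sobolev majorant; the $1$ ensures positivity.
  set K₀ : ℝ := 1 + |C 2| + |C 4| + |C 6| + |C 8| with hK₀
  have a2 := abs_nonneg (C 2)
  have a4 := abs_nonneg (C 4)
  have a6 := abs_nonneg (C 6)
  have a8 := abs_nonneg (C 8)
  have hK₀pos : 0 < K₀ := by positivity
  obtain ⟨L₀, hL₀⟩ := exists_scale_bound (c₁ := c₁) (c₃ := c₃) (c₀ := c₀) (K := K₀) hc₁ hc₀
  refine ⟨L₀, fun L _ hLL hL1 hL R j hj Γ hΓ h A α hh hA hα K hK hKfin X hX => ?_⟩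
  obtain ⟨h80, hsmall, hLc, hscale⟩ := hL₀ L hLL
  have hd : L ^ (j + 1) ∣ L ^ R := pow_dvd_pow L hj
  have hdj : L ^ j ∣ L ^ R := pow_dvd_pow L hj.le
  have hN : 3 ≤ L ^ R := le_trans (by omega) (Nat.le_self_pow (by omega) L)
  have hκ : 0 < kappa c₀ L := div_pos hc₀ (Real.log_pos (by exact_mod_cast hL1))
  have hA0 : 0 < A := by linarith
  obtain ⟨k, hk, hk0, hk2, hk1⟩ := hX.exists_fluctuation_weight hL hdj hΓ hK₀pos
    (by linarith [le_abs_self (C 2)]) (by linarith [le_abs_self (C 4)])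
    (by linarith [le_abs_self (C 6)]) (by linarith [le_abs_self (C 8)]) hc₁ hc₃ hκ hsmall
  set nK := (activityNorm c₁ c₃ (kappa c₀ L) h A L j K).toReal with hnK
  have hnK0 : 0 ≤ nK := ENNReal.toReal_nonneg
  have hpow : 0 < A ^ blockCount L j X := by positivity
  have hle : ∀ φ, tNorm h L j (CoulombGas.star L j X) (K X) φ ≤
      ENNReal.ofReal (nK * (A ^ blockCount L j X)⁻¹ * regulator c₁ c₃ (kappa c₀ L) L j φ X) :=
    tNorm_le_of_activityNorm hA0 hKfin hX.1
  obtain ⟨hint, hsm, hloc, hbound⟩ := hX.derivBound_fluctuationExp hL hdj hN hc₁.le hc₃.le hκ.le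
    (by linarith) hα (by positivity) (hK.smooth X hX.1) (hK.isLocal X hX.1)
    hle hk hk0 hk1
  refine ⟨hint, hsm, fun x₀ hx₀ φ' => ?_⟩
  set I := ∫ ζ, k ζ ∂(fluctuationMeasure Γ) with hI
  have hI0 : 0 ≤ I := MeasureTheory.integral_nonneg hk0
  refine (hX.tNorm_rem_le hL h80 hd hN hc₁ hc₃ hκ hLc hh (by positivity) hsm hloc hbound
    hx₀ φ').trans ?_
  have hnorm : activityNorm c₁ c₃ (kappa c₀ L) h A L j K = ENNReal.ofReal nK :=
    (ENNReal.ofReal_toReal hKfin).symm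
  clear_value nK
  rw [hnorm, ← ENNReal.ofReal_mul (by positivity),
    ← ENNReal.ofReal_mul (by positivity), ← ENNReal.ofReal_mul (by positivity)]
  apply ENNReal.ofReal_le_ofReal
  have hreg : 0 < regulator c₁ c₃ (kappa c₀ L) L (j + 1) φ' (closure L (j + 1) X) := Real.exp_pos _
  refine mul_le_mul_of_nonneg_right ?_ hreg.le
  have hinv : (A ^ blockCount L j X)⁻¹ ≤ (A / 2) ^ (-(blockCount L j X : ℤ)) := by
    rw [zpow_neg, zpow_natCast]
    gcongr
    linarith
  calc 48 * (nK * (A ^ blockCount L j X)⁻¹ * I) * (40 / (L : ℝ)) ^ 3 *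
        (1 + 8 / (c₁ * kappa c₀ L / 72) ^ 2)
      ≤ 48 * (nK * (A ^ blockCount L j X)⁻¹ * 2) * (40 / (L : ℝ)) ^ 3 *
        (1 + 8 / (c₁ * kappa c₀ L / 72) ^ 2) := by gcongr
    _ = 96 * (40 / (L : ℝ)) ^ 3 * (1 + 8 / (c₁ * kappa c₀ L / 72) ^ 2) * nK *
        (A ^ blockCount L j X)⁻¹ := by ring
    _ ≤ _ := by gcongr
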